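/- Conventions. An N-manifold $Y$ with body a smooth manifold $M$ (finite-dimensional, without boundary, Hausdorff, $\sigma$-compact) is a supermanifold with an action of the monoid $(\mathbb R,\times)$ in which $-1$ acts as the parity operator; equivalently, it is given by a sheaf of $\mathbb N$-graded, graded-commutative algebras on $M$ which is $C^\infty_M$ in degree $0$ and is locally freely generated over $C^\infty_M$ by finitely many coordinates of positive degrees. An NQ-manifold is an N-manifold with a vector field $Q$ of degree $1$ with $Q^2=0$. For $n\ge 0$ let $B^n\subset\mathbb R^n$ be the closed unit ball with boundary $S^{n-1}$ (so $S^{-1}=\emptyset$); $T[1]B^n$ and $T[1]S^{n-1}$ are the NQ-manifolds whose functions are the differential forms, with $Q$ the de Rham differential, and $Y\times T[1]B^n$ carries the sum of the two vector fields $Q$. An NQ vector bundle $E$ on an NQ-manifold is a $\mathbb Z$-graded vector bundle (its sheaf of sections is a graded module, locally free of finite rank on homogeneous generators) with an $\mathbb R$-linear operator $D$ of degree $1$ on its sections such that $D^2=0$ and $D(fs)=(Qf)s+(-1)^{|f|}f\,Ds$. Thus its homogeneous sections form a cochain complex $\Gamma(E)=\bigoplus_d\Gamma(E)^d$. Lemma.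 Let $Y$ be an NQ-manifold, $n\ge 0$, and let $E\to Y\times T[1]B^n$ be an NQ vector bundle. Let $E_0$ be the restriction of $E$ to $Y$, embedded in $Y\times T[1]B^n$ as $Y\times\{\text{centre of the ball}\}$, with the induced differential, and let $\Gamma_0(E)\subset\Gamma(E)$ be the subcomplex of the sections whose restriction to $Y\times T[1]S^{n-1}$ vanishes. Then $H(\Gamma_0(E))$ is isomorphic to $H(\Gamma(E_0))$ shifted by $n$: for every $d\in\mathbb Z$ there is an isomorphism of real vector spaces $$H^{d+n}(\Gamma_0(E))\;\cong\;H^{d}(\Gamma(E_0)).$$ -/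

import Mathlib

open scoped Manifold ContDiff TensorProduct

universe u v

noncomputable section

/-- The closed unit ball `Bⁿ ⊂ ℝⁿ`. -/
abbrev UnitBall (n : ℕ) : Type := Metric.closedBall (0 : EuclideanSpace ℝ (Fin n)) 1

namespace UnitBall

/-- The centre of the ball. -/
def centre (n : ℕ) : UnitBall n := ⟨0, by simp⟩

/-- The radial retraction of `ℝⁿ` onto the ball. -/
def retract (n : ℕ) (x : EuclideanSpace ℝ (Fin n)) : UnitBall n :=
  ⟨(max 1 ‖x‖)⁻¹ • x, by
    have h : (0 : ℝ) < max 1 ‖x‖ := lt_of_lt_of_le one_pos (le_max_left _ _)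
    rw [mem_closedBall_zero_iff, norm_smul, norm_inv, Real.norm_of_nonneg h.le,
      inv_mul_le_one₀ h]
    exact le_max_right _ _⟩

lemma retract_coe {n : ℕ} (b : UnitBall n) : retract n b = b := by
  apply Subtype.ext
  have : ‖(b : EuclideanSpace ℝ (Fin n))‖ ≤ 1 := mem_closedBall_zero_iff.1 b.2
  simp [retract, max_eq_left this]

lemma continuous_retract (n : ℕ) : Continuous (retract n) := by
  refine Continuous.subtype_mk ?_ _
  refine Continuous.smul (Continuous.inv₀ (continuous_const.max continuous_norm) fun x => ?_)
    continuous_id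
  exact (lt_of_lt_of_le one_pos (le_max_left _ _)).ne'

/-- The ball as a manifold with boundary: it is covered by one chart, the inclusion into `ℝⁿ`. So
a function on the ball is smooth if it is smooth up to the boundary as a function on a subset of
`ℝⁿ`. -/
def model (n : ℕ) : ModelWithCorners ℝ (EuclideanSpace ℝ (Fin n)) (UnitBall n) :=
  ModelWithCorners.ofConvexRange
    { toFun := Subtype.val
      invFun := retract n
      source := Set.univ
      target := Metric.closedBall 0 1
      map_source' := fun b _ => b.2
      map_target' := fun _ _ => Set.mem_univ _
      left_inv' := fun b _ => retract_coe b
      right_inv' := fun x hx => congrArg Subtype.val (retract_coe ⟨x, hx⟩) }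
    rfl (convex_closedBall _ _) continuous_subtype_val (continuous_retract n)
    ⟨0, Metric.ball_subset_interior_closedBall (by simp)⟩

end UnitBall

/-- The exponents of the monomials in graded-commuting variables of degrees `w i`: a variable of
odd degree occurs at most once. -/
abbrev Exponent {r : ℕ} (w : Fin r → ℕ) : Type := {α : Fin r → ℕ // ∀ i, Odd (w i) → α i ≤ 1}

/-- The ordered monomial `ξ₀ ^ α₀ * ξ₁ ^ α₁ * ⋯`. -/
def orderedMonomial {A : Type*} [Monoid A] {r : ℕ} (ξ : Fin r → A) (α : Fin r → ℕ) : A :=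
  (List.ofFn fun i => ξ i ^ α i).prod

lemma orderedMonomial_succ {A : Type*} [Monoid A] {r : ℕ} (ξ : Fin (r + 1) → A)
    (α : Fin (r + 1) → ℕ) : orderedMonomial ξ α =
      ξ 0 ^ α 0 * orderedMonomial (fun i => ξ i.succ) (fun i => α i.succ) := by
  simp [orderedMonomial, List.ofFn_succ]

lemma orderedMonomial_mem {A : Type*} [Ring A] [Algebra ℝ A] (gr : ℕ → Submodule ℝ A)
    [GradedAlgebra gr] {r : ℕ} (w : Fin r → ℕ) (ξ : Fin r → A) (hξ : ∀ i, ξ i ∈ gr (w i))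
    (α : Fin r → ℕ) : orderedMonomial ξ α ∈ gr (∑ i, α i * w i) := by
  induction r with
  | zero => simpa [orderedMonomial] using SetLike.GradedOne.one_mem
  | succ r ih =>
    rw [orderedMonomial_succ, Fin.sum_univ_succ]
    refine SetLike.GradedMul.mul_mem ?_ (ih _ _ (fun i => hξ i.succ) _)
    simpa using SetLike.pow_mem_graded (α 0) (hξ 0)

lemma exists_orderedMonomial_mul {r : ℕ} (w : Fin r → ℕ) (α β : Fin r → ℕ) :
    ∃ t : ℝ, ∀ (A : Type u) [Ring A] [Algebra ℝ A] (gr : ℕ → Submodule ℝ A) [GradedAlgebra gr]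
      (_ : ∀ i j, ∀ a ∈ gr i, ∀ b ∈ gr j, a * b = (-1 : ℝ) ^ (i * j) • (b * a))
      (ξ : Fin r → A) (_ : ∀ i, ξ i ∈ gr (w i)),
      orderedMonomial ξ α * orderedMonomial ξ β = t • orderedMonomial ξ (α + β) := by
  induction r with
  | zero => exact ⟨1, fun A _ _ gr _ _ ξ _ => by simp [orderedMonomial]⟩
  | succ r ih =>
    obtain ⟨t, ht⟩ := ih (fun i => w i.succ) (fun i => α i.succ) (fun i => β i.succ)
    refine ⟨(-1) ^ ((∑ i : Fin r, α i.succ * w i.succ) * (β 0 * w 0)) * t, ?_⟩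
    intro A _ _ gr _ hc ξ hξ
    have h1 := hc _ _ _ (orderedMonomial_mem gr (fun i => w i.succ) (fun i => ξ i.succ)
      (fun i => hξ i.succ) (fun i => α i.succ)) _ (by
        simpa using SetLike.pow_mem_graded (β 0) (hξ 0) : ξ 0 ^ β 0 ∈ gr (β 0 * w 0))
    have h2 := ht A gr hc (fun i => ξ i.succ) (fun i => hξ i.succ)
    rw [orderedMonomial_succ, orderedMonomial_succ ξ β, orderedMonomial_succ ξ (α + β), mul_assoc,
      ← mul_assoc _ (ξ 0 ^ β 0), h1, smul_mul_assoc, mul_assoc, h2, mul_smul_comm, mul_smul_comm,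
      mul_smul_comm, mul_smul, Pi.add_apply, pow_add, mul_assoc]
    rfl

lemma orderedMonomial_eq_zero {A : Type*} [Ring A] [Algebra ℝ A] (gr : ℕ → Submodule ℝ A)
    (hc : ∀ i j, ∀ a ∈ gr i, ∀ b ∈ gr j, a * b = (-1 : ℝ) ^ (i * j) • (b * a))
    {r : ℕ} (w : Fin r → ℕ) (ξ : Fin r → A) (hξ : ∀ i, ξ i ∈ gr (w i))
    (α : Fin r → ℕ) (i : Fin r) (hi : Odd (w i)) (hα : 1 < α i) : orderedMonomial ξ α = 0 := by
  induction r with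
  | zero => exact i.elim0
  | succ r ih =>
    rw [orderedMonomial_succ]
    induction i using Fin.cases with
    | zero =>
      have h := hc _ _ _ (hξ 0) _ (hξ 0)
      rw [(hi.mul hi).neg_one_pow, neg_one_smul, eq_neg_iff_add_eq_zero, ← two_smul ℝ] at h
      replace h := (smul_eq_zero_iff_right (two_ne_zero : (2 : ℝ) ≠ 0)).1 h
      obtain ⟨k, hk⟩ := Nat.exists_eq_add_of_lt hα
      rw [show α 0 = 2 + k by omega, pow_add, pow_two, h, zero_mul, zero_mul]
    | succ i => rw [ih _ (fun i => ξ i.succ) (fun i => hξ i.succ) _ i hi hα, mul_zero]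

/-- Graded coordinates on an open set `dom` for a family of graded algebras: homogeneous elements
`ξ i` of positive degree which freely generate the algebra over each point, in the sense of
graded-commutative algebras (the ordered monomials form a basis). -/
structure LocalCoordinates {M : Type*} [TopologicalSpace M] (fib : M → Type u)
    [∀ m, Ring (fib m)] [∀ m, Algebra ℝ (fib m)] (gr : ∀ m, ℕ → Submodule ℝ (fib m)) where
  dom : TopologicalSpace.Opens M
  r : ℕ
  w : Fin r → ℕ
  w_pos : ∀ i, 0 < w i
  ξ : Fin r → ∀ m, fib m
  ξ_mem : ∀ i, ∀ m ∈ dom, ξ i m ∈ gr m (w i)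
  basis : ∀ m ∈ dom, Module.Basis (Exponent w) ℝ (fib m)
  basis_apply : ∀ m hm α, basis m hm α = orderedMonomial (fun i => ξ i m) α.1

open Classical in
/-- The coefficient functions of a family `f` in graded coordinates. -/
def LocalCoordinates.coeff {M : Type*} [TopologicalSpace M] {fib : M → Type u}
    [∀ m, Ring (fib m)] [∀ m, Algebra ℝ (fib m)] {gr : ∀ m, ℕ → Submodule ℝ (fib m)}
    (c : LocalCoordinates fib gr) (f : ∀ m, fib m) (α : Exponent c.w) (m : M) : ℝ :=
  if h : m ∈ c.dom then (c.basis m h).repr (f m) α else 0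

namespace LocalCoordinates

variable {M : Type*} [TopologicalSpace M] {fib : M → Type u}
    [∀ m, Ring (fib m)] [∀ m, Algebra ℝ (fib m)] {gr : ∀ m, ℕ → Submodule ℝ (fib m)}
    (c : LocalCoordinates fib gr)

/-- The degree of a monomial. -/
def weight {r : ℕ} (w : Fin r → ℕ) (α : Fin r → ℕ) : ℕ := ∑ i, α i * w i

lemma coeff_of_mem {m : M} (hm : m ∈ c.dom) (f : ∀ m, fib m) (α : Exponent c.w) :
    c.coeff f α m = (c.basis m hm).repr (f m) α := dif_pos hm

lemma coeff_zero (α : Exponent c.w) : c.coeff 0 α = 0 := by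
  ext m; by_cases h : m ∈ c.dom <;> simp [coeff, h]

lemma coeff_add (f g : ∀ m, fib m) (α : Exponent c.w) :
    c.coeff (f + g) α = c.coeff f α + c.coeff g α := by
  ext m; by_cases h : m ∈ c.dom <;> simp [coeff, h]

lemma coeff_smul (t : ℝ) (f : ∀ m, fib m) (α : Exponent c.w) :
    c.coeff (t • f) α = t • c.coeff f α := by
  ext m; by_cases h : m ∈ c.dom <;> simp [coeff, h]

lemma finite_weight (k : ℕ) : {α : Exponent c.w | weight c.w α.1 = k}.Finite := by
  refine Set.Finite.of_finite_image (f := Subtype.val) ?_ Subtype.val_injective.injOn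
  refine (Set.finite_Icc (0 : Fin c.r → ℕ) (fun _ => k)).subset ?_
  rintro _ ⟨α, hα, rfl⟩
  refine ⟨fun i => Nat.zero_le _, fun i => ?_⟩
  rw [← (show weight c.w α.1 = k from hα)]
  exact (Nat.le_mul_of_pos_right _ (c.w_pos i)).trans
    (Finset.single_le_sum (f := fun i => α.1 i * c.w i) (fun _ _ => Nat.zero_le _)
      (Finset.mem_univ i))

variable [∀ m, GradedAlgebra (gr m)]

lemma basis_mem {m : M} (hm : m ∈ c.dom) (α : Exponent c.w) :
    c.basis m hm α ∈ gr m (weight c.w α.1) := by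
  rw [c.basis_apply]
  exact orderedMonomial_mem (gr m) c.w _ (fun i => c.ξ_mem i m hm) _

lemma repr_eq_zero {m : M} (hm : m ∈ c.dom) {k : ℕ} {a : fib m} (ha : a ∈ gr m k)
    (α : Exponent c.w) (hα : weight c.w α.1 ≠ k) : (c.basis m hm).repr a α = 0 := by
  classical
  set B := c.basis m hm
  let L : fib m →ₗ[ℝ] ℝ := (B.coord α) ∘ₗ GradedAlgebra.proj (gr m) k
  have hL : L = 0 := by
    refine B.ext fun β => ?_
    change B.coord α ((DirectSum.decompose (gr m) (B β) k : gr m k) : fib m) = 0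
    by_cases h : weight c.w β.1 = k
    · rw [DirectSum.decompose_of_mem_same _ (h ▸ c.basis_mem hm β), Module.Basis.coord_apply,
        B.repr_self, Finsupp.single_eq_of_ne]
      rintro rfl
      exact hα h
    · rw [DirectSum.decompose_of_mem_ne _ (c.basis_mem hm β) h, map_zero]
  have := LinearMap.congr_fun hL a
  change B.coord α ((DirectSum.decompose (gr m) a k : gr m k) : fib m) = 0 at this
  rwa [DirectSum.decompose_of_mem_same _ ha] at this

/-- The exponents of the monomials of degree `k`. -/
def exponents (k : ℕ) : Finset (Exponent c.w) := (c.finite_weight k).toFinset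

lemma sum_coeff {m : M} (hm : m ∈ c.dom) {k : ℕ} {f : ∀ m, fib m} (hf : f m ∈ gr m k) :
    f m = ∑ α ∈ c.exponents k, c.coeff f α m • c.basis m hm α := by
  classical
  conv_lhs => rw [← (c.basis m hm).linearCombination_repr (f m), Finsupp.linearCombination_apply]
  rw [Finsupp.sum_of_support_subset (s := c.exponents k)]
  · simp_rw [c.coeff_of_mem hm]
  · intro α hα
    simp only [exponents, Set.Finite.mem_toFinset, Set.mem_ofPred_eq]
    by_contra h
    exact (Finsupp.mem_support_iff.1 hα) (c.repr_eq_zero hm hf α h)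
  · simp

lemma exists_repr_mul (α β δ : Exponent c.w)
    (hc : ∀ m i j, ∀ a ∈ gr m i, ∀ b ∈ gr m j, a * b = (-1 : ℝ) ^ (i * j) • (b * a)) :
    ∃ t : ℝ, ∀ m hm, (c.basis m hm).repr (c.basis m hm α * c.basis m hm β) δ = t := by
  classical
  obtain ⟨t, ht⟩ := exists_orderedMonomial_mul.{u} c.w α.1 β.1
  refine ⟨t * if α.1 + β.1 = δ.1 then 1 else 0, fun m hm => ?_⟩
  have h := ht (fib m) (gr m) (hc m) (fun i => c.ξ i m) (fun i => c.ξ_mem i m hm)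
  rw [c.basis_apply m hm α, c.basis_apply m hm β, h, map_smul, Finsupp.smul_apply, smul_eq_mul]
  congr 1
  by_cases hadm : ∀ i, Odd (c.w i) → (α.1 + β.1) i ≤ 1
  · rw [← c.basis_apply m hm ⟨_, hadm⟩, Module.Basis.repr_self, Finsupp.single_apply]
    exact if_congr Subtype.ext_iff rfl rfl
  · push Not at hadm
    obtain ⟨i, hi, h1⟩ := hadm
    rw [orderedMonomial_eq_zero (gr m) (hc m) c.w _ (fun i => c.ξ_mem i m hm) _ i hi h1, map_zero,
      if_neg]
    · rfl
    · intro h2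
      exact absurd (δ.2 i hi) (by rw [← h2]; omega)

end LocalCoordinates

section NManifold

variable {EM : Type*} [NormedAddCommGroup EM] [NormedSpace ℝ EM] {H : Type*} [TopologicalSpace H]

/-- An N-manifold with body `M`. The graded structure sheaf has `C^∞(M)` in degree `0` and is
locally free of finite rank over `C^∞(M)` in each degree, so it is given by the bundle of its
fibres `fib m = ⨁ k, gr m k`, which are graded-commutative algebras. Locally the functions are the
polynomials, with coefficients which are smooth on the body, in finitely many coordinates of positive
degree. -/
structure NManifold (I : ModelWithCorners ℝ EM H) (M : Type*) [TopologicalSpace M]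
    [ChartedSpace H M] where
  fib : M → Type u
  [ring : ∀ m, Ring (fib m)]
  [algebra : ∀ m, Algebra ℝ (fib m)]
  gr : ∀ m, ℕ → Submodule ℝ (fib m)
  [graded : ∀ m, GradedAlgebra (gr m)]
  gcomm : ∀ m i j, ∀ a ∈ gr m i, ∀ b ∈ gr m j, a * b = (-1 : ℝ) ^ (i * j) • (b * a)
  atlas : Set (LocalCoordinates fib gr)
  cover : ∀ m, ∃ c ∈ atlas, m ∈ c.dom
  compat : ∀ c ∈ atlas, ∀ c' ∈ atlas, ∀ i β,
    ContMDiffOn I 𝓘(ℝ, ℝ) ∞ (c'.coeff (c.ξ i) β) (c.dom ∩ c'.dom)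

attribute [instance] NManifold.ring NManifold.algebra NManifold.graded

variable {I : ModelWithCorners ℝ EM H} {M : Type*} [TopologicalSpace M] [ChartedSpace H M]

namespace NManifold

variable (P : NManifold.{u} I M)

/-- A family of elements of the fibres is smooth on `U` if its coefficients in all graded
coordinates are smooth functions. -/
def SmoothOn (f : ∀ m, P.fib m) (U : Set M) : Prop :=
  ∀ c ∈ P.atlas, ∀ α, ContMDiffOn I 𝓘(ℝ, ℝ) ∞ (c.coeff f α) (U ∩ c.dom)

variable {P} in
lemma SmoothOn.add {f g : ∀ m, P.fib m} {U : Set M} (hf : P.SmoothOn f U) (hg : P.SmoothOn g U) :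
    P.SmoothOn (f + g) U := fun c hc α => by
  rw [c.coeff_add]; exact (hf c hc α).add (hg c hc α)

variable {P} in
lemma SmoothOn.smul {f : ∀ m, P.fib m} {U : Set M} (hf : P.SmoothOn f U) (t : ℝ) :
    P.SmoothOn (t • f) U := fun c hc α => by
  rw [c.coeff_smul]; exact contMDiffOn_const.mul (hf c hc α)

lemma smoothOn_zero (U : Set M) : P.SmoothOn 0 U := fun c _ α => by
  rw [c.coeff_zero]; exact contMDiffOn_const

variable {P} in
lemma SmoothOn.mono {f : ∀ m, P.fib m} {U V : Set M} (hf : P.SmoothOn f U) (h : V ⊆ U) :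
    P.SmoothOn f V := fun c hc α => (hf c hc α).mono (Set.inter_subset_inter_left _ h)

variable {P} in
lemma SmoothOn.congr {f g : ∀ m, P.fib m} {U : Set M} (hf : P.SmoothOn f U)
    (h : ∀ m ∈ U, g m = f m) : P.SmoothOn g U := fun c hc α =>
  (hf c hc α).congr fun m hm => by rw [c.coeff_of_mem hm.2, c.coeff_of_mem hm.2, h m hm.1]

variable {P} in
lemma SmoothOn.mul {f g : ∀ m, P.fib m} {U : Set M} (hf : P.SmoothOn f U) (hg : P.SmoothOn g U)
    {k l : ℕ} (hfk : ∀ m ∈ U, f m ∈ P.gr m k) (hgl : ∀ m ∈ U, g m ∈ P.gr m l) :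
    P.SmoothOn (f * g) U := fun c hc δ => by
  choose t ht using fun α β => c.exists_repr_mul α β δ P.gcomm
  have key : ContMDiffOn I 𝓘(ℝ, ℝ) ∞ (fun m => ∑ α ∈ c.exponents k, ∑ β ∈ c.exponents l,
      c.coeff f α m * c.coeff g β m * t α β) (U ∩ c.dom) :=
    contMDiffOn_finsetSum fun α _ => contMDiffOn_finsetSum fun β _ =>
      ((hf c hc α).mul (hg c hc β)).mul contMDiffOn_const
  refine key.congr fun m hm => ?_
  rw [c.coeff_of_mem hm.2, Pi.mul_apply, c.sum_coeff hm.2 (hfk m hm.1),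
    c.sum_coeff hm.2 (hgl m hm.1), Finset.sum_mul_sum]
  simp only [map_sum, Finsupp.coe_finsetSum, Finset.sum_apply, smul_mul_smul_comm, map_smul,
    Finsupp.smul_apply, ht _ _ m hm.2, smul_eq_mul]

/-- The functions of degree `k` on the N-manifold. -/
def functions (k : ℕ) : Submodule ℝ (∀ m, P.fib m) where
  carrier := {f | (∀ m, f m ∈ P.gr m k) ∧ P.SmoothOn f Set.univ}
  zero_mem' := ⟨fun _ => zero_mem _, P.smoothOn_zero _⟩
  add_mem' hf hg := ⟨fun m => add_mem (hf.1 m) (hg.1 m), hf.2.add hg.2⟩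
  smul_mem' t _ hf := ⟨fun m => Submodule.smul_mem _ t (hf.1 m), hf.2.smul t⟩

/-- The grading by all integers, which is zero in negative degrees. -/
def grZ (m : M) : ℤ → Submodule ℝ (P.fib m)
  | Int.ofNat k => P.gr m k
  | Int.negSucc _ => ⊥

end NManifold

/-- An NQ-manifold: an N-manifold with a vector field `Q` (a graded derivation of the functions)
of degree one and of square zero. Only the values of `Q` on the homogeneous smooth functions have a
meaning. -/
structure NQManifold (I : ModelWithCorners ℝ EM H) (M : Type*) [TopologicalSpace M]
    [ChartedSpace H M] extends NManifold.{u} I M where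
  Q : (∀ m, fib m) → ∀ m, fib m
  Q_mem : ∀ k, ∀ f ∈ toNManifold.functions k, Q f ∈ toNManifold.functions (k + 1)
  Q_add : ∀ k, ∀ f ∈ toNManifold.functions k, ∀ g ∈ toNManifold.functions k, Q (f + g) = Q f + Q g
  Q_smul : ∀ k, ∀ f ∈ toNManifold.functions k, ∀ t : ℝ, Q (t • f) = t • Q f
  Q_mul : ∀ k l, ∀ f ∈ toNManifold.functions k, ∀ g ∈ toNManifold.functions l,
    Q (f * g) = Q f * g + (-1 : ℝ) ^ k • (f * Q g)
  Q_Q : ∀ k, ∀ f ∈ toNManifold.functions k, Q (Q f) = 0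

/-! ### Differential forms on the ball -/

/-- The exterior algebra of the cotangent space of the ball at any of its points. -/
abbrev Covectors (n : ℕ) : Type :=
  ExteriorAlgebra ℝ (Module.Dual ℝ (EuclideanSpace ℝ (Fin n)))

namespace Covectors

/-- The degree of forms. -/
abbrev gr (n : ℕ) (k : ℕ) : Submodule ℝ (Covectors n) :=
  ⋀[ℝ]^k (Module.Dual ℝ (EuclideanSpace ℝ (Fin n)))

/-- The standard basis of the cotangent space. -/
def coordBasis (n : ℕ) : Module.Basis (Fin n) ℝ (Module.Dual ℝ (EuclideanSpace ℝ (Fin n))) :=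
  (EuclideanSpace.basisFun (Fin n) ℝ).toBasis.dualBasis

/-- The coordinate differentials `θ i = d x_i`. -/
def θ {n : ℕ} (i : Fin n) : Covectors n := ExteriorAlgebra.ι ℝ (coordBasis n i)

/-- The basis of the ordered products `θ s` of coordinate differentials. -/
def basis (n : ℕ) : Module.Basis (Finset (Fin n)) ℝ (Covectors n) := (coordBasis n).ExteriorAlgebra

lemma θ_mem {n : ℕ} (i : Fin n) : θ i ∈ gr n 1 := by
  simp [θ, gr, ExteriorAlgebra.exteriorPower]

lemma gcomm_ι {n j : ℕ} (v : Module.Dual ℝ (EuclideanSpace ℝ (Fin n))) {y : Covectors n}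
    (hy : y ∈ gr n j) : ExteriorAlgebra.ι ℝ v * y = (-1 : ℝ) ^ j • (y * ExteriorAlgebra.ι ℝ v) := by
  induction hy using Submodule.pow_induction_on_left' with
  | algebraMap r => rw [pow_zero, one_smul, Algebra.commutes]
  | add x y i hx hy h1 h2 => rw [mul_add, add_mul, smul_add, h1, h2]
  | mem_mul m hm i x hx h =>
    obtain ⟨u, rfl⟩ := hm
    rw [← mul_assoc, eq_neg_of_add_eq_zero_left (ExteriorAlgebra.ι_add_mul_swap v u), neg_mul,
      mul_assoc, h, mul_smul_comm, pow_succ, mul_neg_one, neg_smul, mul_assoc]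

lemma gcomm {n : ℕ} (i j : ℕ) (x : Covectors n) (hx : x ∈ gr n i) (y : Covectors n)
    (hy : y ∈ gr n j) : x * y = (-1 : ℝ) ^ (i * j) • (y * x) := by
  induction hx using Submodule.pow_induction_on_left' with
  | algebraMap r => rw [zero_mul, pow_zero, one_smul, Algebra.commutes]
  | add x x' i hx hx' h1 h2 => rw [mul_add, add_mul, smul_add, h1, h2]
  | mem_mul m hm i x hx h =>
    obtain ⟨u, rfl⟩ := hm
    rw [mul_assoc, h, mul_smul_comm, ← mul_assoc, gcomm_ι u hy, smul_mul_assoc, smul_smul,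
      ← pow_add, mul_assoc, Nat.succ_mul]

/-- The exponents of the monomials in `n` variables of degree one are the subsets of `Fin n`. -/
def exponentEquiv (n : ℕ) : Exponent (fun _ : Fin n => 1) ≃ Finset (Fin n) where
  toFun α := Finset.univ.filter fun i => α.1 i = 1
  invFun s := ⟨fun i => if i ∈ s then 1 else 0, fun i _ => by dsimp only; split_ifs <;> simp⟩
  left_inv α := by
    ext i
    have := α.2 i odd_one
    simp only [Finset.mem_filter, Finset.mem_univ, true_and]
    split_ifs with h <;> omega
  right_inv s := by ext i; simp

lemma sort_eq_filter {n : ℕ} (s : Finset (Fin n)) :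
    s.sort = (List.finRange n).filter (· ∈ s) := by
  refine List.Perm.eq_of_sortedLE s.sortedLT_sort.sortedLE ?_ ?_
  · exact ((List.pairwise_lt_finRange n).filter _).imp (fun h => le_of_lt h) |>.sortedLE
  · rw [List.perm_ext_iff_of_nodup (s.sort_nodup _) ((List.nodup_finRange n).filter _)]
    simp

lemma basis_eq {n : ℕ} (α : Exponent (fun _ : Fin n => 1)) :
    basis n (exponentEquiv n α) = orderedMonomial θ α.1 := by
  obtain ⟨s, rfl⟩ := (exponentEquiv n).symm.surjective α
  rw [Equiv.apply_symm_apply, basis, ExteriorAlgebra.basis_apply_ofCard (coordBasis n) rfl,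
    ExteriorAlgebra.ιMulti_family.eq_1, ExteriorAlgebra.ιMulti_apply, orderedMonomial]
  have h1 : (List.ofFn fun i => θ i ^ ((exponentEquiv n).symm s).1 i).prod =
      ((s.sort).map θ).prod := by
    rw [sort_eq_filter, List.ofFn_eq_map]
    induction List.finRange n with
    | nil => simp
    | cons a l ih =>
      rw [List.map_cons, List.prod_cons, ih, List.filter_cons]
      by_cases h : a ∈ s <;> simp [h, exponentEquiv]
  rw [h1]
  congr 1
  refine List.ext_getElem (by simp) fun i h2 h3 => ?_
  simp [θ, Set.powersetCard.ofFinEmbEquiv_symm_apply, Finset.orderEmbOfFin_apply]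

end Covectors

/-! ### The product with the shifted tangent bundle of the ball -/

open scoped TensorProduct in
/-- The total grading of a graded tensor product. -/
def tensorGr {A B : Type*} [Ring A] [Ring B] [Algebra ℝ A] [Algebra ℝ B]
    (𝒜 : ℕ → Submodule ℝ A) (ℬ : ℕ → Submodule ℝ B) [GradedAlgebra 𝒜] [GradedAlgebra ℬ] (k : ℕ) :
    Submodule ℝ (GradedTensorProduct ℝ 𝒜 ℬ) :=
  Submodule.span ℝ {t | ∃ i j, i + j = k ∧ ∃ a ∈ 𝒜 i, ∃ b ∈ ℬ j, t = GradedTensorProduct.tmul ℝ a b}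

namespace tensorGr

variable {A : Type*} {B : Type*} [Ring A] [Ring B] [Algebra ℝ A] [Algebra ℝ B]
    (𝒜 : ℕ → Submodule ℝ A) (ℬ : ℕ → Submodule ℝ B) [GradedAlgebra 𝒜] [GradedAlgebra ℬ]

lemma tmul_mem {i j k : ℕ} (h : i + j = k) {a : A} (ha : a ∈ 𝒜 i) {b : B} (hb : b ∈ ℬ j) :
    (GradedTensorProduct.tmul ℝ a b : GradedTensorProduct ℝ 𝒜 ℬ) ∈ tensorGr 𝒜 ℬ k :=
  Submodule.subset_span ⟨i, j, h, a, ha, b, hb, rfl⟩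

lemma tmul_mul {i j : ℕ} (a : A) {b : B} (hb : b ∈ ℬ i) {a' : A} (ha' : a' ∈ 𝒜 j) (b' : B) :
    (GradedTensorProduct.tmul ℝ a b * GradedTensorProduct.tmul ℝ a' b' :
      GradedTensorProduct ℝ 𝒜 ℬ) =
      (-1 : ℝ) ^ (i * j) • GradedTensorProduct.tmul ℝ (a * a') (b * b') := by
  have := GradedTensorProduct.tmul_coe_mul_coe_tmul (R := ℝ) 𝒜 ℬ a ⟨b, hb⟩ ⟨a', ha'⟩ b'
  refine this.trans ?_
  rcases Nat.even_or_odd (i * j) with h | h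
  · rw [h.neg_one_pow, h.neg_one_pow, one_smul, one_smul]
  · rw [h.neg_one_pow, h.neg_one_pow, neg_one_smul, Units.neg_smul, one_smul]

instance gradedMonoid : SetLike.GradedMonoid (tensorGr 𝒜 ℬ) where
  one_mem := tmul_mem 𝒜 ℬ (zero_add 0) SetLike.GradedOne.one_mem SetLike.GradedOne.one_mem
  mul_mem := by
    intro k l x y hx hy
    have : tensorGr 𝒜 ℬ k * tensorGr 𝒜 ℬ l ≤ tensorGr 𝒜 ℬ (k + l) := by
      rw [tensorGr, tensorGr, Submodule.span_mul_span, Submodule.span_le]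
      rintro _ ⟨_, ⟨i, j, hk, a, ha, b, hb, rfl⟩, _, ⟨i', j', hl, a', ha', b', hb', rfl⟩, rfl⟩
      dsimp only
      rw [tmul_mul 𝒜 ℬ a hb ha' b']
      exact Submodule.smul_mem _ _ (tmul_mem 𝒜 ℬ (by omega) (SetLike.GradedMul.mul_mem ha ha')
        (SetLike.GradedMul.mul_mem hb hb'))
    exact this (Submodule.mul_mem_mul hx hy)

/-- The decomposition of a tensor into its homogeneous components. -/
def decomposeMap : GradedTensorProduct ℝ 𝒜 ℬ →ₗ[ℝ] DirectSum ℕ fun k => tensorGr 𝒜 ℬ k :=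
  (TensorProduct.lift
    (DirectSum.toModule ℝ ℕ _ fun i => LinearMap.flip (DirectSum.toModule ℝ ℕ _ fun j =>
      LinearMap.flip (LinearMap.mk₂ ℝ
        (fun (a : 𝒜 i) (b : ℬ j) => DirectSum.lof ℝ ℕ (fun k => tensorGr 𝒜 ℬ k) (i + j)
          ⟨GradedTensorProduct.tmul ℝ (a : A) (b : B), tmul_mem 𝒜 ℬ rfl a.2 b.2⟩)
        (fun a a' b => by
          rw [← map_add]; exact congrArg _ (Subtype.ext (TensorProduct.add_tmul _ _ _)))
        (fun t a b => by
          rw [← map_smul]; congr 1)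
        (fun a b b' => by
          rw [← map_add]; exact congrArg _ (Subtype.ext (TensorProduct.tmul_add _ _ _)))
        (fun t a b => by
          rw [← map_smul]; exact congrArg _ (Subtype.ext (TensorProduct.tmul_smul _ _ _))))))) ∘ₗ
    (GradedTensorProduct.auxEquiv ℝ 𝒜 ℬ).toLinearMap

lemma decomposeMap_tmul {i j : ℕ} {a : A} (ha : a ∈ 𝒜 i) {b : B} (hb : b ∈ ℬ j) :
    decomposeMap 𝒜 ℬ (GradedTensorProduct.tmul ℝ a b) =
      DirectSum.lof ℝ ℕ (fun k => tensorGr 𝒜 ℬ k) (i + j)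
        ⟨GradedTensorProduct.tmul ℝ a b, tmul_mem 𝒜 ℬ rfl ha hb⟩ := by
  rw [decomposeMap, LinearMap.comp_apply, LinearEquiv.coe_coe, GradedTensorProduct.auxEquiv_tmul,
    DirectSum.decompose_of_mem _ ha, DirectSum.decompose_of_mem _ hb, ← DirectSum.lof_eq_of ℝ,
    ← DirectSum.lof_eq_of ℝ, TensorProduct.lift.tmul, DirectSum.toModule_lof,
    LinearMap.flip_apply, DirectSum.toModule_lof]
  rfl

instance decomposition : DirectSum.Decomposition (tensorGr 𝒜 ℬ) :=
  DirectSum.Decomposition.ofLinearMap (tensorGr 𝒜 ℬ) (decomposeMap 𝒜 ℬ)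
    (by
      apply GradedTensorProduct.hom_ext
      apply TensorProduct.ext
      refine DirectSum.decompose_lhom_ext 𝒜 fun i => LinearMap.ext fun a => ?_
      refine DirectSum.decompose_lhom_ext ℬ fun j => LinearMap.ext fun b => ?_
      have := decomposeMap_tmul 𝒜 ℬ a.2 b.2
      change DirectSum.coeLinearMap _ (decomposeMap 𝒜 ℬ (GradedTensorProduct.tmul ℝ _ _)) = _
      refine (congrArg _ this).trans ?_
      rw [DirectSum.coeLinearMap_lof]
      rfl)
    (by
      refine DirectSum.linearMap_ext ℝ fun k => LinearMap.ext ?_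
      rintro ⟨x, hx⟩
      rw [LinearMap.comp_apply, LinearMap.comp_apply, DirectSum.coeLinearMap_lof,
        LinearMap.id_comp]
      dsimp only
      induction hx using Submodule.span_induction with
      | mem x h =>
        obtain ⟨i, j, rfl, a, ha, b, hb, rfl⟩ := h
        exact decomposeMap_tmul 𝒜 ℬ ha hb
      | zero => rw [map_zero]; exact (map_zero _).symm
      | add x y hx hy h1 h2 => rw [map_add, h1, h2, ← map_add]; rfl
      | smul t x hx h => rw [map_smul, h, ← map_smul]; rfl)

instance gradedAlgebra : GradedAlgebra (tensorGr 𝒜 ℬ) where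
  toGradedMonoid := gradedMonoid 𝒜 ℬ
  toDecomposition := decomposition 𝒜 ℬ

lemma gcomm (hA : ∀ i j, ∀ a ∈ 𝒜 i, ∀ b ∈ 𝒜 j, a * b = (-1 : ℝ) ^ (i * j) • (b * a))
    (hB : ∀ i j, ∀ a ∈ ℬ i, ∀ b ∈ ℬ j, a * b = (-1 : ℝ) ^ (i * j) • (b * a)) (k l : ℕ)
    (x : GradedTensorProduct ℝ 𝒜 ℬ) (hx : x ∈ tensorGr 𝒜 ℬ k)
    (y : GradedTensorProduct ℝ 𝒜 ℬ) (hy : y ∈ tensorGr 𝒜 ℬ l) :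
    x * y = (-1 : ℝ) ^ (k * l) • (y * x) := by
  induction hx using Submodule.span_induction with
  | zero => simp
  | add x x' _ _ h1 h2 => rw [mul_add, add_mul, smul_add, h1, h2]
  | smul t x _ h => rw [mul_smul_comm, smul_mul_assoc, h, smul_comm]
  | mem x hx =>
    induction hy using Submodule.span_induction with
    | zero => simp
    | add x x' _ _ h1 h2 => rw [mul_add, add_mul, smul_add, h1, h2]
    | smul t x _ h => rw [mul_smul_comm, smul_mul_assoc, h, smul_comm]
    | mem y hy =>
      obtain ⟨i, j, rfl, a, ha, b, hb, rfl⟩ := hx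
      obtain ⟨i', j', rfl, a', ha', b', hb', rfl⟩ := hy
      rw [tmul_mul 𝒜 ℬ a hb ha' b', tmul_mul 𝒜 ℬ a' hb' ha b, hA _ _ a ha a' ha',
        hB _ _ b hb b' hb', smul_smul]
      have h1 : ∀ (s t : ℝ) (u : A) (v : B),
          (GradedTensorProduct.tmul ℝ (s • u) (t • v) : GradedTensorProduct ℝ 𝒜 ℬ) =
            (s * t) • GradedTensorProduct.tmul ℝ u v :=
        fun s t u v => TensorProduct.smul_tmul_smul s t u v
      rw [h1, smul_smul, ← pow_add, ← pow_add, ← pow_add, neg_one_pow_congr]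
      simp only [Nat.even_add, Nat.even_mul]
      tauto

end tensorGr

lemma orderedMonomial_append {A : Type*} [Monoid A] {r n : ℕ} (ξ : Fin r → A) (η : Fin n → A)
    (γ : Fin (r + n) → ℕ) : orderedMonomial (Fin.append ξ η) γ =
      orderedMonomial ξ (fun i => γ (Fin.castAdd n i)) *
        orderedMonomial η (fun i => γ (Fin.natAdd r i)) := by
  have : (fun i => Fin.append ξ η i ^ γ i) = Fin.append (fun i => ξ i ^ γ (Fin.castAdd n i))
      (fun i => η i ^ γ (Fin.natAdd r i)) := by
    ext i
    refine Fin.addCases (fun i => ?_) (fun i => ?_) i <;> simp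
  rw [orderedMonomial, this, List.ofFn_fin_append, List.prod_append, orderedMonomial,
    orderedMonomial]

lemma map_orderedMonomial {A B F : Type*} [Monoid A] [Monoid B] [FunLike F A B]
    [MonoidHomClass F A B] (φ : F) {r : ℕ} (ξ : Fin r → A) (α : Fin r → ℕ) :
    φ (orderedMonomial ξ α) = orderedMonomial (fun i => φ (ξ i)) α := by
  simp [orderedMonomial, map_list_prod, List.map_ofFn, Function.comp_def]

/-- Exponents for the variables `ξ` of degrees `w` together with `n` variables of degree one. -/
def exponentAppend {r : ℕ} (w : Fin r → ℕ) (n : ℕ) :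
    Exponent (Fin.append w (fun _ : Fin n => 1)) ≃ Exponent w × Finset (Fin n) where
  toFun γ := (⟨fun i => γ.1 (Fin.castAdd n i), fun i hi => γ.2 _ (by simpa using hi)⟩,
    Covectors.exponentEquiv n ⟨fun i => γ.1 (Fin.natAdd r i), fun i _ => γ.2 _ (by simp)⟩)
  invFun p := ⟨Fin.append p.1.1 ((Covectors.exponentEquiv n).symm p.2).1, fun i => by
    refine Fin.addCases (fun i => ?_) (fun i => ?_) i
    · simpa using p.1.2 i
    · simpa using ((Covectors.exponentEquiv n).symm p.2).2 i⟩
  left_inv γ := by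
    ext i
    refine Fin.addCases (fun i => ?_) (fun i => ?_) i <;> simp
  right_inv p := by
    refine Prod.ext ?_ ?_
    · ext i; simp
    · simp

namespace NManifold

variable (Y : NManifold.{u} I M) (n : ℕ)

/-- The fibres of the structure sheaf of `Y × T[1]Bⁿ`. -/
abbrev prodFib (p : M × UnitBall n) : Type u :=
  GradedTensorProduct ℝ (Y.gr p.1) (Covectors.gr n)

/-- The coordinates on `Y × T[1]Bⁿ` given by coordinates `ξ` on `Y` and the differentials `θ`. -/
def prodCoordinates (c : LocalCoordinates Y.fib Y.gr) :
    LocalCoordinates (Y.prodFib n) (fun p => tensorGr (Y.gr p.1) (Covectors.gr n)) where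
  dom := c.dom.comap ⟨Prod.fst, continuous_fst⟩
  r := c.r + n
  w := Fin.append c.w (fun _ => 1)
  w_pos i := by
    refine Fin.addCases (fun i => ?_) (fun i => ?_) i
    · simpa using c.w_pos i
    · simp
  ξ i p := Fin.append (fun i => GradedTensorProduct.tmul ℝ (c.ξ i p.1) (1 : Covectors n))
    (fun i => GradedTensorProduct.tmul ℝ (1 : Y.fib p.1) (Covectors.θ i)) i
  ξ_mem i p hp := by
    refine Fin.addCases (fun i => ?_) (fun i => ?_) i
    · simp only [Fin.append_left]
      exact tensorGr.tmul_mem _ _ (add_zero _) (c.ξ_mem i _ hp) SetLike.GradedOne.one_mem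
    · simp only [Fin.append_right]
      exact tensorGr.tmul_mem _ _ (zero_add _) SetLike.GradedOne.one_mem (Covectors.θ_mem i)
  basis p hp := (((c.basis p.1 (show p.1 ∈ c.dom from hp)).tensorProduct (Covectors.basis n)).map
    (GradedTensorProduct.of ℝ (Y.gr p.1) (Covectors.gr n))).reindex (exponentAppend c.w n).symm
  basis_apply p hp γ := by
    have hp' : p.1 ∈ c.dom := hp
    rw [Module.Basis.reindex_apply, Equiv.symm_symm, Module.Basis.map_apply,
      Module.Basis.tensorProduct_apply, c.basis_apply p.1 hp']
    refine Eq.trans ?_ (orderedMonomial_append _ _ _).symm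
    have h1 := map_orderedMonomial (GradedTensorProduct.includeLeft (R := ℝ) (Y.gr p.1)
      (Covectors.gr n)) (fun i => c.ξ i p.1) (fun i => γ.1 (Fin.castAdd n i))
    have h2 := map_orderedMonomial (GradedTensorProduct.includeRight (R := ℝ) (Y.gr p.1)
      (Covectors.gr n)) Covectors.θ (fun i => γ.1 (Fin.natAdd c.r i))
    refine Eq.trans ?_ (congrArg₂ (· * ·) h1 h2)
    refine Eq.trans ?_ (GradedTensorProduct.tmul_one_mul_one_tmul _ _ _ _).symm
    exact congrArg _ (congrArg _ (Covectors.basis_eq _))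

lemma prodCoordinates_repr_tmul (c : LocalCoordinates Y.fib Y.gr) {p : M × UnitBall n}
    (hp : p ∈ (Y.prodCoordinates n c).dom) (a : Y.fib p.1) (x : Covectors n)
    (γ : Exponent (Y.prodCoordinates n c).w) :
    ((Y.prodCoordinates n c).basis p hp).repr (GradedTensorProduct.tmul ℝ a x) γ =
      (c.basis p.1 hp).repr a (exponentAppend c.w n γ).1 *
        (Covectors.basis n).repr x (exponentAppend c.w n γ).2 := by
  refine (Module.Basis.repr_reindex_apply _ _ _ _).trans ?_
  refine (Module.Basis.tensorProduct_repr_tmul_apply (c.basis p.1 hp) (Covectors.basis n) a x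
    _ _).trans ?_
  rw [smul_eq_mul, mul_comm]
  rfl

lemma prodCoordinates_coeff_tmul (c : LocalCoordinates Y.fib Y.gr) (f : ∀ m, Y.fib m)
    (x : Covectors n) (γ : Exponent (Y.prodCoordinates n c).w) (p : M × UnitBall n) :
    (Y.prodCoordinates n c).coeff (fun p => GradedTensorProduct.tmul ℝ (f p.1) x) γ p =
      c.coeff f (exponentAppend c.w n γ).1 p.1 *
        (Covectors.basis n).repr x (exponentAppend c.w n γ).2 := by
  by_cases hp : p ∈ (Y.prodCoordinates n c).dom
  · refine (LocalCoordinates.coeff_of_mem (Y.prodCoordinates n c) hp _ _).trans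
      ((Y.prodCoordinates_repr_tmul n c hp _ _ _).trans ?_)
    rw [LocalCoordinates.coeff_of_mem c (show p.1 ∈ c.dom from hp)]
  · refine (dif_neg hp).trans ?_
    rw [LocalCoordinates.coeff, dif_neg (show p.1 ∉ c.dom from hp), zero_mul]

lemma coeff_one (c : LocalCoordinates Y.fib Y.gr) {m : M} (hm : m ∈ c.dom) (α : Exponent c.w) :
    c.coeff 1 α m = if (⟨0, fun _ _ => zero_le_one⟩ : Exponent c.w) = α then (1 : ℝ) else 0 := by
  have h1 : (1 : Y.fib m) = c.basis m hm ⟨0, fun _ _ => zero_le_one⟩ := by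
    rw [c.basis_apply]; simp [orderedMonomial]
  rw [LocalCoordinates.coeff_of_mem c hm, Pi.one_apply, h1, Module.Basis.repr_self,
    Finsupp.single_apply]

lemma smoothOn_one (U : Set M) : Y.SmoothOn 1 U := fun c _ α =>
  contMDiffOn_const.congr fun _ hm => Y.coeff_one c hm.2 α

lemma prodCoordinates_contMDiffOn (c : LocalCoordinates Y.fib Y.gr) (f : ∀ m, Y.fib m)
    (x : Covectors n) (γ : Exponent (Y.prodCoordinates n c).w) (U : Set M)
    (h : ∀ α, ContMDiffOn I 𝓘(ℝ, ℝ) ∞ (c.coeff f α) U) :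
    ContMDiffOn (I.prod (UnitBall.model n)) 𝓘(ℝ, ℝ) ∞
      ((Y.prodCoordinates n c).coeff (fun p => GradedTensorProduct.tmul ℝ (f p.1) x) γ)
      (Prod.fst ⁻¹' U) := by
  have h1 := ((h (exponentAppend c.w n γ).1).comp
    (contMDiffOn_fst (J := UnitBall.model n) (s := (Prod.fst ⁻¹' U : Set (M × UnitBall n))))
    (fun p hp => hp)).mul
      (contMDiffOn_const (c := (Covectors.basis n).repr x (exponentAppend c.w n γ).2))
  exact h1.congr fun p _ => Y.prodCoordinates_coeff_tmul n c f x γ p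

/-- The N-manifold `Y × T[1]Bⁿ`. Its functions are the differential forms on the ball with values in
the functions on `Y`. -/
def prodBall : NManifold.{u} (I.prod (UnitBall.model n)) (M × UnitBall n) where
  fib := Y.prodFib n
  gr p := tensorGr (Y.gr p.1) (Covectors.gr n)
  gcomm p := tensorGr.gcomm _ _ (Y.gcomm p.1) Covectors.gcomm
  atlas := Y.prodCoordinates n '' Y.atlas
  cover p := by
    obtain ⟨c, hc, h⟩ := Y.cover p.1
    exact ⟨_, ⟨c, hc, rfl⟩, h⟩
  compat := by
    rintro _ ⟨c, hc, rfl⟩ _ ⟨c', hc', rfl⟩ i γ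
    refine Fin.addCases (fun i => ?_) (fun i => ?_) i
    · have h1 : (Y.prodCoordinates n c).ξ (Fin.castAdd n i) =
          fun p : M × UnitBall n => GradedTensorProduct.tmul ℝ (c.ξ i p.1) (1 : Covectors n) :=
        funext fun p => Fin.append_left
          (fun i => (GradedTensorProduct.tmul ℝ (c.ξ i p.1) (1 : Covectors n) : Y.prodFib n p))
          (fun i => (GradedTensorProduct.tmul ℝ (1 : Y.fib p.1) (Covectors.θ i) : Y.prodFib n p)) i
      rw [h1]
      exact Y.prodCoordinates_contMDiffOn n c' (c.ξ i) 1 γ (c.dom ∩ c'.dom)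
        (Y.compat c hc c' hc' i)
    · have h1 : (Y.prodCoordinates n c).ξ (Fin.natAdd c.r i) =
          fun p : M × UnitBall n => GradedTensorProduct.tmul ℝ (1 : Y.fib p.1) (Covectors.θ i) :=
        funext fun p => Fin.append_right
          (fun i => (GradedTensorProduct.tmul ℝ (c.ξ i p.1) (1 : Covectors n) : Y.prodFib n p))
          (fun i => (GradedTensorProduct.tmul ℝ (1 : Y.fib p.1) (Covectors.θ i) : Y.prodFib n p)) i
      rw [h1]
      exact Y.prodCoordinates_contMDiffOn n c' 1 (Covectors.θ i) γ (c.dom ∩ c'.dom)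
        (fun α => (Y.smoothOn_one c.dom) c' hc' α)

end NManifold

namespace NManifold

variable (Y : NManifold.{u} I M) (n : ℕ)

lemma algebraMapInv_eq_zero {j : ℕ} (hj : j ≠ 0) {x : Covectors n} (hx : x ∈ Covectors.gr n j) :
    (ExteriorAlgebra.algebraMapInv x : ℝ) = 0 := by
  obtain ⟨j, rfl⟩ := Nat.exists_eq_succ_of_ne_zero hj
  rw [Covectors.gr, ExteriorAlgebra.exteriorPower, pow_succ'] at hx
  induction hx using Submodule.mul_induction_on' with
  | mem_mul_mem m hm y hy =>
    obtain ⟨v, rfl⟩ := hm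
    rw [map_mul, ExteriorAlgebra.algebraMapInv, ExteriorAlgebra.lift_ι_apply]
    simp
  | add x hx y hy h1 h2 => rw [map_add, h1, h2, add_zero]

/-- The component of form degree zero of a function on `Y × T[1]Bⁿ`. -/
def augment (p : M × UnitBall n) : (Y.prodBall n).fib p →ₐ[ℝ] Y.fib p.1 :=
  GradedTensorProduct.lift (Y.gr p.1) (Covectors.gr n) (AlgHom.id ℝ _)
    ((Algebra.ofId ℝ _).comp ExteriorAlgebra.algebraMapInv) (by
      intro i j a x
      by_cases hj : j = 0
      · subst hj
        rw [zero_mul, uzpow_zero, one_smul]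
        exact (Algebra.commutes _ _).symm
      · have : ((Algebra.ofId ℝ (Y.fib p.1)).comp ExteriorAlgebra.algebraMapInv) (x : Covectors n)
            = 0 := by
          rw [AlgHom.comp_apply, algebraMapInv_eq_zero n hj x.2, map_zero]
        rw [this, mul_zero, zero_mul, smul_zero])

/-- The product `a * x` of a function `a` on `Y` and a form `x` on the ball, at a point. -/
def form (p : M × UnitBall n) (a : Y.fib p.1) (x : Covectors n) : (Y.prodBall n).fib p :=
  (GradedTensorProduct.tmul ℝ a x : Y.prodFib n p)

lemma augment_tmul (p : M × UnitBall n) (a : Y.fib p.1) (x : Covectors n) :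
    Y.augment n p (Y.form n p a x) =
      a * algebraMap ℝ _ (ExteriorAlgebra.algebraMapInv x) := rfl

/-- The inclusion of the functions on `Y` into those on `Y × T[1]Bⁿ`. -/
def incl (p : M × UnitBall n) : Y.fib p.1 →ₐ[ℝ] (Y.prodBall n).fib p :=
  GradedTensorProduct.includeLeft (R := ℝ) (Y.gr p.1) (Covectors.gr n)

lemma augment_incl (p : M × UnitBall n) (a : Y.fib p.1) :
    Y.augment n p (Y.incl n p a) = a := by
  refine (Y.augment_tmul n p a 1).trans ?_
  rw [map_one, map_one, mul_one]

/-- The coefficient of `θ s` of a function on `Y × T[1]Bⁿ`, with `Y.fib` acting from the left. -/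
def θCoeff (s : Finset (Fin n)) (p : M × UnitBall n) : (Y.prodBall n).fib p →ₗ[ℝ] Y.fib p.1 :=
  (TensorProduct.rid ℝ (Y.fib p.1)).toLinearMap ∘ₗ
    TensorProduct.map LinearMap.id ((Covectors.basis n).coord s) ∘ₗ
      (GradedTensorProduct.of ℝ (Y.gr p.1) (Covectors.gr n)).symm.toLinearMap

/-- The restriction of covectors to a subspace `W` of the tangent space. -/
def restrictCovectors (W : Submodule ℝ (EuclideanSpace ℝ (Fin n))) (p : M × UnitBall n) :
    (Y.prodBall n).fib p →ₗ[ℝ] TensorProduct ℝ (Y.fib p.1) (ExteriorAlgebra ℝ (Module.Dual ℝ W)) :=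
  TensorProduct.map LinearMap.id (ExteriorAlgebra.map W.subtype.dualMap).toLinearMap ∘ₗ
    (GradedTensorProduct.of ℝ (Y.gr p.1) (Covectors.gr n)).symm.toLinearMap

end NManifold

open Classical in
/-- The partial derivative of a function on the ball with values in a finite-dimensional subspace of
a vector space `W`, computed in a basis of `W`. -/
def UnitBall.partialDeriv {n : ℕ} {W : Type*} [AddCommGroup W] [Module ℝ W] (g : UnitBall n → W)
    (i : Fin n) (b : UnitBall n) : W :=
  ∑ᶠ β, fderivWithin ℝ (fun x => (Module.Basis.ofVectorSpace ℝ W).repr (g (UnitBall.retract n x)) β)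
    (Metric.closedBall 0 1) b (EuclideanSpace.single i 1) • Module.Basis.ofVectorSpace ℝ W β

/-- The partial derivatives of a function on `Y × T[1]Bⁿ` in the directions of the ball. -/
def NManifold.partialDeriv (Y : NManifold.{u} I M) (n : ℕ) (f : ∀ p, (Y.prodBall n).fib p)
    (i : Fin n) (p : M × UnitBall n) : (Y.prodBall n).fib p :=
  UnitBall.partialDeriv (W := Y.prodFib n p) (fun b => f (p.1, b)) i p.2

/-- The vector field `Q` on `Y × T[1]Bⁿ`: the sum of `Q` on `Y`, applied for each point of the ball
to the coefficients of the form, and of the de Rham differential `∑ i, θ i * ∂ / ∂ x_i` on the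
ball. -/
def NQManifold.prodBallQ (Y : NQManifold.{u} I M) (n : ℕ) (f : ∀ p, (Y.prodBall n).fib p)
    (p : M × UnitBall n) : (Y.prodBall n).fib p :=
  ∑ s, Y.form n p (Y.Q (fun m => Y.θCoeff n s (m, p.2) (f (m, p.2))) p.1) (Covectors.basis n s) +
    ∑ i, Y.form n p 1 (Covectors.θ i) * Y.partialDeriv n f i p

/-! ### Vector bundles -/

/-- A homogeneous frame on an open set `dom`: over each point `m` the fibre is the free graded module
over `P.fib m` on the elements `e j` of degree `v j`. -/
structure LocalFrame (P : NManifold.{u} I M) (fib : M → Type v) [∀ m, AddCommGroup (fib m)]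
    [∀ m, Module ℝ (fib m)] [∀ m, Module (P.fib m) (fib m)]
    (gr : ∀ m, ℤ → Submodule ℝ (fib m)) where
  dom : TopologicalSpace.Opens M
  r : ℕ
  v : Fin r → ℤ
  e : Fin r → ∀ m, fib m
  basis : ∀ m ∈ dom, Module.Basis (Fin r) (P.fib m) (fib m)
  basis_apply : ∀ m hm j, basis m hm j = e j m
  mem_gr_iff : ∀ m hm d x, x ∈ gr m d ↔ ∀ j, (basis m hm).repr x j ∈ P.grZ m (d - v j)

open Classical in
/-- The coefficients of a family in a frame. -/
def LocalFrame.coeff {P : NManifold.{u} I M} {fib : M → Type v} [∀ m, AddCommGroup (fib m)]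
    [∀ m, Module ℝ (fib m)] [∀ m, Module (P.fib m) (fib m)]
    {gr : ∀ m, ℤ → Submodule ℝ (fib m)} (φ : LocalFrame P fib gr) (s : ∀ m, fib m) (j : Fin φ.r)
    (m : M) : P.fib m :=
  if h : m ∈ φ.dom then (φ.basis m h).repr (s m) j else 0

/-- A graded vector bundle on the N-manifold `P`. The sheaf of its sections is a graded module,
locally free of finite rank over the structure sheaf; as for N-manifolds it is given by its fibres over
the points of the body. -/
structure NBundle (P : NManifold.{u} I M) where
  fib : M → Type v
  [addCommGroup : ∀ m, AddCommGroup (fib m)]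
  [realModule : ∀ m, Module ℝ (fib m)]
  [module : ∀ m, Module (P.fib m) (fib m)]
  [scalarTower : ∀ m, IsScalarTower ℝ (P.fib m) (fib m)]
  gr : ∀ m, ℤ → Submodule ℝ (fib m)
  atlas : Set (LocalFrame P fib gr)
  cover : ∀ m, ∃ φ ∈ atlas, m ∈ φ.dom
  compat : ∀ φ ∈ atlas, ∀ φ' ∈ atlas, ∀ i j,
    P.SmoothOn (φ'.coeff (φ.e i) j) (φ.dom ∩ φ'.dom)

attribute [instance] NBundle.addCommGroup NBundle.realModule NBundle.module NBundle.scalarTower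

namespace LocalFrame

variable {P : NManifold.{u} I M} {fib : M → Type v} [∀ m, AddCommGroup (fib m)]
    [∀ m, Module ℝ (fib m)] [∀ m, Module (P.fib m) (fib m)]
    {gr : ∀ m, ℤ → Submodule ℝ (fib m)} (φ : LocalFrame P fib gr)

lemma coeff_of_mem {m : M} (hm : m ∈ φ.dom) (s : ∀ m, fib m) (j : Fin φ.r) :
    φ.coeff s j m = (φ.basis m hm).repr (s m) j := dif_pos hm

lemma coeff_add (s t : ∀ m, fib m) (j : Fin φ.r) : φ.coeff (s + t) j = φ.coeff s j + φ.coeff t j := by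
  ext m; by_cases h : m ∈ φ.dom <;> simp [coeff, h]

lemma coeff_zero (j : Fin φ.r) : φ.coeff 0 j = 0 := by
  ext m; by_cases h : m ∈ φ.dom <;> simp [coeff, h]

lemma coeff_smul [∀ m, IsScalarTower ℝ (P.fib m) (fib m)] (t : ℝ) (s : ∀ m, fib m) (j : Fin φ.r) :
    φ.coeff (t • s) j = t • φ.coeff s j := by
  ext m
  by_cases h : m ∈ φ.dom
  · simp only [coeff, h, dif_pos, Pi.smul_apply]
    rw [← algebraMap_smul (P.fib m) t (s m), map_smul, Finsupp.smul_apply, algebraMap_smul]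
  · simp [coeff, h]

end LocalFrame

namespace NBundle

variable {P : NManifold.{u} I M} (E : NBundle.{u, v} P)

/-- A family is smooth on `U` if its coefficients in all frames are smooth. -/
def SmoothOn (s : ∀ m, E.fib m) (U : Set M) : Prop :=
  ∀ φ ∈ E.atlas, ∀ j, P.SmoothOn (φ.coeff s j) (U ∩ φ.dom)

/-- The sections of degree `d`. -/
def sections (d : ℤ) : Submodule ℝ (∀ m, E.fib m) where
  carrier := {s | (∀ m, s m ∈ E.gr m d) ∧ E.SmoothOn s Set.univ}
  zero_mem' := ⟨fun _ => zero_mem _, fun φ _ j => by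
    rw [φ.coeff_zero]; exact P.smoothOn_zero _⟩
  add_mem' hs ht := ⟨fun m => add_mem (hs.1 m) (ht.1 m), fun φ hφ j => by
    rw [φ.coeff_add]; exact (hs.2 φ hφ j).add (ht.2 φ hφ j)⟩
  smul_mem' t _ hs := ⟨fun m => Submodule.smul_mem _ t (hs.1 m), fun φ hφ j => by
    rw [φ.coeff_smul]; exact (hs.2 φ hφ j).smul t⟩

end NBundle

/-- An NQ vector bundle on the N-manifold `P` with homological vector field `Q`: a graded vector
bundle with a differential `D` on its sections, of degree one and of square zero, which satisfies the
Leibniz rule with respect to `Q`. Only the values of `D` on the homogeneous sections have a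
meaning. -/
structure NQBundle (P : NManifold.{u} I M) (Q : (∀ m, P.fib m) → ∀ m, P.fib m) extends
    NBundle.{u, v} P where
  D : (∀ m, fib m) → ∀ m, fib m
  D_mem : ∀ d, ∀ s ∈ toNBundle.sections d, D s ∈ toNBundle.sections (d + 1)
  D_add : ∀ d, ∀ s ∈ toNBundle.sections d, ∀ t ∈ toNBundle.sections d, D (s + t) = D s + D t
  D_smul : ∀ d, ∀ s ∈ toNBundle.sections d, ∀ t : ℝ, D (t • s) = t • D s
  D_leibniz : ∀ k d, ∀ f ∈ P.functions k, ∀ s ∈ toNBundle.sections d,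
    D (fun m => f m • s m) = fun m => Q f m • s m + (-1 : ℝ) ^ k • (f m • D s m)
  D_D : ∀ d, ∀ s ∈ toNBundle.sections d, D (D s) = 0

namespace NQBundle

variable {P : NManifold.{u} I M} {Q : (∀ m, P.fib m) → ∀ m, P.fib m} (E : NQBundle.{u, v} P Q)

/-- The closed sections of degree `d` which belong to a given space `V` of families. -/
def cocycles (V : Submodule ℝ (∀ m, E.fib m)) (d : ℤ) : Submodule ℝ (∀ m, E.fib m) where
  carrier := {s | s ∈ E.sections d ∧ s ∈ V ∧ E.D s = 0}
  zero_mem' := ⟨zero_mem _, zero_mem _, by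
    have := E.D_smul d 0 (zero_mem _) 0
    rwa [zero_smul, zero_smul] at this⟩
  add_mem' hs ht := ⟨add_mem hs.1 ht.1, add_mem hs.2.1 ht.2.1, by
    rw [E.D_add d _ hs.1 _ ht.1, hs.2.2, ht.2.2, add_zero]⟩
  smul_mem' t s hs := ⟨Submodule.smul_mem _ t hs.1, Submodule.smul_mem _ t hs.2.1, by
    rw [E.D_smul d _ hs.1, hs.2.2, smul_zero]⟩

/-- The differentials of the sections of degree `d - 1` which belong to `V`. -/
def coboundaries (V : Submodule ℝ (∀ m, E.fib m)) (d : ℤ) : Submodule ℝ (∀ m, E.fib m) where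
  carrier := {s | ∃ u, u ∈ E.sections (d - 1) ∧ u ∈ V ∧ E.D u = s}
  zero_mem' := ⟨0, zero_mem _, zero_mem _, by
    have := E.D_smul (d - 1) 0 (zero_mem _) 0
    rwa [zero_smul, zero_smul] at this⟩
  add_mem' := by
    rintro _ _ ⟨u, hu, hu', rfl⟩ ⟨u', hv, hv', rfl⟩
    exact ⟨u + u', add_mem hu hv, add_mem hu' hv', E.D_add _ _ hu _ hv⟩
  smul_mem' := by
    rintro t _ ⟨u, hu, hu', rfl⟩
    exact ⟨t • u, Submodule.smul_mem _ t hu, Submodule.smul_mem _ t hu', E.D_smul _ _ hu t⟩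

/-- The cohomology in degree `d` of the complex of the sections which belong to `V`. -/
abbrev cohomologyIn (V : Submodule ℝ (∀ m, E.fib m)) (d : ℤ) : Type _ :=
  E.cocycles V d ⧸ (E.coboundaries V d).submoduleOf (E.cocycles V d)

/-- The cohomology of the complex `Γ(E)` of sections. -/
abbrev cohomology (d : ℤ) : Type _ := E.cohomologyIn ⊤ d

end NQBundle

/-! ### Restriction of bundles to the centre of the ball -/

namespace Covectors

lemma repr_empty {n : ℕ} (x : Covectors n) :
    (basis n).repr x ∅ = ExteriorAlgebra.algebraMapInv x := by
  have h : (basis n).coord ∅ = (ExteriorAlgebra.algebraMapInv : Covectors n →ₐ[ℝ] ℝ).toLinearMap := by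
    refine (basis n).ext fun s => ?_
    rw [Module.Basis.coord_apply, Module.Basis.repr_self, AlgHom.toLinearMap_apply]
    by_cases hs : s = ∅
    · subst hs
      have h1 : basis n ∅ = 1 := by
        have := basis_eq (n := n) ⟨0, fun _ _ => zero_le_one⟩
        rw [show exponentEquiv n ⟨0, fun _ _ => zero_le_one⟩ = ∅ by simp [exponentEquiv]] at this
        rw [this]; simp [orderedMonomial]
      rw [Finsupp.single_eq_same, h1, map_one]
    · rw [Finsupp.single_eq_of_ne (Ne.symm hs)]
      refine (NManifold.algebraMapInv_eq_zero n (j := s.card) (by simpa using hs) ?_).symm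
      rw [basis, ExteriorAlgebra.basis_apply_ofCard (coordBasis n) rfl,
        ← exteriorPower.ιMulti_family_apply_coe]
      exact Subtype.property _
  exact LinearMap.congr_fun h x

end Covectors

namespace NManifold

variable (Y : NManifold.{u} I M) (n : ℕ)

lemma augment_mem (p : M × UnitBall n) {k : ℕ} {a : (Y.prodBall n).fib p}
    (ha : a ∈ (Y.prodBall n).gr p k) : Y.augment n p a ∈ Y.gr p.1 k := by
  induction ha using Submodule.span_induction with
  | zero => rw [map_zero]; exact zero_mem _
  | add x y _ _ h1 h2 => rw [map_add]; exact add_mem h1 h2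
  | smul t x _ h => rw [map_smul]; exact Submodule.smul_mem _ _ h
  | mem x h =>
    obtain ⟨i, j, rfl, a, ha, b, hb, rfl⟩ := h
    change Y.augment n p (Y.form n p a b) ∈ _
    rw [augment_tmul]
    by_cases hj : j = 0
    · subst hj
      rw [← Algebra.commutes, ← Algebra.smul_def]
      exact Submodule.smul_mem _ _ ha
    · rw [algebraMapInv_eq_zero n hj hb, map_zero, mul_zero]
      exact zero_mem _

lemma augment_memZ (p : M × UnitBall n) {k : ℤ} {a : (Y.prodBall n).fib p}
    (ha : a ∈ (Y.prodBall n).grZ p k) : Y.augment n p a ∈ Y.grZ p.1 k := by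
  cases k with
  | ofNat k => exact Y.augment_mem n p ha
  | negSucc k =>
    rw [show a = 0 from ha]
    exact map_zero (Y.augment n p)

lemma incl_mem (p : M × UnitBall n) {k : ℕ} {a : Y.fib p.1} (ha : a ∈ Y.gr p.1 k) :
    Y.incl n p a ∈ (Y.prodBall n).gr p k :=
  tensorGr.tmul_mem _ _ (add_zero k) ha SetLike.GradedOne.one_mem

lemma incl_memZ (p : M × UnitBall n) {k : ℤ} {a : Y.fib p.1} (ha : a ∈ Y.grZ p.1 k) :
    Y.incl n p a ∈ (Y.prodBall n).grZ p k := by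
  cases k with
  | ofNat k => exact Y.incl_mem n p ha
  | negSucc k =>
    rw [show a = 0 from ha]
    exact map_zero (Y.incl n p)

lemma augment_repr (c : LocalCoordinates Y.fib Y.gr) {p : M × UnitBall n}
    (hp : p ∈ (Y.prodCoordinates n c).dom) (α : Exponent c.w) (t : (Y.prodBall n).fib p) :
    (c.basis p.1 hp).repr (Y.augment n p t) α =
      ((Y.prodCoordinates n c).basis p hp).repr (t : Y.prodFib n p)
        ((exponentAppend c.w n).symm (α, ∅)) := by
  have h : (((c.basis p.1 hp).coord α) ∘ₗ (Y.augment n p).toLinearMap : Y.prodFib n p →ₗ[ℝ] ℝ) =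
      (((Y.prodCoordinates n c).basis p hp).coord ((exponentAppend c.w n).symm (α, ∅)) :
        Y.prodFib n p →ₗ[ℝ] ℝ) := by
    apply GradedTensorProduct.hom_ext
    apply TensorProduct.ext'
    intro a x
    have h1 := Y.prodCoordinates_repr_tmul n c hp a x ((exponentAppend c.w n).symm (α, ∅))
    refine Eq.trans ?_ h1.symm
    rw [Equiv.apply_symm_apply, Covectors.repr_empty]
    change (c.basis p.1 hp).repr (Y.augment n p (Y.form n p a x)) α = _
    rw [augment_tmul, ← Algebra.commutes, ← Algebra.smul_def, map_smul, Finsupp.smul_apply,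
      smul_eq_mul, mul_comm]
  exact LinearMap.congr_fun h t

lemma contMDiff_centre : ContMDiff I (I.prod (UnitBall.model n)) ∞
    (fun m : M => (m, UnitBall.centre n)) := contMDiff_id.prodMk contMDiff_const

lemma smoothOn_augment {f : ∀ p, (Y.prodBall n).fib p} {U : Set (M × UnitBall n)}
    (hf : (Y.prodBall n).SmoothOn f U) :
    Y.SmoothOn (fun m => Y.augment n (m, UnitBall.centre n) (f (m, UnitBall.centre n)))
      ((fun m => (m, UnitBall.centre n)) ⁻¹' U) := fun c hc α => by
  have h := (hf _ ⟨c, hc, rfl⟩ ((exponentAppend c.w n).symm (α, ∅))).comp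
    ((contMDiff_centre (I := I) (M := M) n).contMDiffOn
      (s := (fun m => (m, UnitBall.centre n)) ⁻¹' U ∩ c.dom)) (fun m hm => hm)
  refine h.congr fun m hm => ?_
  rw [c.coeff_of_mem hm.2]
  refine (Y.augment_repr n c (p := (m, UnitBall.centre n)) hm.2 α _).trans ?_
  exact (LocalCoordinates.coeff_of_mem (Y.prodCoordinates n c) (m := (m, UnitBall.centre n))
    hm.2 f _).symm

end NManifold

namespace NBundle

variable {Y : NManifold.{u} I M} {n : ℕ} (E : NBundle.{u, v} (Y.prodBall n))

/-- The submodule of the fibre of `E` over a point of `Y × {centre}` generated by the products with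
functions which vanish on `Y × {centre}`. -/
def centreIdeal (m : M) :
    Submodule ((Y.prodBall n).fib (m, UnitBall.centre n)) (E.fib (m, UnitBall.centre n)) :=
  Submodule.span _ {x | ∃ a s, Y.augment n (m, UnitBall.centre n) a = 0 ∧ x = a • s}

/-- The fibres of the restriction `E₀` of `E` to `Y × {centre}`. -/
def CentreFib (m : M) : Type v := E.fib (m, UnitBall.centre n) ⧸ E.centreIdeal m

instance (m : M) : AddCommGroup (E.CentreFib m) :=
  inferInstanceAs (AddCommGroup (E.fib (m, UnitBall.centre n) ⧸ E.centreIdeal m))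

instance (m : M) : Module ℝ (E.CentreFib m) :=
  inferInstanceAs (Module ℝ (E.fib (m, UnitBall.centre n) ⧸ E.centreIdeal m))

instance centreModule (m : M) : Module (Y.fib m) (E.CentreFib m) :=
  Module.compHom (E.fib (m, UnitBall.centre n) ⧸ E.centreIdeal m)
    (Y.incl n (m, UnitBall.centre n)).toRingHom

/-- The restriction of elements of the fibres to `Y × {centre}`. -/
def centreMk (m : M) : E.fib (m, UnitBall.centre n) →ₗ[ℝ] E.CentreFib m :=
  (E.centreIdeal m).mkQ.restrictScalars ℝ

lemma centreMk_surjective (m : M) : Function.Surjective (E.centreMk m) :=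
  Submodule.mkQ_surjective (E.centreIdeal m)

lemma centreMk_eq_zero {m : M} {x : E.fib (m, UnitBall.centre n)} :
    E.centreMk m x = 0 ↔ x ∈ E.centreIdeal m := Submodule.Quotient.mk_eq_zero _

lemma smul_centreMk (m : M) (a : Y.fib m) (x : E.fib (m, UnitBall.centre n)) :
    a • E.centreMk m x =
      E.centreMk m (Y.incl n (m, UnitBall.centre n) a • x) := rfl

lemma centreMk_smul (m : M) (a : (Y.prodBall n).fib (m, UnitBall.centre n))
    (x : E.fib (m, UnitBall.centre n)) :
    E.centreMk m (a • x) = Y.augment n (m, UnitBall.centre n) a • E.centreMk m x := by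
  rw [smul_centreMk, ← sub_eq_zero, ← map_sub, ← sub_smul, centreMk_eq_zero]
  refine Submodule.subset_span ⟨_, x, ?_, rfl⟩
  refine (map_sub (Y.augment n (m, UnitBall.centre n)) _ _).trans ?_
  rw [sub_eq_zero]
  exact (Y.augment_incl n (m, UnitBall.centre n) _).symm

instance (m : M) : IsScalarTower ℝ (Y.fib m) (E.CentreFib m) where
  smul_assoc t a x := by
    obtain ⟨x, rfl⟩ := E.centreMk_surjective m x
    rw [smul_centreMk, smul_centreMk, ← map_smul, ← smul_assoc]
    congr 2

/-- The restriction of functions to `Y × {centre}`. -/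
def centreHom (Y : NManifold.{u} I M) (n : ℕ) (m : M) :
    (Y.prodBall n).fib (m, UnitBall.centre n) →+* Y.fib m :=
  (Y.augment n (m, UnitBall.centre n)).toRingHom

/-- The coefficients, restricted to `Y × {centre}`, of an element of a fibre of `E` in a frame. -/
def centreReprAux {m : M} {r : ℕ} (B : Module.Basis (Fin r)
    ((Y.prodBall n).fib (m, UnitBall.centre n)) (E.fib (m, UnitBall.centre n))) :
    E.fib (m, UnitBall.centre n) →ₛₗ[centreHom Y n m]
      (Fin r → Y.fib m) where
  toFun x j := Y.augment n (m, UnitBall.centre n) (B.repr x j)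
  map_add' x y := by
    ext j
    rw [map_add, Finsupp.add_apply, map_add]
    rfl
  map_smul' a x := by
    ext j
    rw [map_smul, Finsupp.smul_apply, smul_eq_mul, map_mul]
    rfl

lemma centreReprAux_of_mem {m : M} {r : ℕ} (B : Module.Basis (Fin r)
    ((Y.prodBall n).fib (m, UnitBall.centre n)) (E.fib (m, UnitBall.centre n))) :
    E.centreIdeal m ≤ LinearMap.ker (E.centreReprAux B) := by
  refine Submodule.span_le.2 ?_
  rintro _ ⟨a, s, ha, rfl⟩
  rw [SetLike.mem_coe, LinearMap.mem_ker, map_smulₛₗ]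
  ext j
  rw [Pi.smul_apply, smul_eq_mul]
  exact (congrArg (· * _) ha).trans (zero_mul _)

/-- The coefficients of an element of a fibre of `E₀` in the restriction of a frame. -/
def centreRepr {m : M} {r : ℕ} (B : Module.Basis (Fin r)
    ((Y.prodBall n).fib (m, UnitBall.centre n)) (E.fib (m, UnitBall.centre n))) :
    E.CentreFib m ≃ₗ[Y.fib m] (Fin r → Y.fib m) where
  toFun := (E.centreIdeal m).liftQ (E.centreReprAux B) (E.centreReprAux_of_mem B)
  map_add' x y := map_add _ _ _
  map_smul' a x := by
    obtain ⟨x, rfl⟩ := E.centreMk_surjective m x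
    change E.centreReprAux B (Y.incl n (m, UnitBall.centre n) a • x) = a • E.centreReprAux B x
    rw [map_smulₛₗ]
    exact congrArg (· • _) (Y.augment_incl n (m, UnitBall.centre n) a)
  invFun a := ∑ j, a j • E.centreMk m (B j)
  left_inv x := by
    obtain ⟨x, rfl⟩ := E.centreMk_surjective m x
    change ∑ j, Y.augment n (m, UnitBall.centre n) (B.repr x j) • E.centreMk m (B j) = _
    refine (Finset.sum_congr rfl fun j _ => (E.centreMk_smul m _ _).symm).trans ?_
    rw [← map_sum, B.sum_repr]
  right_inv a := by
    simp_rw [smul_centreMk, ← map_sum]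
    change E.centreReprAux B _ = a
    ext j
    change Y.augment n (m, UnitBall.centre n) (B.repr _ j) = _
    rw [map_sum, Finsupp.finsetSum_apply, Finset.sum_eq_single j]
    · rw [map_smul, B.repr_self, Finsupp.smul_apply, Finsupp.single_eq_same, smul_eq_mul, mul_one]
      exact Y.augment_incl n (m, UnitBall.centre n) (a j)
    · intro k _ hk
      rw [map_smul, B.repr_self, Finsupp.smul_apply, Finsupp.single_eq_of_ne hk.symm, smul_zero]
    · simp

lemma centreRepr_mk {m : M} {r : ℕ} (B : Module.Basis (Fin r)
    ((Y.prodBall n).fib (m, UnitBall.centre n)) (E.fib (m, UnitBall.centre n)))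
    (x : E.fib (m, UnitBall.centre n)) (j : Fin r) :
    E.centreRepr B (E.centreMk m x) j = Y.augment n (m, UnitBall.centre n) (B.repr x j) := rfl

lemma centreRepr_symm_apply {m : M} {r : ℕ} (B : Module.Basis (Fin r)
    ((Y.prodBall n).fib (m, UnitBall.centre n)) (E.fib (m, UnitBall.centre n)))
    (a : Fin r → Y.fib m) : (E.centreRepr B).symm a = ∑ j, a j • E.centreMk m (B j) := rfl

/-- The degree `d` part of a fibre of `E₀`. -/
def centreGr (m : M) (d : ℤ) : Submodule ℝ (E.CentreFib m) :=
  (E.gr (m, UnitBall.centre n) d).map (E.centreMk m)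

/-- The restriction of a family of elements of the fibres of `E` to `Y × {centre}`. -/
def restrict (s : ∀ p, E.fib p) (m : M) : E.CentreFib m := E.centreMk m (s (m, UnitBall.centre n))

/-- The restriction of a frame to `Y × {centre}`. -/
def centreFrame (φ : LocalFrame (Y.prodBall n) E.fib E.gr) :
    LocalFrame Y E.CentreFib E.centreGr where
  dom := φ.dom.comap ⟨fun m => (m, UnitBall.centre n), by fun_prop⟩
  r := φ.r
  v := φ.v
  e j := E.restrict (φ.e j)
  basis m hm := Module.Basis.ofEquivFun (E.centreRepr (φ.basis (m, UnitBall.centre n)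
    (show (m, UnitBall.centre n) ∈ φ.dom from hm)))
  basis_apply m hm j := by
    have hm' : (m, UnitBall.centre n) ∈ φ.dom := hm
    rw [Module.Basis.coe_ofEquivFun]
    refine (E.centreRepr_symm_apply (φ.basis _ hm') _).trans ?_
    rw [Finset.sum_eq_single j]
    · rw [Pi.single_eq_same, one_smul, φ.basis_apply]; rfl
    · intro k _ hk
      rw [Pi.single_eq_of_ne hk, zero_smul]
    · simp
  mem_gr_iff m hm d x := by
    have hm' : (m, UnitBall.centre n) ∈ φ.dom := hm
    constructor
    · rintro ⟨x, hx, rfl⟩ j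
      exact Y.augment_memZ n (m, UnitBall.centre n) ((φ.mem_gr_iff _ hm' d x).1 hx j)
    · intro h
      refine ⟨∑ j, Y.incl n (m, UnitBall.centre n)
        (E.centreRepr (φ.basis (m, UnitBall.centre n) hm') x j) • φ.basis _ hm' j, ?_, ?_⟩
      · refine (φ.mem_gr_iff _ hm' d _).2 fun j => ?_
        rw [Module.Basis.repr_sum_self]
        exact Y.incl_memZ n (m, UnitBall.centre n) (h j)
      · rw [map_sum]
        exact (E.centreRepr (φ.basis (m, UnitBall.centre n) hm')).symm_apply_apply x

lemma centreFrame_coeff (φ : LocalFrame (Y.prodBall n) E.fib E.gr) (s : ∀ p, E.fib p) (j : Fin φ.r)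
    (m : M) : (E.centreFrame φ).coeff (E.restrict s) j m =
      Y.augment n (m, UnitBall.centre n) (φ.coeff s j (m, UnitBall.centre n)) := by
  by_cases hm : (m, UnitBall.centre n) ∈ φ.dom
  · rw [φ.coeff_of_mem hm]
    exact (E.centreFrame φ).coeff_of_mem (m := m) hm _ j
  · have h1 : φ.coeff s j (m, UnitBall.centre n) = 0 := dif_neg hm
    rw [h1, map_zero]
    exact dif_neg hm

/-- The restriction `E₀` of a graded vector bundle `E` on `Y × T[1]Bⁿ` to `Y`, embedded as
`Y × {centre}`. -/
def restrictCentre : NBundle.{u, v} Y where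
  fib := E.CentreFib
  gr := E.centreGr
  atlas := E.centreFrame '' E.atlas
  cover m := by
    obtain ⟨φ, hφ, h⟩ := E.cover (m, UnitBall.centre n)
    exact ⟨_, ⟨φ, hφ, rfl⟩, h⟩
  compat := by
    rintro _ ⟨φ, hφ, rfl⟩ _ ⟨φ', hφ', rfl⟩ i j
    refine (Y.smoothOn_augment n (E.compat φ hφ φ' hφ' i j)).congr fun m _ => ?_
    exact E.centreFrame_coeff φ' (φ.e i) j m

lemma restrict_mem {d : ℤ} {s : ∀ p, E.fib p} (hs : s ∈ E.sections d) :
    E.restrict s ∈ E.restrictCentre.sections d := by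
  refine ⟨fun m => ⟨_, hs.1 _, rfl⟩, ?_⟩
  rintro _ ⟨φ, hφ, rfl⟩ j
  refine (Y.smoothOn_augment n (hs.2 φ hφ j)).congr fun m _ => ?_
  exact E.centreFrame_coeff φ s j m

end NBundle

namespace NManifold

lemma eq_zero_of_mem_grZ (P : NManifold.{u} I M) {m : M} {k l : ℤ} (hkl : k ≠ l) {a : P.fib m}
    (hk : a ∈ P.grZ m k) (hl : a ∈ P.grZ m l) : a = 0 := by
  cases k with
  | negSucc k => exact hk
  | ofNat k =>
    cases l with
    | negSucc l => exact hl
    | ofNat l =>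
      rw [← DirectSum.decompose_of_mem_same (P.gr m) (show a ∈ P.gr m k from hk),
        DirectSum.decompose_of_mem_ne (P.gr m) (show a ∈ P.gr m l from hl)]
      rintro rfl
      exact hkl rfl

lemma augment_prodBallQ (Y : NQManifold.{u} I M) (n : ℕ) (f : ∀ p, (Y.prodBall n).fib p)
    (p : M × UnitBall n) : Y.augment n p (Y.prodBallQ n f p) =
      Y.Q (fun m => Y.augment n (m, p.2) (f (m, p.2))) p.1 := by
  have hθ : ∀ m, Y.θCoeff n ∅ (m, p.2) (f (m, p.2)) = Y.augment n (m, p.2) (f (m, p.2)) := by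
    intro m
    have : Y.θCoeff n ∅ (m, p.2) = ((Y.augment n (m, p.2)).toLinearMap :
        Y.prodFib n (m, p.2) →ₗ[ℝ] Y.fib m) := by
      apply GradedTensorProduct.hom_ext
      apply TensorProduct.ext'
      intro a x
      refine Eq.trans ?_ (Y.augment_tmul n (m, p.2) a x).symm
      change ((Covectors.basis n).repr x ∅) • a = _
      rw [Covectors.repr_empty, Algebra.smul_def, Algebra.commutes]
    exact LinearMap.congr_fun this _
  have h0 : ∀ (s : Finset (Fin n)) (a : Y.fib p.1),
      Y.augment n p (Y.form n p a (Covectors.basis n s)) = if s = ∅ then a else 0 := by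
    intro s a
    rw [augment_tmul, ← Covectors.repr_empty, Module.Basis.repr_self]
    split_ifs with h
    · rw [h, Finsupp.single_eq_same, map_one, mul_one]
    · rw [Finsupp.single_eq_of_ne (Ne.symm h), map_zero, mul_zero]
  have h1 : ∀ (i : Fin n) (x : (Y.prodBall n).fib p),
      Y.augment n p (Y.form n p 1 (Covectors.θ i) * x) = 0 := by
    intro i x
    rw [map_mul, augment_tmul, algebraMapInv_eq_zero n one_ne_zero (Covectors.θ_mem i), map_zero,
      mul_zero, zero_mul]
  rw [NQManifold.prodBallQ, map_add, map_sum, map_sum]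
  simp_rw [h1, h0]
  simp [hθ]

end NManifold

/-! ### The differential on the restriction to the centre -/

lemma contMDiffOn_bump {g : M → ℝ} {U V : Set M} (hU : IsOpen U) (hV : IsOpen V)
    (hg : ContMDiffOn I 𝓘(ℝ, ℝ) ∞ g (U ∩ V)) {χ : M → ℝ} (hχ : ContMDiff I 𝓘(ℝ, ℝ) ∞ χ)
    (hs : tsupport χ ⊆ U) : ContMDiffOn I 𝓘(ℝ, ℝ) ∞ (fun m => χ m * g m) V := by
  intro m hm
  refine ContMDiffAt.contMDiffWithinAt ?_
  by_cases h : m ∈ tsupport χ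
  · exact hχ.contMDiffAt.mul (hg.contMDiffAt ((hU.inter hV).mem_nhds ⟨hs h, hm⟩))
  · refine (contMDiffAt_const (c := (0 : ℝ))).congr_of_eventuallyEq ?_
    filter_upwards [notMem_tsupport_iff_eventuallyEq.1 h] with x hx
    rw [hx, Pi.zero_apply, zero_mul]

namespace NManifold

variable (P : NManifold.{u} I M)

variable {P} in
lemma SmoothOn.bump {f : ∀ m, P.fib m} {U V : Set M} (hU : IsOpen U) (hV : IsOpen V)
    (hf : P.SmoothOn f (U ∩ V)) {χ : M → ℝ} (hχ : ContMDiff I 𝓘(ℝ, ℝ) ∞ χ)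
    (hs : tsupport χ ⊆ U) : P.SmoothOn (fun m => χ m • f m) V := fun c hc α => by
  have h := contMDiffOn_bump hU (hV.inter c.dom.isOpen)
    (by rw [← Set.inter_assoc]; exact hf c hc α) hχ hs
  refine h.congr fun m hm => ?_
  rw [c.coeff_of_mem hm.2, c.coeff_of_mem hm.2, map_smul, Finsupp.smul_apply, smul_eq_mul]

lemma mul_memZ {m : M} {k l : ℤ} {a b : P.fib m} (ha : a ∈ P.grZ m k) (hb : b ∈ P.grZ m l) :
    a * b ∈ P.grZ m (k + l) := by
  cases k with
  | negSucc k => rw [show a = 0 from ha, zero_mul]; exact zero_mem _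
  | ofNat k =>
    cases l with
    | negSucc l => rw [show b = 0 from hb, mul_zero]; exact zero_mem _
    | ofNat l => exact SetLike.GradedMul.mul_mem (A := P.gr m) ha hb

variable {P} in
lemma SmoothOn.mulZ {f g : ∀ m, P.fib m} {U : Set M} (hf : P.SmoothOn f U) (hg : P.SmoothOn g U)
    {k l : ℤ} (hfk : ∀ m ∈ U, f m ∈ P.grZ m k) (hgl : ∀ m ∈ U, g m ∈ P.grZ m l) :
    P.SmoothOn (f * g) U := by
  cases k with
  | negSucc k =>
    refine (P.smoothOn_zero U).congr fun m hm => ?_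
    rw [Pi.mul_apply, show f m = 0 from hfk m hm, zero_mul, Pi.zero_apply]
  | ofNat k =>
    cases l with
    | negSucc l =>
      refine (P.smoothOn_zero U).congr fun m hm => ?_
      rw [Pi.mul_apply, show g m = 0 from hgl m hm, mul_zero, Pi.zero_apply]
    | ofNat l => exact hf.mul hg hfk hgl

/-- A smooth function on the body, as a function of degree zero. -/
lemma smul_one_mem {χ : M → ℝ} (hχ : ContMDiff I 𝓘(ℝ, ℝ) ∞ χ) :
    (fun m => χ m • (1 : P.fib m)) ∈ P.functions 0 := by
  refine ⟨fun m => Submodule.smul_mem _ _ SetLike.GradedOne.one_mem, ?_⟩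
  have h := SmoothOn.bump isOpen_univ isOpen_univ (P.smoothOn_one (Set.univ ∩ Set.univ)) hχ
    (Set.subset_univ _)
  exact h

lemma incl_functions (n : ℕ) {k : ℕ} {f : ∀ m, P.fib m} (hf : f ∈ P.functions k) :
    (fun p => P.incl n p (f p.1)) ∈ (P.prodBall n).functions k := by
  refine ⟨fun p => P.incl_mem n p (hf.1 p.1), ?_⟩
  rintro _ ⟨c, hc, rfl⟩ γ
  exact P.prodCoordinates_contMDiffOn n c f 1 γ (Set.univ ∩ c.dom) (fun α => hf.2 c hc α)

lemma incl_smoothOn (n : ℕ) {f : ∀ m, P.fib m} {U : Set M} (hf : P.SmoothOn f U) :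
    (P.prodBall n).SmoothOn (fun p => P.incl n p (f p.1)) (Prod.fst ⁻¹' U) := by
  rintro _ ⟨c, hc, rfl⟩ γ
  exact P.prodCoordinates_contMDiffOn n c f 1 γ (U ∩ c.dom) (fun α => hf c hc α)

end NManifold

namespace LocalFrame

variable {P : NManifold.{u} I M} {fib : M → Type v} [∀ m, AddCommGroup (fib m)]
    [∀ m, Module ℝ (fib m)] [∀ m, Module (P.fib m) (fib m)]
    {gr : ∀ m, ℤ → Submodule ℝ (fib m)} (φ : LocalFrame P fib gr)

lemma coeff_memZ {m : M} (hm : m ∈ φ.dom) {s : ∀ m, fib m} {d : ℤ} (h : s m ∈ gr m d)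
    (j : Fin φ.r) : φ.coeff s j m ∈ P.grZ m (d - φ.v j) := by
  rw [φ.coeff_of_mem hm]
  exact (φ.mem_gr_iff m hm d _).1 h j

lemma sum_coeff {m : M} (hm : m ∈ φ.dom) (s : ∀ m, fib m) :
    ∑ j, φ.coeff s j m • φ.e j m = s m := by
  refine Eq.trans ?_ ((φ.basis m hm).sum_repr (s m))
  refine Finset.sum_congr rfl fun j _ => ?_
  rw [φ.coeff_of_mem hm, φ.basis_apply m hm]

end LocalFrame

namespace NBundle

variable {P : NManifold.{u} I M} (E : NBundle.{u, v} P)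

variable {E} in
lemma SmoothOn.congr {s t : ∀ m, E.fib m} {U : Set M} (hs : E.SmoothOn s U)
    (h : ∀ m ∈ U, t m = s m) : E.SmoothOn t U := fun φ hφ j =>
  (hs φ hφ j).congr fun m hm => by rw [φ.coeff_of_mem hm.2, φ.coeff_of_mem hm.2, h m hm.1]

variable {E} in
lemma SmoothOn.mono {s : ∀ m, E.fib m} {U V : Set M} (hs : E.SmoothOn s U) (h : V ⊆ U) :
    E.SmoothOn s V := fun φ hφ j => (hs φ hφ j).mono (Set.inter_subset_inter_left _ h)

lemma smoothOn_zero (U : Set M) : E.SmoothOn 0 U := fun φ _ j => by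
  rw [φ.coeff_zero]; exact P.smoothOn_zero _

variable {E} in
lemma SmoothOn.add {s t : ∀ m, E.fib m} {U : Set M} (hs : E.SmoothOn s U) (ht : E.SmoothOn t U) :
    E.SmoothOn (s + t) U := fun φ hφ j => by
  rw [φ.coeff_add]; exact (hs φ hφ j).add (ht φ hφ j)

variable {E} in
lemma SmoothOn.bump {s : ∀ m, E.fib m} {U V : Set M} (hU : IsOpen U) (hV : IsOpen V)
    (hs : E.SmoothOn s (U ∩ V)) {χ : M → ℝ} (hχ : ContMDiff I 𝓘(ℝ, ℝ) ∞ χ)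
    (h : tsupport χ ⊆ U) : E.SmoothOn (fun m => χ m • s m) V := fun φ hφ j => by
  have h1 := NManifold.SmoothOn.bump hU (hV.inter φ.dom.isOpen)
    (by rw [← Set.inter_assoc]; exact hs φ hφ j) hχ h
  refine h1.congr fun m hm => ?_
  rw [φ.coeff_of_mem hm.2, φ.coeff_of_mem hm.2, ← algebraMap_smul (P.fib m) (χ m) (s m), map_smul,
    Finsupp.smul_apply, algebraMap_smul]

lemma smul_mem {m : M} {k d : ℤ} {a : P.fib m} {x : E.fib m} (ha : a ∈ P.grZ m k)
    (hx : x ∈ E.gr m d) : a • x ∈ E.gr m (k + d) := by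
  obtain ⟨φ, _, hm⟩ := E.cover m
  refine (φ.mem_gr_iff m hm _ _).2 fun j => ?_
  rw [map_smul, Finsupp.smul_apply, smul_eq_mul, add_sub_assoc]
  exact P.mul_memZ ha ((φ.mem_gr_iff m hm _ _).1 hx j)

lemma e_mem {φ : LocalFrame P E.fib E.gr} {m : M} (hm : m ∈ φ.dom) (j : Fin φ.r) :
    φ.e j m ∈ E.gr m (φ.v j) := by
  refine (φ.mem_gr_iff m hm _ _).2 fun i => ?_
  rw [← φ.basis_apply m hm, Module.Basis.repr_self]
  by_cases h : j = i
  · subst h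
    rw [Finsupp.single_eq_same, sub_self]
    exact SetLike.GradedOne.one_mem (A := P.gr m)
  · rw [Finsupp.single_eq_of_ne (Ne.symm h)]
    exact zero_mem _

variable {E} in
lemma SmoothOn.fun_smul {f : ∀ m, P.fib m} {s : ∀ m, E.fib m} {U : Set M} (hf : P.SmoothOn f U)
    (hs : E.SmoothOn s U) {k d : ℤ} (hfk : ∀ m ∈ U, f m ∈ P.grZ m k)
    (hsd : ∀ m ∈ U, s m ∈ E.gr m d) : E.SmoothOn (fun m => f m • s m) U := fun φ hφ j => by
  have h := (hf.mono Set.inter_subset_left).mulZ (hs φ hφ j) (k := k) (l := d - φ.v j)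
    (fun m hm => hfk m hm.1) (fun m hm => by
      rw [φ.coeff_of_mem hm.2]
      exact (φ.mem_gr_iff m hm.2 _ _).1 (hsd m hm.1) j)
  refine h.congr fun m hm => ?_
  rw [φ.coeff_of_mem hm.2, Pi.mul_apply, φ.coeff_of_mem hm.2, map_smul, Finsupp.smul_apply,
    smul_eq_mul]

lemma smul_sections {k : ℕ} {d : ℤ} {f : ∀ m, P.fib m} {s : ∀ m, E.fib m}
    (hf : f ∈ P.functions k) (hs : s ∈ E.sections d) :
    (fun m => f m • s m) ∈ E.sections (k + d) :=
  ⟨fun m => E.smul_mem (k := k) (hf.1 m) (hs.1 m),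
    SmoothOn.fun_smul hf.2 hs.2 (k := k) (fun m _ => hf.1 m) (fun m _ => hs.1 m)⟩

end NBundle

section Bump

variable [FiniteDimensional ℝ EM] [IsManifold I ∞ M] [T2Space M] [SigmaCompactSpace M]

lemma exists_bump (I : ModelWithCorners ℝ EM H) [IsManifold I ∞ M] {m : M} {U : Set M}
    (hU : IsOpen U) (hm : m ∈ U) :
    ∃ χ : M → ℝ, ContMDiff I 𝓘(ℝ, ℝ) ∞ χ ∧ tsupport χ ⊆ U ∧ χ m = 1 := by
  obtain ⟨ρ, hρ⟩ := SmoothPartitionOfUnity.exists_isSubordinate I (isClosed_singleton (x := m))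
    (fun _ : Unit => U) (fun _ => hU) (fun x hx => Set.mem_iUnion.2 ⟨(), by rwa [hx]⟩)
  refine ⟨ρ (), (ρ ()).contMDiff, hρ (), ?_⟩
  have := ρ.sum_eq_one (Set.mem_singleton m)
  rwa [finsum_unique] at this

end Bump

instance (n : ℕ) : CompactSpace (UnitBall n) :=
  isCompact_iff_compactSpace.1 (isCompact_closedBall _ _)

namespace NBundle

lemma partition_finite {P : NManifold.{u} I M} (E : NBundle.{u, v} P) {ι : Type*} {S : Set M}
    (ρ : SmoothPartitionOfUnity ι I M S) (L : ι → ∀ m, E.fib m) (m : M) :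
    (Function.support fun i => ρ i m • L i m).Finite :=
  (ρ.locallyFinite.point_finite m).subset fun i hi h => hi (by
    change ρ i m • L i m = 0
    rw [show ρ i m = 0 from h, zero_smul])

/-- Sections which are glued from local ones by a partition of unity. -/
lemma glue_mem {P : NManifold.{u} I M} (E : NBundle.{u, v} P) {ι : Type*} {S : Set M}
    (ρ : SmoothPartitionOfUnity ι I M S) (U : ι → Set M) (hU : ∀ i, IsOpen (U i))
    (hρ : ρ.IsSubordinate U) (L : ι → ∀ m, E.fib m) {d : ℤ} (hL : ∀ i, E.SmoothOn (L i) (U i))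
    (hd : ∀ i, ∀ m ∈ U i, L i m ∈ E.gr m d) :
    (fun m => ∑ᶠ i, ρ i m • L i m) ∈ E.sections d := by
  constructor
  · intro m
    refine finsum_induction (· ∈ E.gr m d) (zero_mem _) (fun _ _ => add_mem) fun i => ?_
    by_cases h : m ∈ U i
    · exact Submodule.smul_mem _ _ (hd i m h)
    · rw [image_eq_zero_of_notMem_tsupport fun h' => h (hρ i h'), zero_smul]
      exact zero_mem _
  · intro φ hφ j c hc α
    have hopen : IsOpen ((Set.univ ∩ φ.dom) ∩ c.dom : Set M) :=
      (isOpen_univ.inter φ.dom.isOpen).inter c.dom.isOpen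
    have key : ContMDiffOn I 𝓘(ℝ, ℝ) ∞
        (fun m => ∑ᶠ i, ρ i m • c.coeff (φ.coeff (L i) j) α m) ((Set.univ ∩ φ.dom) ∩ c.dom) := by
      intro m hm
      refine ContMDiffAt.contMDiffWithinAt (ρ.contMDiffAt_finsum fun i hi => ?_)
      exact (hL i φ hφ j c hc α).contMDiffAt
        ((((hU i).inter φ.dom.isOpen).inter c.dom.isOpen).mem_nhds ⟨⟨hρ i hi, hm.1.2⟩, hm.2⟩)
    refine key.congr fun m hm => ?_
    have h1 : ∀ s : ∀ m, E.fib m, c.coeff (φ.coeff s j) α m =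
        (c.basis m hm.2).repr ((φ.basis m hm.1.2).repr (s m) j) α := by
      intro s
      rw [c.coeff_of_mem hm.2, φ.coeff_of_mem hm.1.2]
    let T : E.fib m →+ ℝ :=
      { toFun x := (c.basis m hm.2).repr ((φ.basis m hm.1.2).repr x j) α
        map_zero' := by simp
        map_add' x y := by simp }
    rw [h1]
    refine (T.map_finsum (partition_finite E ρ L m)).trans (finsum_congr fun i => ?_)
    rw [h1]
    change (c.basis m hm.2).repr ((φ.basis m hm.1.2).repr (ρ i m • L i m) j) α = _
    rw [← algebraMap_smul (P.fib m) (ρ i m) (L i m), map_smul, Finsupp.smul_apply, algebraMap_smul,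
      map_smul, Finsupp.smul_apply]

variable [FiniteDimensional ℝ EM] [IsManifold I ∞ M] [T2Space M] [SigmaCompactSpace M]

variable {Y : NManifold.{u} I M} {n : ℕ} (E : NBundle.{u, v} (Y.prodBall n))

/-- Sections of the restriction to the centre extend. -/
lemma exists_restrict_eq {d : ℤ} {s₀ : ∀ m, E.CentreFib m}
    (hs₀ : s₀ ∈ E.restrictCentre.sections d) : ∃ s ∈ E.sections d, E.restrict s = s₀ := by
  let c := UnitBall.centre n
  let V : E.atlas → Set M := fun φ => (fun m : M => (m, c)) ⁻¹' φ.1.dom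
  have hV : ∀ φ, IsOpen (V φ) := fun φ => φ.1.dom.isOpen.preimage (by fun_prop)
  let U : E.atlas → Set (M × UnitBall n) := fun φ => φ.1.dom ∩ Prod.fst ⁻¹' (V φ)
  have hU : ∀ φ, IsOpen (U φ) := fun φ => φ.1.dom.isOpen.inter ((hV φ).preimage continuous_fst)
  have hclosed : IsClosed {p : M × UnitBall n | p.2 = c} :=
    isClosed_eq continuous_snd continuous_const
  obtain ⟨ρ, hρ⟩ := SmoothPartitionOfUnity.exists_isSubordinate (I.prod (UnitBall.model n))
    hclosed U hU (by
      rintro ⟨m, b⟩ (rfl : b = c)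
      obtain ⟨φ, hφ, h⟩ := E.cover (m, c)
      exact Set.mem_iUnion.2 ⟨⟨φ, hφ⟩, h, h⟩)
  let L : E.atlas → ∀ p, E.fib p := fun φ p =>
    ∑ j, Y.incl n p ((E.centreFrame φ.1).coeff s₀ j p.1) • φ.1.e j p
  have hc : ∀ (φ : E.atlas) (j : Fin φ.1.r), ∀ p ∈ U φ,
      Y.incl n p ((E.centreFrame φ.1).coeff s₀ j p.1) ∈
        (Y.prodBall n).grZ p (d - φ.1.v j) := by
    intro φ j p hp
    exact Y.incl_memZ n p ((E.centreFrame φ.1).coeff_memZ (m := p.1) hp.2 (hs₀.1 p.1) j)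
  refine ⟨_, glue_mem E ρ U hU hρ L (d := d) ?_ ?_, ?_⟩
  · intro φ
    have : ∀ t : Finset (Fin φ.1.r), E.SmoothOn (fun p =>
        ∑ j ∈ t, Y.incl n p ((E.centreFrame φ.1).coeff s₀ j p.1) • φ.1.e j p) (U φ) := by
      classical
      intro t
      induction t using Finset.induction_on with
      | empty => exact (E.smoothOn_zero _).congr fun p _ => by simp
      | insert j t hj ih =>
        simp_rw [Finset.sum_insert hj]
        refine SmoothOn.add ?_ ih
        refine SmoothOn.fun_smul (k := d - φ.1.v j) (d := φ.1.v j) ?_ ?_ (hc φ j)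
          fun p hp => E.e_mem hp.1 j
        · refine (Y.incl_smoothOn n (U := Set.univ ∩ (E.centreFrame φ.1).dom)
            (hs₀.2 _ ⟨φ.1, φ.2, rfl⟩ j)).mono fun p hp => ⟨trivial, hp.2⟩
        · intro φ' hφ' i
          exact (E.compat φ.1 φ.2 φ' hφ' j i).mono fun p hp => ⟨hp.1.1, hp.2⟩
    exact this Finset.univ
  · intro φ p hp
    refine Submodule.sum_mem _ fun j _ => ?_
    have := E.smul_mem (hc φ j p hp) (E.e_mem hp.1 j)
    rwa [sub_add_cancel] at this
  · ext m
    change E.centreMk m (∑ᶠ i, ρ i (m, c) • L i (m, c)) = s₀ m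
    rw [← LinearMap.toAddMonoidHom_coe,
      AddMonoidHom.map_finsum _ (partition_finite E ρ L (m, c))]
    have h1 : ∀ φ, (E.centreMk m).toAddMonoidHom (ρ φ (m, c) • L φ (m, c)) =
        ρ φ (m, c) • s₀ m := by
      intro φ
      by_cases h : (m, c) ∈ φ.1.dom
      · rw [LinearMap.toAddMonoidHom_coe, map_smul]
        congr 1
        change E.centreMk m (∑ j, _) = _
        rw [map_sum]
        exact (E.centreFrame φ.1).sum_coeff (m := m) h s₀
      · rw [image_eq_zero_of_notMem_tsupport fun h' => h (hρ φ h').1, zero_smul, zero_smul,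
          map_zero]
    simp_rw [h1]
    rw [← finsum_smul, ρ.sum_eq_one (show (m, c) ∈ {p : M × UnitBall n | p.2 = c} from rfl),
      one_smul]

end NBundle

namespace NQBundle

lemma D_zero {P : NManifold.{u} I M} {Q : (∀ m, P.fib m) → ∀ m, P.fib m}
    (E : NQBundle.{u, v} P Q) : E.D 0 = 0 := by
  have := E.D_smul 0 0 (zero_mem _) 0
  rwa [zero_smul, zero_smul] at this

lemma D_sum {P : NManifold.{u} I M} {Q : (∀ m, P.fib m) → ∀ m, P.fib m}
    (E : NQBundle.{u, v} P Q) {d : ℤ} {ι : Type*} (t : Finset ι) (s : ι → ∀ m, E.fib m)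
    (hs : ∀ i, s i ∈ E.sections d) : E.D (∑ i ∈ t, s i) = ∑ i ∈ t, E.D (s i) := by
  classical
  induction t using Finset.induction_on with
  | empty => simpa using E.D_zero
  | insert i t hi ih =>
    rw [Finset.sum_insert hi, Finset.sum_insert hi,
      E.D_add d _ (hs i) _ (Submodule.sum_mem _ fun j _ => hs j), ih]

variable {Y : NQManifold.{u} I M} {n : ℕ}
  (E : NQBundle.{u, v} (Y.prodBall n) (Y.prodBallQ n))

lemma restrict_leibniz {k : ℕ} {d : ℤ} {f : ∀ p, (Y.prodBall n).fib p}
    (hf : f ∈ (Y.prodBall n).functions k) {s : ∀ p, E.fib p} (hs : s ∈ E.sections d) :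
    E.restrict (E.D (fun p => f p • s p)) = fun m =>
      Y.Q (fun m => Y.augment n (m, UnitBall.centre n) (f (m, UnitBall.centre n))) m •
        E.restrict s m + (-1 : ℝ) ^ k •
          (Y.augment n (m, UnitBall.centre n) (f (m, UnitBall.centre n)) •
            E.restrict (E.D s) m) := by
  rw [E.D_leibniz k d f hf s hs]
  ext m
  change E.centreMk m _ = _
  rw [map_add, E.centreMk_smul, map_smul, E.centreMk_smul,
    NManifold.augment_prodBallQ Y n f (m, UnitBall.centre n)]
  rfl

variable [FiniteDimensional ℝ EM] [IsManifold I ∞ M] [T2Space M] [SigmaCompactSpace M]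

/-- The differential preserves the sections which vanish on `Y × {centre}`. -/
lemma restrict_D_eq_zero {d : ℤ} {s : ∀ p, E.fib p} (hs : s ∈ E.sections d)
    (h : E.restrict s = 0) : E.restrict (E.D s) = 0 := by
  ext m
  have hQ0 : Y.Q 0 = 0 := by
    have := Y.Q_smul 0 0 (zero_mem _) 0
    rwa [zero_smul, zero_smul] at this
  obtain ⟨φ, hφ, hm⟩ := E.cover (m, UnitBall.centre n)
  obtain ⟨χ, hχ, hsupp, h1⟩ := exists_bump (I.prod (UnitBall.model n)) φ.dom.isOpen hm
  have ha : ∀ j m', Y.augment n (m', UnitBall.centre n)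
      (φ.coeff s j (m', UnitBall.centre n)) = 0 := by
    intro j m'
    rw [← E.centreFrame_coeff φ s j m', h]
    exact congrFun ((E.centreFrame φ).coeff_zero j) m'
  let T : Fin φ.r → ∀ p, E.fib p := fun j p => (χ p • φ.coeff s j p) • (χ p • φ.e j p)
  have hT : ∀ j, T j ∈ E.sections d ∧ E.restrict (E.D (T j)) m = 0 := by
    intro j
    have hS : (fun p => χ p • φ.e j p) ∈ E.sections (φ.v j) := by
      constructor
      · intro p
        by_cases hp : p ∈ φ.dom
        · exact Submodule.smul_mem _ _ (E.e_mem hp j)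
        · change χ p • φ.e j p ∈ _
          rw [image_eq_zero_of_notMem_tsupport fun h' => hp (hsupp h'), zero_smul]
          exact zero_mem _
      · refine NBundle.SmoothOn.bump φ.dom.isOpen isOpen_univ ?_ hχ hsupp
        intro φ' hφ' i
        exact (E.compat φ hφ φ' hφ' j i).mono fun p hp => ⟨hp.1.1, hp.2⟩
    obtain ⟨k, hk⟩ | ⟨k, hk⟩ : (∃ k : ℕ, d - φ.v j = Int.ofNat k) ∨
        ∃ k : ℕ, d - φ.v j = Int.negSucc k := by
      cases d - φ.v j with
      | ofNat k => exact Or.inl ⟨k, rfl⟩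
      | negSucc k => exact Or.inr ⟨k, rfl⟩
    · have hA : (fun p => χ p • φ.coeff s j p) ∈ (Y.prodBall n).functions k := by
        constructor
        · intro p
          by_cases hp : p ∈ φ.dom
          · have := φ.coeff_memZ hp (hs.1 p) j
            rw [hk] at this
            exact Submodule.smul_mem _ _ this
          · change χ p • φ.coeff s j p ∈ _
            rw [image_eq_zero_of_notMem_tsupport fun h' => hp (hsupp h'), zero_smul]
            exact zero_mem _
        · refine NManifold.SmoothOn.bump φ.dom.isOpen isOpen_univ ?_ hχ hsupp
          exact (hs.2 φ hφ j).mono fun p hp => ⟨trivial, hp.1⟩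
      have hd : (k : ℤ) + φ.v j = d := by rw [← Int.ofNat_eq_natCast, ← hk]; ring
      refine ⟨hd ▸ E.smul_sections hA hS, ?_⟩
      have h2 := congrFun (E.restrict_leibniz hA hS) m
      refine h2.trans ?_
      have h3 : ∀ m', Y.augment n (m', UnitBall.centre n) (χ (m', UnitBall.centre n) •
          φ.coeff s j (m', UnitBall.centre n)) = 0 := fun m' => by
        rw [map_smul, ha, smul_zero]
      simp only [h3]
      rw [show (fun _ => 0 : ∀ m, Y.fib m) = 0 from rfl, hQ0, Pi.zero_apply, zero_smul, zero_smul,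
        smul_zero, add_zero]
    · have h0 : T j = 0 := by
        ext p
        have : φ.coeff s j p = 0 := by
          by_cases hp : p ∈ φ.dom
          · have := φ.coeff_memZ hp (hs.1 p) j
            rwa [hk] at this
          · exact dif_neg hp
        change (χ p • φ.coeff s j p) • _ = (0 : E.fib p)
        rw [this, smul_zero, zero_smul]
      rw [h0, E.D_zero]
      exact ⟨zero_mem _, map_zero (E.centreMk m)⟩
  let g : ∀ p, (Y.prodBall n).fib p := fun p => (1 - χ p * χ p) • 1
  have hg : g ∈ (Y.prodBall n).functions 0 :=
    (Y.prodBall n).smul_one_mem (contMDiff_const.sub (hχ.mul hχ))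
  have hgs : (fun p => g p • s p) ∈ E.sections d := by
    have := E.smul_sections hg hs
    rwa [Nat.cast_zero, zero_add] at this
  have hsum : s = ∑ j, T j + fun p => g p • s p := by
    ext p
    rw [Pi.add_apply, Finset.sum_apply]
    change s p = ∑ j, (χ p • φ.coeff s j p) • (χ p • φ.e j p) +
      ((1 - χ p * χ p) • (1 : (Y.prodBall n).fib p)) • s p
    rw [smul_assoc, one_smul]
    have h2 : ∑ j, (χ p • φ.coeff s j p) • (χ p • φ.e j p) = (χ p * χ p) • s p := by
      by_cases hp : p ∈ φ.dom
      · conv_rhs => rw [← φ.sum_coeff hp s]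
        rw [Finset.smul_sum]
        refine Finset.sum_congr rfl fun j _ => ?_
        rw [smul_assoc, mul_smul, smul_algebra_smul_comm]
      · simp [image_eq_zero_of_notMem_tsupport fun h' => hp (hsupp h')]
    rw [h2, ← add_smul, add_sub_cancel, one_smul]
  conv_lhs => rw [hsum]
  rw [E.D_add d _ (Submodule.sum_mem _ fun j _ => (hT j).1) _ hgs,
    E.D_sum _ _ fun j => (hT j).1]
  change E.centreMk m ((∑ j, E.D (T j) + E.D (fun p => g p • s p)) (m, UnitBall.centre n)) = 0
  have hz : ∑ j, E.centreMk m (E.D (T j) (m, UnitBall.centre n)) = 0 :=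
    Finset.sum_eq_zero fun j _ => (hT j).2
  rw [Pi.add_apply, Finset.sum_apply, map_add, map_sum]
  refine (congrArg (· + _) hz).trans ((zero_add _).trans ?_)
  refine (congrFun (E.restrict_leibniz hg hs) m).trans ?_
  have hg0 : g (m, UnitBall.centre n) = 0 := by
    change (1 - χ (m, UnitBall.centre n) * χ (m, UnitBall.centre n)) • _ = _
    rw [h1, mul_one, sub_self, zero_smul]
  rw [h, hg0, map_zero, zero_smul, smul_zero, add_zero, Pi.zero_apply, smul_zero]

lemma restrict_D_congr {d d' : ℤ} {s s' : ∀ p, E.fib p} (hs : s ∈ E.sections d)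
    (hs' : s' ∈ E.sections d') (h : E.restrict s = E.restrict s') :
    E.restrict (E.D s) = E.restrict (E.D s') := by
  by_cases hd : d = d'
  · subst hd
    have h1 : E.restrict (s + (-1 : ℝ) • s') = 0 := by
      ext m
      change E.centreMk m (_ + (-1 : ℝ) • _) = 0
      rw [map_add, map_smul, neg_one_smul]
      exact add_neg_eq_zero.2 (congrFun h m)
    have hs1 : (-1 : ℝ) • s' ∈ E.sections d := Submodule.smul_mem _ _ hs'
    have h2 := E.restrict_D_eq_zero (add_mem hs hs1) h1
    rw [E.D_add d _ hs _ hs1, E.D_smul d _ hs'] at h2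
    ext m
    have h3 : E.centreMk m (_ + (-1 : ℝ) • _) = 0 := congrFun h2 m
    rw [map_add, map_smul, neg_one_smul] at h3
    exact add_neg_eq_zero.1 h3
  · have h0 : E.restrict s = 0 := by
      ext m
      obtain ⟨φ, _, hm⟩ := E.restrictCentre.cover m
      have h1 : E.restrict s m ∈ E.restrictCentre.gr m d := ⟨_, hs.1 _, rfl⟩
      have h2 : E.restrict s m ∈ E.restrictCentre.gr m d' := by
        rw [h]; exact ⟨_, hs'.1 _, rfl⟩
      have h3 : ∀ j, (φ.basis m hm).repr (E.restrict s m) j = 0 := fun j =>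
        Y.eq_zero_of_mem_grZ (k := d - φ.v j) (l := d' - φ.v j) (by omega)
          ((φ.mem_gr_iff m hm _ _).1 h1 j) ((φ.mem_gr_iff m hm _ _).1 h2 j)
      exact (φ.basis m hm).ext_elem fun j => (h3 j).trans (by
        rw [Pi.zero_apply]; exact (congrArg (· j) (map_zero (φ.basis m hm).repr)).symm)
    rw [E.restrict_D_eq_zero hs h0, E.restrict_D_eq_zero hs' (h ▸ h0)]

open Classical in
/-- The differential on the sections of the restriction `E₀`: it is induced by the differential on the
sections of `E`. -/
def centreD (s₀ : ∀ m, E.CentreFib m) : ∀ m, E.CentreFib m :=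
  if h : ∃ s, (∃ d, s ∈ E.sections d) ∧ E.restrict s = s₀ then E.restrict (E.D h.choose) else 0

lemma centreD_restrict {d : ℤ} {s : ∀ p, E.fib p} (hs : s ∈ E.sections d) :
    E.centreD (E.restrict s) = E.restrict (E.D s) := by
  have h : ∃ t, (∃ d, t ∈ E.sections d) ∧ E.restrict t = E.restrict s := ⟨s, ⟨d, hs⟩, rfl⟩
  rw [centreD, dif_pos h]
  obtain ⟨d', hd'⟩ := h.choose_spec.1
  exact E.restrict_D_congr hd' hs h.choose_spec.2

/-- The restriction `E₀` of an NQ vector bundle `E` on `Y × T[1]Bⁿ` to `Y`, embedded as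
`Y × {centre}`. -/
def restrictCentre : NQBundle.{u, v} Y.toNManifold Y.Q where
  toNBundle := E.toNBundle.restrictCentre
  D := E.centreD
  D_mem d s₀ hs₀ := by
    obtain ⟨s, hs, rfl⟩ := E.exists_restrict_eq hs₀
    rw [E.centreD_restrict hs]
    exact E.restrict_mem (E.D_mem d s hs)
  D_add d s₀ hs₀ t₀ ht₀ := by
    obtain ⟨s, hs, rfl⟩ := E.exists_restrict_eq hs₀
    obtain ⟨t, ht, rfl⟩ := E.exists_restrict_eq ht₀
    have h : E.restrict s + E.restrict t = E.restrict (s + t) :=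
      funext fun m => (map_add (E.centreMk m) _ _).symm
    refine (congrArg E.centreD h).trans ?_
    rw [E.centreD_restrict (add_mem hs ht), E.D_add d s hs t ht, E.centreD_restrict hs,
      E.centreD_restrict ht]
    exact funext fun m => map_add (E.centreMk m) _ _
  D_smul d s₀ hs₀ r := by
    obtain ⟨s, hs, rfl⟩ := E.exists_restrict_eq hs₀
    have h : r • E.restrict s = E.restrict (r • s) :=
      funext fun m => (map_smul (E.centreMk m) _ _).symm
    refine (congrArg E.centreD h).trans ?_
    rw [E.centreD_restrict (Submodule.smul_mem _ r hs), E.D_smul d s hs, E.centreD_restrict hs]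
    exact funext fun m => map_smul (E.centreMk m) _ _
  D_leibniz k d f hf s₀ hs₀ := by
    obtain ⟨s, hs, rfl⟩ := E.exists_restrict_eq hs₀
    have hF := Y.incl_functions n hf
    have h : (fun m => f m • E.restrict s m) =
        E.restrict (fun p => Y.incl n p (f p.1) • s p) := rfl
    refine (congrArg E.centreD h).trans ?_
    rw [E.centreD_restrict (E.smul_sections hF hs), E.restrict_leibniz hF hs,
      E.centreD_restrict hs]
    have h2 : ∀ m, Y.augment n (m, UnitBall.centre n)
        (Y.incl n (m, UnitBall.centre n) (f m)) = f m := fun m => Y.augment_incl n _ _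
    simp only [h2]
    rfl
  D_D d s₀ hs₀ := by
    obtain ⟨s, hs, rfl⟩ := E.exists_restrict_eq hs₀
    rw [E.centreD_restrict hs, E.centreD_restrict (E.D_mem d s hs), E.D_D d s hs]
    exact funext fun m => map_zero (E.centreMk m)

end NQBundle

namespace NBundle

variable {Y : NManifold.{u} I M} {n : ℕ} (E : NBundle.{u, v} (Y.prodBall n))

/-- The submodule of the fibre of `E` over a point of `Y × Sⁿ⁻¹` generated by the products with
functions which vanish on `Y × T[1]Sⁿ⁻¹`, i.e. with forms which vanish on the tangent vectors of the
sphere. -/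
def sphereIdeal (p : M × UnitBall n) : Submodule ((Y.prodBall n).fib p) (E.fib p) :=
  Submodule.span _ {x | ∃ a t,
    Y.restrictCovectors n (ℝ ∙ (p.2 : EuclideanSpace ℝ (Fin n)))ᗮ p a = 0 ∧ x = a • t}

/-- The families whose restriction to `Y × T[1]Sⁿ⁻¹` vanishes. -/
def vanishOnSphere : Submodule ℝ (∀ p, E.fib p) where
  carrier := {s | ∀ p : M × UnitBall n, ‖(p.2 : EuclideanSpace ℝ (Fin n))‖ = 1 →
    s p ∈ E.sphereIdeal p}
  zero_mem' p _ := zero_mem _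
  add_mem' hs ht p hp := add_mem (hs p hp) (ht p hp)
  smul_mem' r s hs p hp := by
    rw [Pi.smul_apply, ← algebraMap_smul ((Y.prodBall n).fib p) r (s p)]
    exact Submodule.smul_mem _ _ (hs p hp)

end NBundle

end NManifold

end

noncomputable section

/-! ### Smooth families of continuous paths -/

section Curry

open Set unitInterval

variable {E G : Type*} [NormedAddCommGroup E] [NormedSpace ℝ E] [NormedAddCommGroup G]
  [NormedSpace ℝ G]

/-! The statement is a Thom isomorphism with coefficients. Along the ball, `E` behaves like a flat
bundle, so relative to the sphere only the class of degree `n` of the ball contributes, with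
coefficients in `E₀`. No trivialization of `E` along the ball is constructed; Cartan calculus takes
its place. Contraction of forms with a vector field `V` on the ball is lifted to an operator `ι` on
sections (`NBundle.contract`), and `L = Dι + ιD` (`NQBundle.lieD`) commutes with `D` and satisfies
`L(χs) = V(χ)s + χ Ls` for functions `χ` on the body. Coordinates have positive degree, so in each
degree the sections are locally generated by finitely many of them over the smooth functions on the
body, and by compactness this holds uniformly along the ball. Therefore `Lw = s` is a linear
differential equation along the integral curves of `V`: it has smooth solutions (`exists_flowD_eq`),
and solutions are determined by initial values (`eq_zero_of_flowD_eq_zero`).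

This gives a Poincaré lemma. From `Lw = s` follows `L(Dw) = Ds`; if `Ds = 0` and `Dw` vanishes on
the initial hypersurface, then `Dw = 0` and `s = Dιw + ιDw = D(ιw)`. Sections over an open subset
never appear by themselves: they are represented by global sections modulo those which vanish on the
subset (`relCohomology`).

The Poincaré lemma is applied to three families of segments. Radial segments starting at the sphere
replace `Γ₀(E)` by the sections which vanish outside a small cube (`relCohomology_equiv_sphere`),
and by excision only a neighbourhood of that cube matters (`relCohomology_equiv_offCube`). Segments
parallel to a coordinate axis which start on one side of the cube show that sections vanishing on
that side are acyclic, so a Mayer–Vietoris argument trades the vanishing condition in one coordinate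
for one degree (`relCohomology_equiv_collar`); the `n` coordinates produce the shift by `n`.
Segments parallel to an axis which start at the hyperplane `x_k = 0` show that restriction to this
hyperplane does not change the cohomology (`exists_primitive_coordKernel`), and after all
coordinates only the centre is left (`relCohomology_equiv_restrictCentre`). -/

lemma ContinuousOn.curry_unitInterval {X : Set E} {A : ℝ × E → G}
    (hA : ContinuousOn A (Icc 0 1 ×ˢ X)) {Ψ : E → C(I, G)}
    (hΨ : ∀ x ∈ X, ∀ t : I, Ψ x t = A (t, x)) : ContinuousOn Ψ X := by
  rw [continuousOn_iff_continuous_domRestrict]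
  have hc : Continuous fun p : X × I => A (p.2, p.1) :=
    hA.comp_continuous (f := fun p : X × I => ((p.2 : ℝ), (p.1 : E))) (by fun_prop)
      fun p => ⟨p.2.2, p.1.2⟩
  convert (ContinuousMap.curry ⟨_, hc⟩).continuous using 1
  ext x t
  exact hΨ x x.2 t

variable [FiniteDimensional ℝ E]

/-- A continuous path of linear maps, as a linear map to continuous paths. -/
def ContinuousMap.flipCLM (B : C(I, E →L[ℝ] G)) : E →L[ℝ] C(I, G) :=
  LinearMap.toContinuousLinearMap
    { toFun := fun v => ⟨fun t => B t v, by fun_prop⟩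
      map_add' := fun v w => by ext t; simp
      map_smul' := fun r v => by ext t; simp }

lemma ContinuousMap.flipCLM_apply (B : C(I, E →L[ℝ] G)) (v : E) (t : I) :
    B.flipCLM v t = B t v := rfl

/-- The curried partial derivative is continuous for the sup norm, so near `x` the derivatives
differ by at most `ε` for all `t` at once. The mean value inequality then bounds the remainder
uniformly in `t`. -/
lemma hasFDerivWithinAt_curry {X : Set E} (hX : Convex ℝ X) {A : ℝ × E → G}
    {A' : ℝ × E → E →L[ℝ] G} (hA' : ContinuousOn A' (Icc 0 1 ×ˢ X))
    (h : ∀ t ∈ Icc (0 : ℝ) 1, ∀ x ∈ X, HasFDerivWithinAt (fun y => A (t, y)) (A' (t, x)) X x)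
    {Ψ : E → C(I, G)} (hΨ : ∀ x ∈ X, ∀ t : I, Ψ x t = A (t, x))
    {Ψ' : E → C(I, E →L[ℝ] G)} (hΨ' : ∀ x ∈ X, ∀ t : I, Ψ' x t = A' (t, x)) {x : E} (hx : x ∈ X) :
    HasFDerivWithinAt Ψ (Ψ' x).flipCLM X x := by
  rw [hasFDerivWithinAt_iff_isLittleO, Asymptotics.isLittleO_iff]
  intro ε hε
  have hc := hA'.curry_unitInterval hΨ' x hx
  obtain ⟨δ, hδ, hball⟩ := Metric.continuousWithinAt_iff.1 hc ε hε
  have hmem : X ∩ Metric.ball x δ ∈ nhdsWithin x X :=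
    inter_mem_nhdsWithin _ (Metric.ball_mem_nhds x hδ)
  filter_upwards [hmem] with y hy
  rw [ContinuousMap.norm_le _ (by positivity)]
  intro t
  have key := Convex.norm_image_sub_le_of_norm_hasFDerivWithin_le' (𝕜 := ℝ)
    (f := fun y => A (t, y)) (f' := fun z => A' (t, z)) (φ := A' (t, x)) (C := ε)
    (s := X ∩ Metric.ball x δ) (x := x) (y := y)
    (fun z hz => (h t t.2 z hz.1).mono inter_subset_left)
    (fun z hz => by
      rw [← hΨ' z hz.1, ← hΨ' x hx, ← ContinuousMap.sub_apply]
      exact (ContinuousMap.norm_coe_le_norm _ t).trans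
        (by rw [← dist_eq_norm]; exact (hball hz.1 hz.2).le))
    (hX.inter (convex_ball x δ)) ⟨hx, Metric.mem_ball_self hδ⟩ hy
  simp only [ContinuousMap.sub_apply, ContinuousMap.flipCLM_apply, hΨ x hx, hΨ y hy.1, hΨ' x hx]
  exact key

/-- The derivative of the curried map is again a curried map, built from the partial derivative of
`A` in the directions of `E`, which is as smooth as `A`. So differentiability can be iterated. This
converts smooth dependence on parameters into smoothness of a map to a Banach space of paths. -/
lemma ContDiffOn.curry_unitInterval {X : Set E} (hX : Convex ℝ X) (hX' : UniqueDiffOn ℝ X)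
    {A : ℝ × E → G} (hA : ContDiffOn ℝ ∞ A (Icc 0 1 ×ˢ X)) {Ψ : E → C(I, G)}
    (hΨ : ∀ x ∈ X, ∀ t : I, Ψ x t = A (t, x)) : ContDiffOn ℝ ∞ Ψ X := by
  rw [contDiffOn_infty]
  intro n
  induction n generalizing A Ψ with
  | zero => exact contDiffOn_zero.2 (hA.continuousOn.curry_unitInterval hΨ)
  | succ n ih =>
    classical
    have hU : UniqueDiffOn ℝ (Icc (0 : ℝ) 1 ×ˢ X) := (uniqueDiffOn_Icc one_pos).prod hX'
    set A' : ℝ × E → E →L[ℝ] G := fun p =>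
      (fderivWithin ℝ A (Icc 0 1 ×ˢ X) p).comp (ContinuousLinearMap.inr ℝ ℝ E) with hA'def
    have hA' : ContDiffOn ℝ ∞ A' (Icc 0 1 ×ˢ X) :=
      (hA.fderivWithin hU le_rfl).clm_comp contDiffOn_const
    have hder : ∀ t ∈ Icc (0 : ℝ) 1, ∀ x ∈ X,
        HasFDerivWithinAt (fun y => A (t, y)) (A' (t, x)) X x := by
      intro t ht x hx
      have h1 := ((hA.differentiableOn (by simp)) (t, x) ⟨ht, hx⟩).hasFDerivWithinAt
      exact h1.comp x ((hasFDerivAt_prodMk_right t x).hasFDerivWithinAt) fun y hy => ⟨ht, hy⟩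
    have hcont : ∀ x ∈ X, Continuous fun t : I => A' (t, x) := fun x hx =>
      hA'.continuousOn.comp_continuous (f := fun t : I => ((t : ℝ), x)) (by fun_prop)
        fun t => ⟨t.2, hx⟩
    let Ψ' : E → C(I, E →L[ℝ] G) := fun x => if hx : x ∈ X then ⟨_, hcont x hx⟩ else 0
    have hΨ' : ∀ x ∈ X, ∀ t : I, Ψ' x t = A' (t, x) := fun x hx t => by simp [Ψ', hx]
    have hD : ∀ x ∈ X, HasFDerivWithinAt Ψ (Ψ' x).flipCLM X x := fun x hx =>
      hasFDerivWithinAt_curry hX hA'.continuousOn hder hΨ hΨ' hx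
    rw [Nat.cast_succ, contDiffOn_succ_iff_fderivWithin hX']
    refine ⟨fun x hx => (hD x hx).differentiableWithinAt, fun h => absurd h (by simp), ?_⟩
    refine ContDiffOn.congr ?_ fun x hx => (hD x hx).fderivWithin (hX' x hx)
    -- Evaluation at a fixed vector keeps the target `G`, which the induction does not vary.
    rw [contDiffOn_clm_apply]
    intro v
    refine ih (A := fun p => A' p v) (hA'.clm_apply contDiffOn_const) ?_
    intro x hx t
    rw [ContinuousMap.flipCLM_apply, hΨ' x hx]

end Curry

/-! ### Linear differential equations on the unit interval -/

section Volterra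

open Set unitInterval

variable {G : Type*} [NormedAddCommGroup G] [NormedSpace ℝ G]

lemma continuous_IccExtend (f : C(I, G)) : Continuous (IccExtend zero_le_one f) :=
  f.continuous.Icc_extend'

lemma norm_IccExtend_le (f : C(I, G)) (t : ℝ) : ‖IccExtend zero_le_one f t‖ ≤ ‖f‖ :=
  f.norm_coe_le_norm _

/-- The primitive of a path which vanishes at the starting point. -/
def primitive : C(I, G) →L[ℝ] C(I, G) :=
  LinearMap.mkContinuous
    { toFun := fun f => ⟨fun t => ∫ τ in (0 : ℝ)..t, IccExtend zero_le_one f τ,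
        (intervalIntegral.continuous_primitive
          (fun a b => (continuous_IccExtend f).intervalIntegrable a b) 0).comp
          continuous_subtype_val⟩
      map_add' := fun f g => by
        ext t
        exact intervalIntegral.integral_add ((continuous_IccExtend f).intervalIntegrable _ _)
          ((continuous_IccExtend g).intervalIntegrable _ _)
      map_smul' := fun r f => by
        ext t
        exact intervalIntegral.integral_smul r _ } 1 (by
    intro f
    rw [one_mul, ContinuousMap.norm_le _ (norm_nonneg _)]
    intro t
    refine (intervalIntegral.norm_integral_le_of_norm_le_const
      (fun τ _ => norm_IccExtend_le f τ)).trans ?_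
    rw [sub_zero, abs_of_nonneg t.2.1]
    exact mul_le_of_le_one_right (norm_nonneg _) t.2.2)

lemma primitive_apply (f : C(I, G)) (t : I) :
    primitive f t = ∫ τ in (0 : ℝ)..t, IccExtend zero_le_one f τ := rfl

/-- The product of a path of operators and a path. -/
def pathMul : C(I, G →L[ℝ] G) →L[ℝ] C(I, G) →L[ℝ] C(I, G) :=
  LinearMap.mkContinuous₂
    (LinearMap.mk₂ ℝ (fun (B : C(I, G →L[ℝ] G)) (f : C(I, G)) =>
        (⟨fun t => B t (f t), by fun_prop⟩ : C(I, G)))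
      (fun B B' f => by ext t; simp) (fun r B f => by ext t; simp)
      (fun B f f' => by ext t; simp) (fun r B f => by ext t; simp)) 1 (by
    intro B f
    rw [one_mul, ContinuousMap.norm_le _ (by positivity)]
    intro t
    exact ((B t).le_opNorm _).trans (mul_le_mul (B.norm_coe_le_norm t) (f.norm_coe_le_norm t)
      (norm_nonneg _) (norm_nonneg B)))

lemma pathMul_apply (B : C(I, G →L[ℝ] G)) (f : C(I, G)) (t : I) :
    pathMul B f t = B t (f t) := rfl

/-- Each integration raises the power of `t` and divides by the new exponent. The resulting
factorial makes some power of the Volterra operator a contraction, however large `B` is. -/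
lemma norm_primitive_pathMul_pow_le (B : C(I, G →L[ℝ] G)) (f : C(I, G)) (k : ℕ) (t : I) :
    ‖((primitive ∘L pathMul B) ^ k) f t‖ ≤ ‖B‖ ^ k * (t : ℝ) ^ k / k.factorial * ‖f‖ := by
  induction k generalizing t with
  | zero => simpa using f.norm_coe_le_norm t
  | succ k ih =>
    rw [pow_succ', mul_apply_eq_comp, ContinuousLinearMap.comp_apply, primitive_apply]
    have hb : ∀ τ ∈ Ioc (0 : ℝ) t, ‖IccExtend zero_le_one
        (pathMul B (((primitive ∘L pathMul B) ^ k) f)) τ‖ ≤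
          ‖B‖ ^ (k + 1) / k.factorial * ‖f‖ * τ ^ k := by
      intro τ hτ
      have hτ' : τ ∈ Icc (0 : ℝ) 1 := ⟨hτ.1.le, hτ.2.trans t.2.2⟩
      rw [IccExtend_of_mem _ _ hτ', pathMul_apply]
      refine ((B _).le_opNorm _).trans ((mul_le_mul (B.norm_coe_le_norm _) (ih ⟨τ, hτ'⟩)
        (norm_nonneg _) (norm_nonneg _)).trans (le_of_eq ?_))
      rw [pow_succ]
      ring
    refine (intervalIntegral.norm_integral_le_of_norm_le t.2.1
      (MeasureTheory.ae_of_all _ hb) (Continuous.intervalIntegrable (by fun_prop) _ _)).trans ?_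
    rw [intervalIntegral.integral_const_mul, integral_pow, Nat.factorial_succ]
    push_cast
    rw [zero_pow (by omega), sub_zero]
    refine le_of_eq ?_
    field_simp

variable [CompleteSpace G]

lemma isUnit_one_sub_primitive_pathMul (B : C(I, G →L[ℝ] G)) :
    IsUnit (1 - primitive ∘L pathMul B : C(I, G) →L[ℝ] C(I, G)) := by
  have h0 := FloorSemiring.tendsto_pow_div_factorial_atTop ‖B‖
  obtain ⟨k, hk⟩ := (h0.eventually (gt_mem_nhds (one_pos : (0 : ℝ) < 1))).exists
  have h1 : ‖(primitive ∘L pathMul B : C(I, G) →L[ℝ] C(I, G)) ^ k‖ < 1 := by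
    refine lt_of_le_of_lt (ContinuousLinearMap.opNorm_le_bound _ (by positivity) fun f => ?_) hk
    rw [ContinuousMap.norm_le _ (by positivity)]
    intro t
    refine (norm_primitive_pathMul_pow_le B f k t).trans ?_
    gcongr
    exact mul_le_of_le_one_right (by positivity) (pow_le_one₀ t.2.1 t.2.2)
  have h2 := isUnit_one_sub_of_norm_lt_one (R := C(I, G) →L[ℝ] C(I, G)) h1
  -- With `T` the Volterra operator, `1 - T ^ k` is the product of `1 - T` and a geometric sum which
  -- commutes with it. So invertibility of `1 - T ^ k` passes to the factor.
  rw [← mul_neg_geom_sum] at h2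
  refine ((Commute.isUnit_mul_iff ?_).1 h2).1
  rw [Commute, SemiconjBy, mul_neg_geom_sum, geom_sum_mul_neg]

/-- The solution of `f' = B f + g` with initial value zero. -/
def linearODESol (B : C(I, G →L[ℝ] G)) (g : C(I, G)) : C(I, G) :=
  Ring.inverse (1 - primitive ∘L pathMul B : C(I, G) →L[ℝ] C(I, G)) (primitive g)

lemma linearODESol_eq (B : C(I, G →L[ℝ] G)) (g : C(I, G)) :
    linearODESol B g = primitive (pathMul B (linearODESol B g) + g) := by
  have h := congrArg (fun T => T (primitive g))
    (Ring.mul_inverse_cancel _ (isUnit_one_sub_primitive_pathMul B))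
  simp only [mul_apply_eq_comp, sub_apply,
    one_apply_eq_self, ContinuousLinearMap.comp_apply] at h
  rw [map_add, ← sub_eq_iff_eq_add']
  exact h

lemma linearODESol_zero (B : C(I, G →L[ℝ] G)) (g : C(I, G)) : linearODESol B g 0 = 0 := by
  rw [linearODESol_eq, primitive_apply]
  simp

lemma hasDerivWithinAt_linearODESol (B : C(I, G →L[ℝ] G)) (g : C(I, G)) (t : I) :
    HasDerivWithinAt (IccExtend zero_le_one (linearODESol B g))
      (B t (linearODESol B g t) + g t) (Icc 0 1) t := by
  set F := pathMul B (linearODESol B g) + g with hF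
  have hc := continuous_IccExtend F
  have h := intervalIntegral.integral_hasDerivAt_right (hc.intervalIntegrable 0 t)
    (hc.stronglyMeasurableAtFilter _ _) hc.continuousAt
  rw [IccExtend_val] at h
  refine h.hasDerivWithinAt.congr_of_mem (fun τ hτ => ?_) t.2
  rw [IccExtend_of_mem _ _ hτ, linearODESol_eq, primitive_apply]

/-- The solution is obtained by inverting an operator which depends continuously and linearly on
`B`, up to a constant, and inversion is smooth on the units of a Banach algebra. Smooth dependence
on parameters follows without differentiating the equation. -/
lemma ContDiffOn.linearODESol {E : Type*} [NormedAddCommGroup E] [NormedSpace ℝ E] {X : Set E}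
    {B : E → C(I, G →L[ℝ] G)} {g : E → C(I, G)} (hB : ContDiffOn ℝ ∞ B X)
    (hg : ContDiffOn ℝ ∞ g X) : ContDiffOn ℝ ∞ (fun x => linearODESol (B x) (g x)) X := by
  have h1 : ContDiffOn ℝ ∞ (fun x => (1 - primitive ∘L pathMul (B x) : C(I, G) →L[ℝ] C(I, G)))
      X := by
    have hp : ContDiff ℝ ∞ (pathMul : C(I, G →L[ℝ] G) → C(I, G) →L[ℝ] C(I, G)) :=
      ContinuousLinearMap.contDiff _
    exact contDiffOn_const.sub (contDiffOn_const.clm_comp (hp.comp_contDiffOn hB))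
  have hp : ContDiff ℝ ∞ (primitive : C(I, G) → C(I, G)) := ContinuousLinearMap.contDiff _
  refine ContDiffOn.clm_apply (fun x hx => ?_) (hp.comp_contDiffOn hg)
  obtain ⟨u, hu⟩ := isUnit_one_sub_primitive_pathMul (B x)
  have h2 := contDiffAt_ringInverse ℝ (R := C(I, G) →L[ℝ] C(I, G)) (n := ∞) u
  rw [hu] at h2
  exact h2.comp_contDiffWithinAt x (h1 x hx)

/-- A bound for `B` on the compact interval is a Lipschitz constant. The source `g` cancels in
differences and needs no regularity. -/
lemma eqOn_of_linearODE {B : ℝ → G →L[ℝ] G} (hB : ContinuousOn B (Icc 0 1)) {g : ℝ → G}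
    {f f' : ℝ → G} (hf : ∀ t ∈ Icc (0 : ℝ) 1, HasDerivWithinAt f (B t (f t) + g t) (Icc 0 1) t)
    (hf' : ∀ t ∈ Icc (0 : ℝ) 1, HasDerivWithinAt f' (B t (f' t) + g t) (Icc 0 1) t)
    (h0 : f 0 = f' 0) : EqOn f f' (Icc 0 1) := by
  obtain ⟨C, hC⟩ := isCompact_Icc.exists_bound_of_continuousOn hB
  have hC0 : 0 ≤ C := (norm_nonneg _).trans (hC 0 ⟨le_rfl, zero_le_one⟩)
  have hIci : ∀ {k k' : ℝ → G}, (∀ t ∈ Icc (0 : ℝ) 1, HasDerivWithinAt k (k' t) (Icc 0 1) t) →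
      ∀ t ∈ Ico (0 : ℝ) 1, HasDerivWithinAt k (k' t) (Ici t) t := fun h t ht =>
    (h t ⟨ht.1, ht.2.le⟩).mono_of_mem_nhdsWithin (Icc_mem_nhdsGE_of_mem ht)
  refine ODE_solution_unique_of_mem_Icc_right (v := fun t x => B t x + g t)
    (s := fun _ => univ) (K := ⟨C, hC0⟩) ?_ (fun t ht => (hf t ht).continuousWithinAt)
    (hIci hf) (fun _ _ => mem_univ _) (fun t ht => (hf' t ht).continuousWithinAt) (hIci hf')
    (fun _ _ => mem_univ _) h0
  intro t ht
  refine LipschitzOnWith.of_dist_le_mul fun x _ y _ => ?_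
  rw [dist_add_right, dist_eq_norm, dist_eq_norm, ← map_sub]
  exact ((B t).le_opNorm _).trans
    (mul_le_mul_of_nonneg_right (hC t ⟨ht.1, ht.2.le⟩) (norm_nonneg _))

end Volterra

end

noncomputable section

/-! ### Contraction of forms -/

/-- The parity involution of a graded algebra. -/
def parityMap {A : Type*} [Ring A] [Algebra ℝ A] (gr : ℕ → Submodule ℝ A) [GradedAlgebra gr] :
    A →ₗ[ℝ] A :=
  (DirectSum.toModule ℝ ℕ A fun k => ((-1 : ℝ) ^ k) • (gr k).subtype) ∘ₗ
    (DirectSum.decomposeLinearEquiv gr).toLinearMap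

lemma parityMap_of_mem {A : Type*} [Ring A] [Algebra ℝ A] (gr : ℕ → Submodule ℝ A)
    [GradedAlgebra gr] {k : ℕ} {a : A} (ha : a ∈ gr k) : parityMap gr a = (-1 : ℝ) ^ k • a := by
  rw [parityMap, LinearMap.comp_apply, LinearEquiv.coe_coe, DirectSum.decomposeLinearEquiv_apply,
    DirectSum.decompose_of_mem _ ha, ← DirectSum.lof_eq_of ℝ, DirectSum.toModule_lof]
  rfl

lemma parityMap_mul {A : Type*} [Ring A] [Algebra ℝ A] (gr : ℕ → Submodule ℝ A)
    [GradedAlgebra gr] {k : ℕ} {a : A} (ha : a ∈ gr k) (b : A) :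
    parityMap gr (a * b) = (-1 : ℝ) ^ k • (a * parityMap gr b) := by
  induction b using DirectSum.Decomposition.inductionOn gr with
  | zero => simp
  | homogeneous b =>
    rename_i i
    rw [parityMap_of_mem gr (SetLike.GradedMul.mul_mem ha b.2), parityMap_of_mem gr b.2,
      mul_smul_comm, smul_smul, pow_add]
  | add b b' h h' => rw [mul_add, map_add, h, h', map_add, mul_add, smul_add]

namespace Covectors

/-- The contraction of forms with a vector. -/
def contract {n : ℕ} : EuclideanSpace ℝ (Fin n) →ₗ[ℝ] Covectors n →ₗ[ℝ] Covectors n :=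
  (CliffordAlgebra.contractLeft (Q := (0 : QuadraticForm ℝ _))) ∘ₗ
    Module.Dual.eval ℝ (EuclideanSpace ℝ (Fin n))

lemma contract_ι_mul {n : ℕ} (v : EuclideanSpace ℝ (Fin n))
    (ξ : Module.Dual ℝ (EuclideanSpace ℝ (Fin n))) (x : Covectors n) :
    contract v (ExteriorAlgebra.ι ℝ ξ * x) =
      ξ v • x - ExteriorAlgebra.ι ℝ ξ * contract v x :=
  CliffordAlgebra.contractLeft_ι_mul _ ξ x

lemma contract_algebraMap {n : ℕ} (v : EuclideanSpace ℝ (Fin n)) (r : ℝ) :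
    contract v (algebraMap ℝ (Covectors n) r) = 0 :=
  CliffordAlgebra.contractLeft_algebraMap (Q := (0 : QuadraticForm ℝ _)) _ r

lemma contract_mem {n j : ℕ} (v : EuclideanSpace ℝ (Fin n)) {x : Covectors n}
    (hx : x ∈ gr n (j + 1)) : contract v x ∈ gr n j := by
  -- The degree zero case has to be carried along: the step from a scalar to a covector uses that
  -- contraction kills scalars.
  have key : ∀ j, ∀ x ∈ gr n j, (j = 0 → contract v x = 0) ∧
      ∀ i, j = i + 1 → contract v x ∈ gr n i := by
    intro j x hx
    induction hx using Submodule.pow_induction_on_left' with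
    | algebraMap r => exact ⟨fun _ => contract_algebraMap v r, fun i hi => by omega⟩
    | add x y i hx hy h1 h2 =>
      refine ⟨fun h => by rw [map_add, h1.1 h, h2.1 h, add_zero], fun i h => ?_⟩
      rw [map_add]
      exact add_mem (h1.2 i h) (h2.2 i h)
    | mem_mul m hm i x hx h =>
      obtain ⟨ξ, rfl⟩ := hm
      refine ⟨fun h => by omega, fun i' h' => ?_⟩
      obtain rfl : i = i' := by omega
      rw [contract_ι_mul]
      refine sub_mem (Submodule.smul_mem _ _ hx) ?_
      cases i with
      | zero => rw [h.1 rfl, mul_zero]; exact zero_mem _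
      | succ i =>
        have h3 : ExteriorAlgebra.ι ℝ ξ ∈ gr n 1 := by
          simp [gr, ExteriorAlgebra.exteriorPower]
        rw [add_comm]
        exact SetLike.GradedMul.mul_mem h3 (h.2 i rfl)
  exact (key _ x hx).2 j rfl

lemma contract_of_mem_zero {n : ℕ} (v : EuclideanSpace ℝ (Fin n)) {x : Covectors n}
    (hx : x ∈ gr n 0) : contract v x = 0 := by
  obtain ⟨r, rfl⟩ := Submodule.mem_one.1 (show x ∈ (1 : Submodule ℝ (Covectors n)) by
    simpa [gr, ExteriorAlgebra.exteriorPower] using hx)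
  exact contract_algebraMap v r

end Covectors

/-! ### Contraction of functions on `Y × T[1]Bⁿ` -/

section Functions

variable {EM : Type*} [NormedAddCommGroup EM] [NormedSpace ℝ EM] {H : Type*} [TopologicalSpace H]
  {I : ModelWithCorners ℝ EM H} {M : Type*} [TopologicalSpace M] [ChartedSpace H M]

namespace NManifold

lemma SmoothOn.real_smul {P : NManifold.{u} I M} {χ : M → ℝ} {f : ∀ m, P.fib m} {U : Set M}
    (hχ : ContMDiffOn I 𝓘(ℝ, ℝ) ∞ χ U) (hf : P.SmoothOn f U) :
    P.SmoothOn (fun m => χ m • f m) U := fun c hc α => by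
  refine ((hχ.mono Set.inter_subset_left).mul (hf c hc α)).congr fun m hm => ?_
  rw [Pi.mul_apply, c.coeff_of_mem hm.2, c.coeff_of_mem hm.2, map_smul, Finsupp.smul_apply,
    smul_eq_mul]

lemma SmoothOn.finset_sum {P : NManifold.{u} I M} {ι : Type*} (t : Finset ι)
    {f : ι → ∀ m, P.fib m} {U : Set M} (hf : ∀ i ∈ t, P.SmoothOn (f i) U) :
    P.SmoothOn (fun m => ∑ i ∈ t, f i m) U := by
  classical
  induction t using Finset.induction_on with
  | empty => exact (P.smoothOn_zero U).congr fun _ _ => by simp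
  | insert i t hi ih =>
    simp_rw [Finset.sum_insert hi]
    exact (hf i (Finset.mem_insert_self _ _)).add
      (ih fun j hj => hf j (Finset.mem_insert_of_mem hj))

variable (Y : NManifold.{u} I M) (n : ℕ)

/-- The contraction of functions on `Y × T[1]Bⁿ` with a tangent vector of the ball. -/
def contract (p : M × UnitBall n) :
    EuclideanSpace ℝ (Fin n) →ₗ[ℝ] (Y.prodBall n).fib p →ₗ[ℝ] (Y.prodBall n).fib p where
  -- The parity map is the sign for moving the odd contraction past the factor from `Y`.
  toFun v := (GradedTensorProduct.of ℝ (Y.gr p.1) (Covectors.gr n)).toLinearMap ∘ₗ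
    TensorProduct.map (parityMap (Y.gr p.1)) (Covectors.contract v) ∘ₗ
      (GradedTensorProduct.of ℝ (Y.gr p.1) (Covectors.gr n)).symm.toLinearMap
  map_add' v w := by
    rw [map_add, TensorProduct.map_add_right]
    rfl
  map_smul' r v := by
    rw [map_smul, TensorProduct.map_smul_right]
    rfl

lemma contract_form (p : M × UnitBall n) (v : EuclideanSpace ℝ (Fin n)) (a : Y.fib p.1)
    (x : Covectors n) : Y.contract n p v (Y.form n p a x) =
      Y.form n p (parityMap (Y.gr p.1) a) (Covectors.contract v x) := rfl

lemma form_smul_left (p : M × UnitBall n) (r : ℝ) (a : Y.fib p.1) (x : Covectors n) :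
    Y.form n p (r • a) x = r • Y.form n p a x := rfl

lemma form_smul_right (p : M × UnitBall n) (r : ℝ) (a : Y.fib p.1) (x : Covectors n) :
    Y.form n p a (r • x) = r • Y.form n p a x := TensorProduct.tmul_smul _ _ _

lemma form_sub_right (p : M × UnitBall n) (a : Y.fib p.1) (x y : Covectors n) :
    Y.form n p a (x - y) = Y.form n p a x - Y.form n p a y := TensorProduct.tmul_sub _ _ _

lemma form_add_right (p : M × UnitBall n) (a : Y.fib p.1) (x y : Covectors n) :
    Y.form n p a (x + y) = Y.form n p a x + Y.form n p a y := TensorProduct.tmul_add _ _ _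

variable {n} in
-- Reduces linear identities to products of a homogeneous function on `Y` and a homogeneous form,
-- where the signs are explicit.
lemma form_induction {p : M × UnitBall n} {C : (Y.prodBall n).fib p → Prop}
    (b : (Y.prodBall n).fib p) (zero : C 0)
    (form : ∀ k, ∀ a ∈ Y.gr p.1 k, ∀ j, ∀ x ∈ Covectors.gr n j, C (Y.form n p a x))
    (add : ∀ b b', C b → C b' → C (b + b')) : C b := by
  induction b using DirectSum.Decomposition.inductionOn ((Y.prodBall n).gr p) with
  | zero => exact zero
  | add b b' h h' => exact add b b' h h'
  | homogeneous b =>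
    obtain ⟨b, hb⟩ := b
    -- `C` is not assumed to be stable under scalars; with `r` quantified, scalars are absorbed into
    -- the factor from `Y`.
    suffices h : ∀ r : ℝ, C (r • b) by simpa using h 1
    refine Submodule.span_induction (p := fun b _ => ∀ r : ℝ, C (r • b)) ?_ (fun r => ?_)
      (fun b b' _ _ h h' r => ?_) (fun t b _ h r => ?_) hb
    · rintro _ ⟨i, j, _, a, ha, x, hx, rfl⟩ r
      exact form i (r • a) (Submodule.smul_mem _ _ ha) j x hx
    · rwa [smul_zero]
    · rw [smul_add]
      exact add _ _ (h r) (h' r)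
    · exact (congrArg C (smul_smul r t b)).mpr (h (r * t))

lemma form_mul {p : M × UnitBall n} {i j : ℕ} (a : Y.fib p.1) {x : Covectors n}
    (hx : x ∈ Covectors.gr n i) {a' : Y.fib p.1} (ha' : a' ∈ Y.gr p.1 j) (x' : Covectors n) :
    Y.form n p a x * Y.form n p a' x' =
      (-1 : ℝ) ^ (i * j) • Y.form n p (a * a') (x * x') :=
  tensorGr.tmul_mul (Y.gr p.1) (Covectors.gr n) a hx ha' x'

/-- A function of degree one on `Y × T[1]Bⁿ`, at a point: the sum of a function on `Y` and of a
covector of the ball. -/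
def oneForm (p : M × UnitBall n) (y : Y.fib p.1)
    (ξ : Module.Dual ℝ (EuclideanSpace ℝ (Fin n))) : (Y.prodBall n).fib p :=
  Y.form n p y 1 + Y.form n p 1 (ExteriorAlgebra.ι ℝ ξ)

/-- Contraction with a vector is an odd derivation, on products with functions of degree one. -/
lemma contract_oneForm_mul {p : M × UnitBall n} {y : Y.fib p.1} (hy : y ∈ Y.gr p.1 1)
    (ξ : Module.Dual ℝ (EuclideanSpace ℝ (Fin n))) (v : EuclideanSpace ℝ (Fin n))
    (b : (Y.prodBall n).fib p) :
    Y.contract n p v (Y.oneForm n p y ξ * b) =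
      ξ v • b - Y.oneForm n p y ξ * Y.contract n p v b := by
  induction b using Y.form_induction with
  | zero => simp
  | add b b' h h' => rw [mul_add, map_add, h, h', map_add, mul_add, smul_add]; abel
  | form k a ha j x hx =>
    have h1 : ExteriorAlgebra.ι ℝ ξ ∈ Covectors.gr n 1 := by
      simp [Covectors.gr, ExteriorAlgebra.exteriorPower]
    have h0 : (1 : Covectors n) ∈ Covectors.gr n 0 := SetLike.GradedOne.one_mem
    have ha' : parityMap (Y.gr p.1) a ∈ Y.gr p.1 k := by
      rw [parityMap_of_mem _ ha]; exact Submodule.smul_mem _ _ ha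
    rw [oneForm, add_mul, add_mul, contract_form, Y.form_mul n _ h0 ha, Y.form_mul n _ h1 ha,
      Y.form_mul n _ h0 ha', Y.form_mul n _ h1 ha', map_add, map_smul, map_smul, contract_form,
      contract_form, parityMap_mul _ hy, one_mul, one_mul, one_mul, one_mul,
      Covectors.contract_ι_mul, parityMap_of_mem _ ha]
    simp only [form_smul_left, zero_mul, one_mul, pow_zero, pow_one, form_sub_right,
      form_smul_right, smul_sub, smul_smul, mul_smul_comm]
    rcases neg_one_pow_eq_or ℝ k with hk | hk <;> rw [hk] <;> module

lemma contract_mem {p : M × UnitBall n} (v : EuclideanSpace ℝ (Fin n)) {k : ℤ}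
    {b : (Y.prodBall n).fib p} (hb : b ∈ (Y.prodBall n).grZ p k) :
    Y.contract n p v b ∈ (Y.prodBall n).grZ p (k - 1) := by
  cases k with
  | negSucc k => 
    rw [show b = 0 from hb, map_zero]; exact zero_mem _
  | ofNat k =>
    have hb' : b ∈ (Y.prodBall n).gr p k := hb
    refine Submodule.span_induction (p := fun b _ => Y.contract n p v b ∈
      (Y.prodBall n).grZ p (Int.ofNat k - 1)) ?_ ?_ ?_ ?_ hb'
    · rintro _ ⟨i, j, h, a, ha, x, hx, rfl⟩
      change Y.contract n p v (Y.form n p a x) ∈ _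
      have ha' : parityMap (Y.gr p.1) a ∈ Y.gr p.1 i := by
        rw [parityMap_of_mem _ ha]; exact Submodule.smul_mem _ _ ha
      rw [contract_form]
      cases j with
      | zero => 
        rw [Covectors.contract_of_mem_zero v hx]
        have : Y.form n p (parityMap (Y.gr p.1) a) 0 = 0 := TensorProduct.tmul_zero _ _
        rw [this]
        exact zero_mem _
      | succ j =>
        have : Int.ofNat k - 1 = Int.ofNat (i + j) := by
          simp only [Int.ofNat_eq_natCast]; omega
        rw [this]
        exact tensorGr.tmul_mem _ _ rfl ha' (Covectors.contract_mem v hx)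
    · rw [map_zero]; exact zero_mem _
    · intro b b' _ _ h h'
      rw [map_add]; exact add_mem h h'
    · intro r b _ h
      rw [map_smul]; exact Submodule.smul_mem _ _ h

/-- The parity and the contraction with a fixed vector send products of coordinates to combinations
with coefficients independent of the point. Hence contraction with a constant vector acts on
coefficient functions by a constant matrix and preserves smoothness. -/
lemma exists_repr_contract (c : LocalCoordinates Y.fib Y.gr) (v : EuclideanSpace ℝ (Fin n))
    (γ δ : Exponent (Y.prodCoordinates n c).w) : ∃ t : ℝ, ∀ p hp,
      ((Y.prodCoordinates n c).basis p hp).repr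
        (Y.contract n p v ((Y.prodCoordinates n c).basis p hp γ)) δ = t := by
  refine ⟨(-1) ^ LocalCoordinates.weight c.w (exponentAppend c.w n γ).1.1 *
    (if (exponentAppend c.w n γ).1 = (exponentAppend c.w n δ).1 then 1 else 0) *
    (Covectors.basis n).repr (Covectors.contract v
      (Covectors.basis n (exponentAppend c.w n γ).2)) (exponentAppend c.w n δ).2, ?_⟩
  intro p hp
  have hp' : p.1 ∈ c.dom := hp
  have h1 : (Y.prodCoordinates n c).basis p hp γ =
      Y.form n p (c.basis p.1 hp' (exponentAppend c.w n γ).1)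
        (Covectors.basis n (exponentAppend c.w n γ).2) := by
    refine (Module.Basis.reindex_apply _ _ _).trans ?_
    rw [Module.Basis.map_apply]
    exact congrArg _ (Module.Basis.tensorProduct_apply _ _ _ _)
  rw [h1, contract_form, parityMap_of_mem _ (c.basis_mem hp' _)]
  refine (Y.prodCoordinates_repr_tmul n c hp _ _ _).trans ?_
  rw [map_smul, Finsupp.smul_apply, Module.Basis.repr_self, Finsupp.single_apply, smul_eq_mul]

lemma SmoothOn.contract_const {f : ∀ p, (Y.prodBall n).fib p} {U : Set (M × UnitBall n)} {k : ℤ}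
    (hf : (Y.prodBall n).SmoothOn f U) (hk : ∀ p ∈ U, f p ∈ (Y.prodBall n).grZ p k)
    (v : EuclideanSpace ℝ (Fin n)) :
    (Y.prodBall n).SmoothOn (fun p => Y.contract n p v (f p)) U := by
  cases k with
  | negSucc k =>
    refine ((Y.prodBall n).smoothOn_zero U).congr fun p hp => ?_
    rw [show f p = 0 from hk p hp, map_zero, Pi.zero_apply]
  | ofNat k =>
    rintro _ ⟨c, hc, rfl⟩ δ
    choose t ht using fun γ => Y.exists_repr_contract n c v γ δ
    have h : ContMDiffOn (I.prod (UnitBall.model n)) 𝓘(ℝ, ℝ) ∞ (fun p =>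
        ∑ γ ∈ (Y.prodCoordinates n c).exponents k, (Y.prodCoordinates n c).coeff f γ p * t γ)
        (U ∩ (Y.prodCoordinates n c).dom) :=
      contMDiffOn_finsetSum fun γ _ => (hf _ ⟨c, hc, rfl⟩ γ).mul contMDiffOn_const
    refine h.congr fun p hp => ?_
    have hfp := LocalCoordinates.sum_coeff (Y.prodCoordinates n c) hp.2 (f := f) (k := k)
      (hk p hp.1)
    refine (LocalCoordinates.coeff_of_mem (Y.prodCoordinates n c) hp.2 _ δ).trans ?_
    let T : Y.prodFib n p →ₗ[ℝ] ℝ := ((Y.prodCoordinates n c).basis p hp.2).coord δ ∘ₗ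
      (Y.contract n p v : Y.prodFib n p →ₗ[ℝ] Y.prodFib n p)
    refine (congrArg T hfp).trans ?_
    rw [map_sum]
    refine Finset.sum_congr rfl fun γ _ => ?_
    rw [map_smul, smul_eq_mul]
    exact congrArg _ (ht γ p hp.2)

lemma SmoothOn.contract {f : ∀ p, (Y.prodBall n).fib p} {U : Set (M × UnitBall n)} {k : ℤ}
    (hf : (Y.prodBall n).SmoothOn f U) (hk : ∀ p ∈ U, f p ∈ (Y.prodBall n).grZ p k)
    {V : M × UnitBall n → EuclideanSpace ℝ (Fin n)}
    (hV : ∀ i, ContMDiffOn (I.prod (UnitBall.model n)) 𝓘(ℝ, ℝ) ∞ (fun p => V p i) U) :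
    (Y.prodBall n).SmoothOn (fun p => Y.contract n p (V p) (f p)) U := by
  refine (SmoothOn.finset_sum Finset.univ fun i _ => SmoothOn.real_smul (hV i)
    (SmoothOn.contract_const Y n hf hk (EuclideanSpace.single i 1))).congr fun p _ => ?_
  conv_lhs => rw [← (EuclideanSpace.basisFun (Fin n) ℝ).toBasis.sum_repr (V p)]
  simp

end NManifold
end Functions
end

noncomputable section

/-! ### Smooth functions on the ball -/

namespace UnitBall

lemma contMDiff_coe (n : ℕ) :
    ContMDiff (model n) 𝓘(ℝ, EuclideanSpace ℝ (Fin n)) ∞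
      (Subtype.val : UnitBall n → EuclideanSpace ℝ (Fin n)) := by
  have h := contMDiffOn_extChartAt (I := model n) (n := ∞) (x := centre n)
  have h2 : (chartAt (UnitBall n) (centre n)).source = Set.univ := rfl
  rw [h2, contMDiffOn_univ] at h
  exact h

lemma contMDiffOn_retract (n : ℕ) :
    ContMDiffOn 𝓘(ℝ, EuclideanSpace ℝ (Fin n)) (model n) ∞ (retract n)
      (Metric.closedBall 0 1) := by
  have h := contMDiffOn_extChartAt_symm (I := model n) (n := ∞) (centre n)
  have h2 : (extChartAt (model n) (centre n)).target = Metric.closedBall 0 1 := by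
    rw [extChartAt_target]
    change (model n).symm ⁻¹' Set.univ ∩ Set.range (Subtype.val : UnitBall n → _) = _
    rw [Set.preimage_univ, Set.univ_inter, Subtype.range_coe]
  rw [h2] at h
  exact h

lemma retract_val {n : ℕ} {x : EuclideanSpace ℝ (Fin n)} (hx : x ∈ Metric.closedBall 0 1) :
    (retract n x : EuclideanSpace ℝ (Fin n)) = x :=
  congrArg Subtype.val (retract_coe ⟨x, hx⟩)

lemma uniqueDiffOn_closedBall (n : ℕ) :
    UniqueDiffOn ℝ (Metric.closedBall (0 : EuclideanSpace ℝ (Fin n)) 1) :=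
  uniqueDiffOn_convex (convex_closedBall _ _)
    ⟨0, Metric.ball_subset_interior_closedBall (by simp)⟩

end UnitBall

namespace Covectors

lemma basis_empty (n : ℕ) : basis n ∅ = 1 := by
  have := basis_eq (n := n) ⟨0, fun _ _ => zero_le_one⟩
  rw [show exponentEquiv n ⟨0, fun _ _ => zero_le_one⟩ = ∅ by simp [exponentEquiv]] at this
  rw [this]
  simp [orderedMonomial]

lemma coordBasis_apply {n : ℕ} (i : Fin n) (x : EuclideanSpace ℝ (Fin n)) :
    coordBasis n i x = x i := by
  simp [coordBasis]

end Covectors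

section Functions

variable {EM : Type*} [NormedAddCommGroup EM] [NormedSpace ℝ EM] {H : Type*} [TopologicalSpace H]
  {I : ModelWithCorners ℝ EM H} {M : Type*} [TopologicalSpace M] [ChartedSpace H M] {n : ℕ}

/-- The derivative of a function in the directions of the ball. -/
def ballDeriv (χ : M × UnitBall n → ℝ) (p : M × UnitBall n) :
    EuclideanSpace ℝ (Fin n) →L[ℝ] ℝ :=
  fderivWithin ℝ (fun x => χ (p.1, UnitBall.retract n x)) (Metric.closedBall 0 1) p.2

lemma ContMDiffOn.comp_retract {χ : M × UnitBall n → ℝ} {U : Set (M × UnitBall n)}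
    (hχ : ContMDiffOn (I.prod (UnitBall.model n)) 𝓘(ℝ, ℝ) ∞ χ U) (m : M) :
    ContDiffOn ℝ ∞ (fun x => χ (m, UnitBall.retract n x))
      (Metric.closedBall 0 1 ∩ {x | (m, UnitBall.retract n x) ∈ U}) := by
  rw [← contMDiffOn_iff_contDiffOn]
  refine hχ.comp (t := U) (f := fun x => (m, UnitBall.retract n x)) ?_ fun x hx => hx.2
  exact contMDiffOn_const.prodMk ((UnitBall.contMDiffOn_retract n).mono Set.inter_subset_left)

lemma differentiableWithinAt_comp_retract {χ : M × UnitBall n → ℝ} {U : Set (M × UnitBall n)}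
    (hχ : ContMDiffOn (I.prod (UnitBall.model n)) 𝓘(ℝ, ℝ) ∞ χ U) (hU : IsOpen U)
    {p : M × UnitBall n} (hp : p ∈ U) :
    DifferentiableWithinAt ℝ (fun x => χ (p.1, UnitBall.retract n x)) (Metric.closedBall 0 1)
      p.2 := by
  have h := (ContMDiffOn.comp_retract hχ p.1).differentiableOn (by simp) (p.2 : _)
    ⟨p.2.2, by rw [Set.mem_ofPred_eq, UnitBall.retract_coe]; exact hp⟩
  refine (differentiableWithinAt_inter ?_).1 h
  refine (hU.preimage (by
    exact continuous_const.prodMk (UnitBall.continuous_retract n))).mem_nhds ?_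
  change (p.1, UnitBall.retract n p.2) ∈ U
  rw [UnitBall.retract_coe]
  exact hp

lemma ballDeriv_congr {χ χ' : M × UnitBall n → ℝ} {U : Set (M × UnitBall n)} (hU : IsOpen U)
    {p : M × UnitBall n} (hp : p ∈ U) (h : ∀ q ∈ U, χ q = χ' q) :
    ballDeriv χ p = ballDeriv χ' p := by
  have hmem : {x | (p.1, UnitBall.retract n x) ∈ U} ∈ nhds (p.2 : EuclideanSpace ℝ (Fin n)) := by
    refine (hU.preimage (by
      exact continuous_const.prodMk (UnitBall.continuous_retract n))).mem_nhds ?_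
    change (p.1, UnitBall.retract n p.2) ∈ U
    rw [UnitBall.retract_coe]
    exact hp
  refine Filter.EventuallyEq.fderivWithin_eq ?_ (h _ (by rw [UnitBall.retract_coe]; exact hp))
  filter_upwards [mem_nhdsWithin_of_mem_nhds hmem] with x hx using h _ hx

/-- The coordinates of `g b • w` in any basis are constant multiples of the single function `g`, so
the algebraic basis chosen in `UnitBall.partialDeriv` drops out. -/
lemma UnitBall.partialDeriv_real_smul {W : Type*} [AddCommGroup W] [Module ℝ W]
    {g : UnitBall n → ℝ} {b : UnitBall n}
    (hg : DifferentiableWithinAt ℝ (fun x => g (UnitBall.retract n x)) (Metric.closedBall 0 1) b)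
    (w : W) (i : Fin n) : UnitBall.partialDeriv (fun b => g b • w) i b =
      fderivWithin ℝ (fun x => g (UnitBall.retract n x)) (Metric.closedBall 0 1) b
        (EuclideanSpace.single i 1) • w := by
  rw [UnitBall.partialDeriv]
  have h1 : ∀ β, fderivWithin ℝ (fun x => (Module.Basis.ofVectorSpace ℝ W).repr
      (g (UnitBall.retract n x) • w) β) (Metric.closedBall 0 1) b (EuclideanSpace.single i 1) =
      fderivWithin ℝ (fun x => g (UnitBall.retract n x)) (Metric.closedBall 0 1) b
        (EuclideanSpace.single i 1) * (Module.Basis.ofVectorSpace ℝ W).repr w β := by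
    intro β
    simp only [map_smul, Finsupp.smul_apply, smul_eq_mul]
    rw [fderivWithin_mul_const (UnitBall.uniqueDiffOn_closedBall n _ b.2) hg]
    simp [mul_comm]
  simp_rw [h1, mul_smul]
  rw [← smul_finsum]
  congr 1
  conv_rhs => rw [← (Module.Basis.ofVectorSpace ℝ W).linearCombination_repr w,
    Finsupp.linearCombination_apply, Finsupp.sum]
  exact finsum_eq_sum_of_support_subset _ fun β hβ => by
    simp only [Finset.mem_coe, Finsupp.mem_support_iff]
    intro h
    exact hβ (by simp [h])

namespace NQManifold

lemma Q_zero (Y : NQManifold.{u} I M) : Y.Q 0 = 0 := by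
  have := Y.Q_smul 0 0 (zero_mem _) 0
  rwa [zero_smul, zero_smul] at this

variable (Y : NQManifold.{u} I M) (n)

/-- The differential of a function on the body of `Y × T[1]Bⁿ`. -/
def bodyDiff (χ : M × UnitBall n → ℝ) : ∀ p, (Y.prodBall n).fib p :=
  Y.prodBallQ n fun p => χ p • 1

/-- A function on the body has form degree zero, so only the coefficient of the empty product
contributes to the part along `Y`, and the partial derivatives along the ball are scalars. This
explicit formula suffices for what follows, where the Leibniz rule for `D` is applied to functions
on the body only. -/
lemma bodyDiff_eq {χ : M × UnitBall n → ℝ}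
    (hχ : ContMDiff (I.prod (UnitBall.model n)) 𝓘(ℝ, ℝ) ∞ χ) (p : M × UnitBall n) :
    Y.bodyDiff n χ p = Y.oneForm n p (Y.Q (fun m => χ (m, p.2) • 1) p.1) (ballDeriv χ p) := by
  have hθ : ∀ (s : Finset (Fin n)) (q : M × UnitBall n),
      Y.θCoeff n s q (χ q • 1) = if s = ∅ then χ q • 1 else 0 := by
    intro s q
    rw [map_smul]
    have : Y.θCoeff n s q 1 = (Covectors.basis n).repr 1 s • 1 := rfl
    rw [this, ← Covectors.basis_empty, Module.Basis.repr_self]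
    split_ifs with h
    · rw [h, Finsupp.single_eq_same, one_smul]
    · rw [Finsupp.single_eq_of_ne h, zero_smul, smul_zero]
  have h1 : ∑ s, Y.form n p (Y.Q (fun m => Y.θCoeff n s (m, p.2) (χ (m, p.2) • 1)) p.1)
      (Covectors.basis n s) = Y.form n p (Y.Q (fun m => χ (m, p.2) • 1) p.1) 1 := by
    simp_rw [hθ]
    rw [Finset.sum_eq_single ∅]
    · simp [Covectors.basis_empty]
    · intro s _ hs
      simp only [hs, if_false]
      rw [show (fun _ => 0 : ∀ m, Y.fib m) = 0 from rfl, Y.Q_zero]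
      exact TensorProduct.zero_tmul _ _
    · simp
  have h2 : ∀ i, Y.partialDeriv n (fun p => χ p • 1) i p =
      ballDeriv χ p (EuclideanSpace.single i 1) • (1 : (Y.prodBall n).fib p) := by
    intro i
    exact UnitBall.partialDeriv_real_smul (W := Y.prodFib n p) (g := fun b => χ (p.1, b))
      (differentiableWithinAt_comp_retract hχ.contMDiffOn isOpen_univ (Set.mem_univ p)) 1 i
  have h3 : ∑ i, Y.form n p 1 (Covectors.θ i) * Y.partialDeriv n (fun p => χ p • 1) i p =
      Y.form n p 1 (ExteriorAlgebra.ι ℝ (ballDeriv χ p : Module.Dual ℝ _)) := by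
    have h4 : (ballDeriv χ p : Module.Dual ℝ (EuclideanSpace ℝ (Fin n))) =
        ∑ i, ballDeriv χ p (EuclideanSpace.single i 1) • Covectors.coordBasis n i := by
      refine (EuclideanSpace.basisFun (Fin n) ℝ).toBasis.ext fun j => ?_
      simp [LinearMap.sum_apply, Covectors.coordBasis_apply]
    rw [h4, map_sum]
    have h5 : ∀ x : Fin n → Covectors n, Y.form n p 1 (∑ i, x i) = ∑ i, Y.form n p 1 (x i) :=
      fun x => TensorProduct.tmul_sum _ _ _
    rw [h5]
    refine Finset.sum_congr rfl fun i _ => ?_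
    rw [h2, mul_smul_comm, mul_one, map_smul, NManifold.form_smul_right]
    rfl
  exact congrArg₂ (· + ·) h1 h3

end NQManifold

end Functions

end

noncomputable section

/-! ### Contraction of sections of a bundle -/

section Bundles

variable {EM : Type*} [NormedAddCommGroup EM] [NormedSpace ℝ EM] {H : Type*} [TopologicalSpace H]
  {I : ModelWithCorners ℝ EM H} {M : Type*} [TopologicalSpace M] [ChartedSpace H M] {n : ℕ}

namespace NManifold

variable (Y : NManifold.{u} I M)

lemma oneForm_mem {p : M × UnitBall n} {y : Y.fib p.1} (hy : y ∈ Y.gr p.1 1)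
    (ξ : Module.Dual ℝ (EuclideanSpace ℝ (Fin n))) :
    Y.oneForm n p y ξ ∈ (Y.prodBall n).gr p 1 := by
  refine add_mem (tensorGr.tmul_mem _ _ (add_zero 1) hy SetLike.GradedOne.one_mem)
    (tensorGr.tmul_mem _ _ (zero_add 1) SetLike.GradedOne.one_mem ?_)
  simp [Covectors.gr, ExteriorAlgebra.exteriorPower]

lemma mul_swap_of_mem_one {P : NManifold.{u} I M} {m : M} {a b : P.fib m} (ha : a ∈ P.gr m 1)
    (hb : b ∈ P.gr m 1) : a * b = -(b * a) := by
  rw [P.gcomm m 1 1 a ha b hb]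
  simp

end NManifold

namespace NBundle

section General

variable {P : NManifold.{u} I M} {E : NBundle.{u, v} P}

lemma SmoothOn.real_smul {χ : M → ℝ} {s : ∀ m, E.fib m} {U : Set M}
    (hχ : ContMDiffOn I 𝓘(ℝ, ℝ) ∞ χ U) (hs : E.SmoothOn s U) :
    E.SmoothOn (fun m => χ m • s m) U := fun φ hφ j => by
  refine (NManifold.SmoothOn.real_smul (hχ.mono Set.inter_subset_left) (hs φ hφ j)).congr
    fun m hm => ?_
  rw [φ.coeff_of_mem hm.2, φ.coeff_of_mem hm.2, ← algebraMap_smul (P.fib m) (χ m) (s m), map_smul,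
    Finsupp.smul_apply, algebraMap_smul]

lemma SmoothOn.finset_sum {ι : Type*} (t : Finset ι) {s : ι → ∀ m, E.fib m} {U : Set M}
    (hs : ∀ i ∈ t, E.SmoothOn (s i) U) : E.SmoothOn (fun m => ∑ i ∈ t, s i m) U := by
  classical
  induction t using Finset.induction_on with
  | empty => exact (E.smoothOn_zero U).congr fun _ _ => by simp
  | insert i t hi ih =>
    simp_rw [Finset.sum_insert hi]
    exact (hs i (Finset.mem_insert_self _ _)).add
      (ih fun j hj => hs j (Finset.mem_insert_of_mem hj))

lemma real_smul_mem {χ : M → ℝ} (hχ : ContMDiff I 𝓘(ℝ, ℝ) ∞ χ) {d : ℤ} {s : ∀ m, E.fib m}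
    (hs : s ∈ E.sections d) : (fun m => χ m • s m) ∈ E.sections d :=
  ⟨fun m => Submodule.smul_mem _ _ (hs.1 m), SmoothOn.real_smul hχ.contMDiffOn hs.2⟩

/-- Smoothness is a local property. -/
lemma mem_sections_of_local {d : ℤ} {s : ∀ m, E.fib m}
    (h : ∀ m, ∃ U, IsOpen U ∧ m ∈ U ∧ ∃ t ∈ E.sections d, ∀ x ∈ U, s x = t x) :
    s ∈ E.sections d := by
  refine ⟨fun m => ?_, fun φ hφ j c hc α m hm => ?_⟩
  · obtain ⟨U, -, hm, t, ht, h⟩ := h m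
    rw [h m hm]
    exact ht.1 m
  · obtain ⟨U, hU, hmU, t, ht, h⟩ := h m
    have h1 := (ht.2 φ hφ j c hc α) m hm
    have h2 : ∀ x ∈ U, c.coeff (φ.coeff s j) α x = c.coeff (φ.coeff t j) α x := by
      intro x hx
      by_cases h3 : x ∈ c.dom
      · rw [c.coeff_of_mem h3, c.coeff_of_mem h3]
        congr 2
        by_cases h4 : x ∈ φ.dom
        · rw [φ.coeff_of_mem h4, φ.coeff_of_mem h4, h x hx]
        · have e1 : φ.coeff s j x = 0 := dif_neg h4
          have e2 : φ.coeff t j x = 0 := dif_neg h4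
          rw [e1, e2]
      · have e1 : ∀ f, c.coeff f α x = 0 := fun f => dif_neg h3
        rw [e1, e1]
    refine h1.congr_of_eventuallyEq ?_ (h2 m hmU)
    filter_upwards [mem_nhdsWithin_of_mem_nhds (hU.mem_nhds hmU)] with x hx using h2 x hx

end General

variable {Y : NManifold.{u} I M} (E : NBundle.{u, v} (Y.prodBall n))

open Classical in
/-- Contraction of the coefficients in a frame. -/
def frameContract (φ : LocalFrame (Y.prodBall n) E.fib E.gr) (p : M × UnitBall n)
    (v : EuclideanSpace ℝ (Fin n)) : E.fib p →ₗ[ℝ] E.fib p :=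
  if h : p ∈ φ.dom then
    { toFun := fun x => ∑ j, Y.contract n p v ((φ.basis p h).repr x j) • φ.e j p
      map_add' := fun x y => by
        simp only [map_add, Finsupp.add_apply, add_smul, Finset.sum_add_distrib]
      map_smul' := fun r x => by
        rw [RingHom.id_apply, Finset.smul_sum]
        refine Finset.sum_congr rfl fun j _ => ?_
        rw [← algebraMap_smul ((Y.prodBall n).fib p) r x, map_smul, Finsupp.smul_apply,
          algebraMap_smul, map_smul, smul_assoc] }
  else 0

variable {E} in
lemma frameContract_of_mem {φ : LocalFrame (Y.prodBall n) E.fib E.gr} {p : M × UnitBall n}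
    (h : p ∈ φ.dom) (v : EuclideanSpace ℝ (Fin n)) (x : E.fib p) : E.frameContract φ p v x =
      ∑ j, Y.contract n p v ((φ.basis p h).repr x j) • φ.e j p := by
  rw [frameContract, dif_pos h]
  rfl

/-- The coefficients stand to the left of the frame and the contraction also acts from the left, so
the rule for functions carries over without further signs. -/
lemma frameContract_oneForm_smul {φ : LocalFrame (Y.prodBall n) E.fib E.gr} {p : M × UnitBall n}
    (h : p ∈ φ.dom) (v : EuclideanSpace ℝ (Fin n)) {y : Y.fib p.1} (hy : y ∈ Y.gr p.1 1)
    (ξ : Module.Dual ℝ (EuclideanSpace ℝ (Fin n))) (x : E.fib p) :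
    E.frameContract φ p v (Y.oneForm n p y ξ • x) =
      ξ v • x - Y.oneForm n p y ξ • E.frameContract φ p v x := by
  rw [frameContract_of_mem h, frameContract_of_mem h, Finset.smul_sum]
  simp only [map_smul, Finsupp.smul_apply, smul_eq_mul, Y.contract_oneForm_mul n hy, sub_smul,
    Finset.sum_sub_distrib, mul_smul, smul_assoc, ← Finset.smul_sum, ← φ.basis_apply p h,
    (φ.basis p h).sum_repr]

variable [FiniteDimensional ℝ EM] [IsManifold I ∞ M] [T2Space M] [SigmaCompactSpace M]

lemma exists_partition : ∃ ρ : SmoothPartitionOfUnity E.atlas (I.prod (UnitBall.model n))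
    (M × UnitBall n) Set.univ, ρ.IsSubordinate fun φ => (φ.1.dom : Set (M × UnitBall n)) :=
  SmoothPartitionOfUnity.exists_isSubordinate _ isClosed_univ _ (fun φ => φ.1.dom.isOpen)
    fun p _ => by
      obtain ⟨φ, hφ, h⟩ := E.cover p
      exact Set.mem_iUnion.2 ⟨⟨φ, hφ⟩, h⟩

/-- A partition of unity which is subordinate to the domains of the frames. -/
def partition : SmoothPartitionOfUnity E.atlas (I.prod (UnitBall.model n)) (M × UnitBall n)
    Set.univ := E.exists_partition.choose

lemma partition_apply_eq_zero {φ : E.atlas} {p : M × UnitBall n} (h : p ∉ φ.1.dom) :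
    E.partition φ p = 0 :=
  image_eq_zero_of_notMem_tsupport fun h' => h (E.exists_partition.choose_spec φ h')

/-- A lift to the sections of `E` of the contraction of forms with a tangent vector of the
ball. -/
def contract (p : M × UnitBall n) (v : EuclideanSpace ℝ (Fin n)) : E.fib p →ₗ[ℝ] E.fib p :=
  ∑ φ ∈ E.partition.finsupport p, E.partition φ p • E.frameContract φ.1 p v

lemma contract_apply (p : M × UnitBall n) (v : EuclideanSpace ℝ (Fin n)) (x : E.fib p) :
    E.contract p v x =
      ∑ φ ∈ E.partition.finsupport p, E.partition φ p • E.frameContract φ.1 p v x := by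
  rw [contract, LinearMap.sum_apply]
  rfl

/-- The contractions defined by different frames need not agree, but each satisfies this rule, and
the rule is preserved by averages with weights of sum one. It is the only property of the lift that
is needed besides linearity, degree and smoothness. -/
lemma contract_oneForm_smul (p : M × UnitBall n) (v : EuclideanSpace ℝ (Fin n)) {y : Y.fib p.1}
    (hy : y ∈ Y.gr p.1 1) (ξ : Module.Dual ℝ (EuclideanSpace ℝ (Fin n))) (x : E.fib p) :
    E.contract p v (Y.oneForm n p y ξ • x) =
      ξ v • x - Y.oneForm n p y ξ • E.contract p v x := by
  rw [contract_apply, contract_apply, Finset.smul_sum]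
  have h1 : ∀ φ : E.atlas, E.partition φ p • E.frameContract φ.1 p v (Y.oneForm n p y ξ • x) =
      E.partition φ p • (ξ v • x) -
        Y.oneForm n p y ξ • E.partition φ p • E.frameContract φ.1 p v x := by
    intro φ
    by_cases h : p ∈ φ.1.dom
    · rw [E.frameContract_oneForm_smul h v hy, smul_sub]
      exact congrArg _ (smul_algebra_smul_comm (E.partition φ p) (Y.oneForm n p y ξ) _).symm
    · simp [E.partition_apply_eq_zero h]
  simp_rw [h1]
  rw [Finset.sum_sub_distrib, ← Finset.sum_smul,
    E.partition.sum_finsupport p (Set.mem_univ p), one_smul]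

lemma contract_mem_sections {V : M × UnitBall n → EuclideanSpace ℝ (Fin n)}
    (hV : ∀ i, ContMDiff (I.prod (UnitBall.model n)) 𝓘(ℝ, ℝ) ∞ fun p => V p i) {d : ℤ}
    {s : ∀ p, E.fib p} (hs : s ∈ E.sections d) :
    (fun p => E.contract p (V p) (s p)) ∈ E.sections (d - 1) := by
  have hc : ∀ (φ : E.atlas) (j : Fin φ.1.r), ∀ p ∈ φ.1.dom,
      Y.contract n p (V p) (φ.1.coeff s j p) ∈ (Y.prodBall n).grZ p (d - φ.1.v j - 1) :=
    fun φ j p hp => Y.contract_mem n _ (φ.1.coeff_memZ hp (hs.1 p) j)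
  have hL : ∀ φ : E.atlas, ∀ p ∈ φ.1.dom, E.frameContract φ.1 p (V p) (s p) =
      ∑ j, Y.contract n p (V p) (φ.1.coeff s j p) • φ.1.e j p := by
    intro φ p hp
    rw [frameContract_of_mem hp]
    exact Finset.sum_congr rfl fun j _ => by rw [φ.1.coeff_of_mem hp]
  have key := glue_mem E E.partition (fun φ => (φ.1.dom : Set (M × UnitBall n)))
    (fun φ => φ.1.dom.isOpen) E.exists_partition.choose_spec
    (fun φ p => E.frameContract φ.1 p (V p) (s p)) (d := d - 1) ?_ ?_
  · convert key using 2 with p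
    rw [contract_apply]
    refine (finsum_eq_sum_of_support_subset _ fun φ hφ => ?_).symm
    rw [SmoothPartitionOfUnity.coe_finsupport]
    intro h
    exact hφ (by simp only [show E.partition φ p = 0 from h, zero_smul])
  · intro φ
    refine SmoothOn.congr ?_ (hL φ)
    refine SmoothOn.finset_sum _ fun j _ => SmoothOn.fun_smul (k := d - φ.1.v j - 1)
      (d := φ.1.v j) ?_ ?_ (hc φ j) fun p hp => E.e_mem hp j
    · refine NManifold.SmoothOn.contract Y n (k := d - φ.1.v j) ?_
        (fun p hp => φ.1.coeff_memZ hp (hs.1 p) j) fun i => (hV i).contMDiffOn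
      exact (hs.2 φ.1 φ.2 j).mono fun p hp => ⟨trivial, hp⟩
    · intro φ' hφ' i
      exact (E.compat φ.1 φ.2 φ' hφ' j i)
  · intro φ p hp
    rw [hL φ p hp]
    refine Submodule.sum_mem _ fun j _ => ?_
    have := E.smul_mem (hc φ j p hp) (E.e_mem hp j)
    rwa [show d - φ.1.v j - 1 + φ.1.v j = d - 1 by ring] at this

end NBundle

end Bundles

end

noncomputable section

/-! ### Cartan calculus for sections -/

section Calculus

variable {EM : Type*} [NormedAddCommGroup EM] [NormedSpace ℝ EM] {H : Type*} [TopologicalSpace H]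
  {I : ModelWithCorners ℝ EM H} {M : Type*} [TopologicalSpace M] [ChartedSpace H M] {n : ℕ}

namespace NQManifold

variable (Y : NQManifold.{u} I M)

lemma Q_one : Y.Q 1 = 0 := by
  have h1 : (1 : ∀ m, Y.fib m) ∈ Y.functions 0 :=
    ⟨fun m => SetLike.GradedOne.one_mem, Y.smoothOn_one _⟩
  have h := Y.Q_mul 0 0 1 h1 1 h1
  rw [mul_one, mul_one, one_mul, pow_zero, one_smul] at h
  exact left_eq_add.1 h

lemma Q_const_smul_one (r : ℝ) : Y.Q (fun _ => r • 1) = 0 := by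
  have h1 : (1 : ∀ m, Y.fib m) ∈ Y.functions 0 :=
    ⟨fun m => SetLike.GradedOne.one_mem, Y.smoothOn_one _⟩
  refine (Y.Q_smul 0 1 h1 r).trans ?_
  rw [Y.Q_one, smul_zero]

variable {χ : M × UnitBall n → ℝ}

lemma Q_smul_one_mem (hχ : ContMDiff (I.prod (UnitBall.model n)) 𝓘(ℝ, ℝ) ∞ χ)
    (p : M × UnitBall n) : Y.Q (fun m => χ (m, p.2) • 1) p.1 ∈ Y.gr p.1 1 :=
  (Y.Q_mem 0 _ (Y.smul_one_mem
    (hχ.comp (contMDiff_id.prodMk (contMDiff_const (c := p.2)))))).1 p.1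

lemma bodyDiff_mem (hχ : ContMDiff (I.prod (UnitBall.model n)) 𝓘(ℝ, ℝ) ∞ χ)
    (p : M × UnitBall n) : Y.bodyDiff n χ p ∈ (Y.prodBall n).gr p 1 := by
  rw [Y.bodyDiff_eq n hχ]
  exact Y.oneForm_mem (Y.Q_smul_one_mem hχ p) _

lemma bodyDiff_mul_swap {χ' : M × UnitBall n → ℝ}
    (hχ : ContMDiff (I.prod (UnitBall.model n)) 𝓘(ℝ, ℝ) ∞ χ)
    (hχ' : ContMDiff (I.prod (UnitBall.model n)) 𝓘(ℝ, ℝ) ∞ χ') (p : M × UnitBall n) :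
    Y.bodyDiff n χ p * Y.bodyDiff n χ' p = -(Y.bodyDiff n χ' p * Y.bodyDiff n χ p) :=
  NManifold.mul_swap_of_mem_one (Y.bodyDiff_mem hχ p) (Y.bodyDiff_mem hχ' p)

end NQManifold

namespace NQBundle

section General

variable {P : NManifold.{u} I M} {Q : (∀ m, P.fib m) → ∀ m, P.fib m} (E : NQBundle.{u, v} P Q)

lemma D_neg {d : ℤ} {s : ∀ m, E.fib m} (hs : s ∈ E.sections d) : E.D (-s) = -E.D s := by
  rw [← neg_one_smul ℝ s, E.D_smul d s hs, neg_one_smul]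

lemma D_sub {d : ℤ} {s t : ∀ m, E.fib m} (hs : s ∈ E.sections d) (ht : t ∈ E.sections d) :
    E.D (s - t) = E.D s - E.D t := by
  rw [sub_eq_add_neg, E.D_add d s hs _ (neg_mem ht), E.D_neg ht, sub_eq_add_neg]

end General

variable {Y : NQManifold.{u} I M} (E : NQBundle.{u, v} (Y.prodBall n) (Y.prodBallQ n))
  {χ : M × UnitBall n → ℝ} {d : ℤ} {s t : ∀ p, E.fib p}

lemma fun_smul_mem (hχ : ContMDiff (I.prod (UnitBall.model n)) 𝓘(ℝ, ℝ) ∞ χ)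
    (hs : s ∈ E.sections d) : χ • s ∈ E.sections d := NBundle.real_smul_mem hχ hs

lemma D_fun_smul (hχ : ContMDiff (I.prod (UnitBall.model n)) 𝓘(ℝ, ℝ) ∞ χ)
    (hs : s ∈ E.sections d) : E.D (χ • s) = Y.bodyDiff n χ • s + χ • E.D s := by
  have h := E.D_leibniz 0 d _ ((Y.prodBall n).smul_one_mem hχ) s hs
  have e : (fun m => (χ m • (1 : (Y.prodBall n).fib m)) • s m) = χ • s := by
    ext p
    rw [smul_assoc, one_smul]
    rfl
  rw [e] at h
  rw [h]
  ext p
  rw [pow_zero, one_smul, smul_assoc, one_smul]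
  rfl

/-- By the Leibniz rule the product is `D(χs) - χ Ds`, a difference of sections already known to be
smooth. -/
lemma bodyDiff_smul_mem (hχ : ContMDiff (I.prod (UnitBall.model n)) 𝓘(ℝ, ℝ) ∞ χ)
    (hs : s ∈ E.sections d) : Y.bodyDiff n χ • s ∈ E.sections (d + 1) := by
  have h := sub_mem (E.D_mem d _ (E.fun_smul_mem hχ hs)) (E.fun_smul_mem hχ (E.D_mem d s hs))
  rwa [E.D_fun_smul hχ hs, add_sub_cancel_right] at h

/-- Read off from `D(D(χs)) = 0`; the equation `Q(dχ) = 0` is not needed separately. -/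
lemma D_bodyDiff_smul (hχ : ContMDiff (I.prod (UnitBall.model n)) 𝓘(ℝ, ℝ) ∞ χ)
    (hs : s ∈ E.sections d) : E.D (Y.bodyDiff n χ • s) = -(Y.bodyDiff n χ • E.D s) := by
  have h := E.D_D d _ (E.fun_smul_mem hχ hs)
  have h1 := E.D_mem d s hs
  rw [E.D_fun_smul hχ hs, E.D_add _ _ (E.bodyDiff_smul_mem hχ hs) _ (E.fun_smul_mem hχ h1),
    E.D_fun_smul hχ h1, E.D_D d s hs, smul_zero, add_zero] at h
  exact eq_neg_of_add_eq_zero_left h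

lemma bodyDiff_smul_swap {χ' : M × UnitBall n → ℝ}
    (hχ : ContMDiff (I.prod (UnitBall.model n)) 𝓘(ℝ, ℝ) ∞ χ)
    (hχ' : ContMDiff (I.prod (UnitBall.model n)) 𝓘(ℝ, ℝ) ∞ χ') (p : M × UnitBall n)
    (x : E.fib p) : Y.bodyDiff n χ p • Y.bodyDiff n χ' p • x =
      -(Y.bodyDiff n χ' p • Y.bodyDiff n χ p • x) := by
  rw [← mul_smul, Y.bodyDiff_mul_swap hχ hχ', neg_smul, mul_smul]

lemma bodyDiff_smul_self (hχ : ContMDiff (I.prod (UnitBall.model n)) 𝓘(ℝ, ℝ) ∞ χ)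
    (p : M × UnitBall n) (x : E.fib p) : Y.bodyDiff n χ p • Y.bodyDiff n χ p • x = 0 := by
  have h := E.bodyDiff_smul_swap hχ hχ p x
  rw [eq_neg_iff_add_eq_zero, ← two_smul ℝ] at h
  exact (smul_eq_zero_iff_right (two_ne_zero : (2 : ℝ) ≠ 0)).1 h

variable [FiniteDimensional ℝ EM] [IsManifold I ∞ M] [T2Space M] [SigmaCompactSpace M]

/-- The differential is a local operator. -/
lemma D_eq_zero_of_eqOn {O : Set (M × UnitBall n)} (hO : IsOpen O) (hs : s ∈ E.sections d)
    (h : ∀ p ∈ O, s p = 0) {p : M × UnitBall n} (hp : p ∈ O) : E.D s p = 0 := by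
  obtain ⟨χ, hχ, hsupp, h1⟩ := exists_bump (I.prod (UnitBall.model n)) hO hp
  have h0 : χ • s = 0 := by
    ext q
    change χ q • s q = 0
    by_cases hq : q ∈ O
    · rw [h q hq, smul_zero]
    · rw [image_eq_zero_of_notMem_tsupport fun h' => hq (hsupp h'), zero_smul]
  have h2 := congrFun (E.D_fun_smul hχ hs) p
  rw [h0, E.D_zero] at h2
  have h3 : (0 : E.fib p) = Y.bodyDiff n χ p • s p + χ p • E.D s p := h2
  rw [h p hp, smul_zero, zero_add, h1, one_smul] at h3
  exact h3.symm

lemma D_congr {O : Set (M × UnitBall n)} (hO : IsOpen O) (hs : s ∈ E.sections d)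
    (ht : t ∈ E.sections d) (h : ∀ p ∈ O, s p = t p) {p : M × UnitBall n} (hp : p ∈ O) :
    E.D s p = E.D t p := by
  have h1 := E.D_eq_zero_of_eqOn hO (sub_mem hs ht) (fun q hq => sub_eq_zero.2 (h q hq)) hp
  rw [E.D_sub hs ht] at h1
  exact sub_eq_zero.1 h1

variable (V : M × UnitBall n → EuclideanSpace ℝ (Fin n))

/-- Contraction of sections with a vector field on the ball. -/
def contractField : (∀ p, E.fib p) →ₗ[ℝ] ∀ p, E.fib p where
  toFun s p := E.contract p (V p) (s p)
  map_add' _ _ := funext fun _ => map_add _ _ _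
  map_smul' _ _ := funext fun _ => map_smul _ _ _

lemma contractField_apply (s : ∀ p, E.fib p) (p : M × UnitBall n) :
    E.contractField V s p = E.contract p (V p) (s p) := rfl

/-- The covariant derivative along a vector field on the ball. -/
def lieD (s : ∀ p, E.fib p) : ∀ p, E.fib p :=
  E.D (E.contractField V s) + E.contractField V (E.D s)

lemma contractField_fun_smul (χ : M × UnitBall n → ℝ) (s : ∀ p, E.fib p) :
    E.contractField V (χ • s) = χ • E.contractField V s :=
  funext fun p => map_smul (E.contract p (V p)) (χ p) (s p)

lemma contractField_bodyDiff_smul (hχ : ContMDiff (I.prod (UnitBall.model n)) 𝓘(ℝ, ℝ) ∞ χ)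
    (s : ∀ p, E.fib p) : E.contractField V (Y.bodyDiff n χ • s) =
      (fun p => ballDeriv χ p (V p)) • s - Y.bodyDiff n χ • E.contractField V s := by
  ext p
  change E.contract p (V p) (Y.bodyDiff n χ p • s p) =
    ballDeriv χ p (V p) • s p - Y.bodyDiff n χ p • E.contract p (V p) (s p)
  rw [Y.bodyDiff_eq n hχ]
  exact E.contract_oneForm_smul p (V p) (Y.Q_smul_one_mem hχ p) _ _

variable {V} (hV : ∀ i, ContMDiff (I.prod (UnitBall.model n)) 𝓘(ℝ, ℝ) ∞ fun p => V p i)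

include hV in
lemma contractField_mem (hs : s ∈ E.sections d) : E.contractField V s ∈ E.sections (d - 1) :=
  E.contract_mem_sections hV hs

include hV in
lemma contractField_D_mem (hs : s ∈ E.sections d) : E.contractField V (E.D s) ∈ E.sections d := by
  simpa using E.contractField_mem hV (E.D_mem d s hs)

include hV in
lemma D_contractField_mem (hs : s ∈ E.sections d) : E.D (E.contractField V s) ∈ E.sections d := by
  simpa using E.D_mem _ _ (E.contractField_mem hV hs)

include hV in
lemma lieD_mem (hs : s ∈ E.sections d) : E.lieD V s ∈ E.sections d :=
  add_mem (E.D_contractField_mem hV hs) (E.contractField_D_mem hV hs)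

include hV in
lemma lieD_add (hs : s ∈ E.sections d) (ht : t ∈ E.sections d) :
    E.lieD V (s + t) = E.lieD V s + E.lieD V t := by
  rw [lieD, map_add, E.D_add _ _ (E.contractField_mem hV hs) _ (E.contractField_mem hV ht),
    E.D_add _ _ hs _ ht, map_add, lieD, lieD]
  abel

lemma lieD_zero : E.lieD V 0 = 0 := by
  rw [lieD, map_zero, E.D_zero, map_zero, add_zero]

include hV in
lemma lieD_sum {ι : Type*} (T : Finset ι) {s : ι → ∀ p, E.fib p}
    (hs : ∀ i, s i ∈ E.sections d) : E.lieD V (∑ i ∈ T, s i) = ∑ i ∈ T, E.lieD V (s i) := by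
  classical
  induction T using Finset.induction_on with
  | empty => simpa using E.lieD_zero
  | insert i T hi ih =>
    rw [Finset.sum_insert hi, Finset.sum_insert hi,
      E.lieD_add hV (hs i) (Submodule.sum_mem _ fun j _ => hs j), ih]

include hV in
-- The terms `dχ · ιs` coming from `Dι` and from `ιD` have opposite signs and cancel, which leaves
-- `V(χ) s`. So `L` is a covariant derivative, although `D` also differentiates along `Y`.
lemma lieD_fun_smul (hχ : ContMDiff (I.prod (UnitBall.model n)) 𝓘(ℝ, ℝ) ∞ χ)
    (hs : s ∈ E.sections d) :
    E.lieD V (χ • s) = (fun p => ballDeriv χ p (V p)) • s + χ • E.lieD V s := by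
  rw [lieD, contractField_fun_smul, E.D_fun_smul hχ (E.contractField_mem hV hs),
    E.D_fun_smul hχ hs, map_add, E.contractField_bodyDiff_smul V hχ, contractField_fun_smul, lieD,
    smul_add]
  abel

include hV in
-- Since `D` has square zero, both sides equal `DιDs`.
lemma lieD_D (hs : s ∈ E.sections d) : E.lieD V (E.D s) = E.D (E.lieD V s) := by
  rw [lieD, lieD, E.D_add _ _ (E.D_contractField_mem hV hs) _ (E.contractField_D_mem hV hs),
    E.D_D _ _ hs, map_zero, E.D_D _ _ (E.contractField_mem hV hs), add_zero, zero_add]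

include hV in
lemma lieD_congr {O : Set (M × UnitBall n)} (hO : IsOpen O) (hs : s ∈ E.sections d)
    (ht : t ∈ E.sections d) (h : ∀ p ∈ O, s p = t p) {p : M × UnitBall n} (hp : p ∈ O) :
    E.lieD V s p = E.lieD V t p := by
  change E.D (E.contractField V s) p + E.contract p (V p) (E.D s p) =
    E.D (E.contractField V t) p + E.contract p (V p) (E.D t p)
  rw [E.D_congr hO hs ht h hp, E.D_congr hO (E.contractField_mem hV hs)
    (E.contractField_mem hV ht) (fun q hq => by rw [contractField_apply, h q hq]; rfl) hp]

include hV in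
/-- The derivative along `V` commutes with the product with `dχ` if `χ` is constant along `V`. -/
lemma lieD_bodyDiff_smul (hχ : ContMDiff (I.prod (UnitBall.model n)) 𝓘(ℝ, ℝ) ∞ χ)
    (h : ∀ p, ballDeriv χ p (V p) = 0) (hs : s ∈ E.sections d) :
    E.lieD V (Y.bodyDiff n χ • s) = Y.bodyDiff n χ • E.lieD V s := by
  have h1 : ∀ s : ∀ p, E.fib p, E.contractField V (Y.bodyDiff n χ • s) =
      -(Y.bodyDiff n χ • E.contractField V s) := fun s => by
    rw [E.contractField_bodyDiff_smul V hχ]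
    ext p
    change ballDeriv χ p (V p) • s p - _ = - _
    rw [h, zero_smul, zero_sub]
  rw [lieD, h1, E.D_neg (E.bodyDiff_smul_mem hχ (E.contractField_mem hV hs)),
    E.D_bodyDiff_smul hχ (E.contractField_mem hV hs), E.D_bodyDiff_smul hχ hs, map_neg, h1,
    neg_neg, neg_neg, lieD, smul_add]

end NQBundle

end Calculus

end

noncomputable section

/-! ### Local generation of the sections of a given degree -/

section Generators

variable {EM : Type*} [NormedAddCommGroup EM] [NormedSpace ℝ EM] {H : Type*} [TopologicalSpace H]
  {I : ModelWithCorners ℝ EM H} {M : Type*} [TopologicalSpace M] [ChartedSpace H M]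

namespace NManifold

variable {P : NManifold.{u} I M}

lemma SmoothOn.pow {f : ∀ m, P.fib m} {U : Set M} (hf : P.SmoothOn f U) {k : ℕ}
    (hk : ∀ m ∈ U, f m ∈ P.gr m k) (j : ℕ) : P.SmoothOn (fun m => f m ^ j) U := by
  induction j with
  | zero => exact (P.smoothOn_one U).congr fun m _ => pow_zero _
  | succ j ih =>
    refine (SmoothOn.mul ih hf (k := j * k) (l := k) (fun m hm => ?_) hk).congr
      fun m _ => pow_succ _ _
    simpa using SetLike.pow_mem_graded j (hk m hm)

lemma smoothOn_orderedMonomial {r : ℕ} (w : Fin r → ℕ) (ξ : Fin r → ∀ m, P.fib m) {U : Set M}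
    (hξ : ∀ i, P.SmoothOn (ξ i) U) (hw : ∀ i, ∀ m ∈ U, ξ i m ∈ P.gr m (w i)) (α : Fin r → ℕ) :
    P.SmoothOn (fun m => orderedMonomial (fun i => ξ i m) α) U := by
  induction r with
  | zero => exact (P.smoothOn_one U).congr fun m _ => by simp [orderedMonomial]
  | succ r ih =>
    refine (SmoothOn.mul ((hξ 0).pow (hw 0) (α 0))
      (ih (fun i => w i.succ) (fun i => ξ i.succ) (fun i => hξ i.succ) (fun i => hw i.succ)
        (fun i => α i.succ)) (k := α 0 * w 0) (l := ∑ i : Fin r, α i.succ * w i.succ)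
        (fun m hm => ?_) (fun m hm => ?_)).congr fun m _ => orderedMonomial_succ _ _
    · simpa using SetLike.pow_mem_graded (α 0) (hw 0 m hm)
    · exact orderedMonomial_mem (P.gr m) _ _ (fun i => hw i.succ m hm) _

end NManifold

namespace NBundle

variable {P : NManifold.{u} I M} (E : NBundle.{u, v} P)
variable [FiniteDimensional ℝ EM] [IsManifold I ∞ M] [T2Space M] [SigmaCompactSpace M]

open Classical in
/-- Near every point the sections of a given degree are generated by finitely many global sections,
with smooth coefficients. -/
lemma exists_generators (m₀ : M) (d : ℤ) : ∃ (ι : Type) (_ : Fintype ι)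
    (e : ι → ∀ m, E.fib m) (c : ι → ∀ m, E.fib m →ₗ[ℝ] ℝ) (χ : M → ℝ),
    (∀ a, e a ∈ E.sections d) ∧
    (∀ a, ∀ s ∈ E.sections d, ContMDiff I 𝓘(ℝ, ℝ) ∞ fun m => c a m (s m)) ∧
    ContMDiff I 𝓘(ℝ, ℝ) ∞ χ ∧ (∀ m, 0 ≤ χ m) ∧ χ m₀ = 1 ∧
    ∀ m, ∀ x ∈ E.gr m d, ∑ a, c a m x • e a m = χ m • x := by
  obtain ⟨φ, hφ, hm⟩ := E.cover m₀
  obtain ⟨c, hc, hm'⟩ := P.cover m₀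
  obtain ⟨χ, hχ, hsupp, h1⟩ := exists_bump I (φ.dom.isOpen.inter c.dom.isOpen) ⟨hm, hm'⟩
  have hout : ∀ m, ¬ (m ∈ φ.dom ∧ m ∈ c.dom) → χ m = 0 := fun m h =>
    image_eq_zero_of_notMem_tsupport fun h' => h (hsupp h')
  -- A frame element of degree `v` is multiplied by the finitely many monomials of degree `d - v`.
  -- The negative case is separated because `toNat` would turn it into degree zero.
  let S : Fin φ.r → Finset (Exponent c.w) := fun j =>
    if 0 ≤ d - φ.v j then c.exponents (d - φ.v j).toNat else ∅
  let e : (Σ j, S j) → ∀ m, E.fib m := fun a m =>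
    χ m • orderedMonomial (fun i => c.ξ i m) a.2.1.1 • φ.e a.1 m
  let C : (Σ j, S j) → ∀ m, E.fib m →ₗ[ℝ] ℝ := fun a m =>
    if h : m ∈ φ.dom ∧ m ∈ c.dom then
      χ m • ((c.basis m h.2).coord a.2.1 ∘ₗ ((φ.basis m h.1).coord a.1).restrictScalars ℝ)
    else 0
  have hC : ∀ (s : ∀ m, E.fib m) a m, C a m (s m) = χ m * c.coeff (φ.coeff s a.1) a.2.1 m := by
    intro s a m
    by_cases h : m ∈ φ.dom ∧ m ∈ c.dom
    · simp only [C, dif_pos h]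
      rw [c.coeff_of_mem h.2, φ.coeff_of_mem h.1]
      rfl
    · simp only [C, dif_neg h, hout m h]
      simp
  have hdeg : ∀ a : (Σ j, S j), (LocalCoordinates.weight c.w a.2.1.1 : ℤ) + φ.v a.1 = d := by
    rintro ⟨j, α, hα⟩
    simp only [S] at hα
    split_ifs at hα with h
    · have h2 : LocalCoordinates.weight c.w α.1 = (d - φ.v j).toNat := by
        simpa [LocalCoordinates.exponents] using hα
      dsimp only
      rw [h2, Int.toNat_of_nonneg h]
      ring
    · exact absurd hα (Finset.notMem_empty _)
  -- One factor `χ` makes the generators global and the other one the coefficients, so expansions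
  -- reproduce `χ²` times the vector.
  refine ⟨_, inferInstance, e, C, fun m => χ m * χ m, fun a => ⟨fun m => ?_, ?_⟩,
    fun a s hs => ?_, hχ.mul hχ, fun m => mul_self_nonneg _, by simp [h1], ?_⟩
  · by_cases h : m ∈ φ.dom ∧ m ∈ c.dom
    · refine Submodule.smul_mem _ _ ?_
      have h2 : orderedMonomial (fun i => c.ξ i m) a.2.1.1 ∈
          P.grZ m (LocalCoordinates.weight c.w a.2.1.1 : ℕ) := by
        rw [← c.basis_apply m h.2]
        exact c.basis_mem h.2 _
      have h3 := E.smul_mem h2 (E.e_mem h.1 a.1)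
      rwa [hdeg a] at h3
    · simp only [e, hout m h, zero_smul]
      exact zero_mem _
  · refine SmoothOn.bump (φ.dom.isOpen.inter c.dom.isOpen) isOpen_univ ?_ hχ hsupp
    refine SmoothOn.fun_smul (k := (LocalCoordinates.weight c.w a.2.1.1 : ℕ)) (d := φ.v a.1)
      ?_ ?_ ?_ ?_
    · refine NManifold.smoothOn_orderedMonomial c.w c.ξ (fun i => ?_) (fun i m hm =>
        c.ξ_mem i m hm.1.2) _
      intro c' hc' β
      exact (P.compat c hc c' hc' i β).mono fun m hm => ⟨hm.1.1.2, hm.2⟩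
    · intro φ' hφ' i
      exact (E.compat φ hφ φ' hφ' a.1 i).mono fun m hm => ⟨hm.1.1.1, hm.2⟩
    · intro m hm
      rw [← c.basis_apply m hm.1.2]
      exact c.basis_mem hm.1.2 _
    · exact fun m hm => E.e_mem hm.1.1 _
  · simp only [hC]
    rw [← contMDiffOn_univ]
    refine contMDiffOn_bump (φ.dom.isOpen.inter c.dom.isOpen) isOpen_univ ?_ hχ hsupp
    exact (hs.2 φ hφ a.1 c hc a.2.1).mono fun m hm => ⟨⟨trivial, hm.1.1⟩, hm.1.2⟩
  · intro m x hx
    by_cases h : m ∈ φ.dom ∧ m ∈ c.dom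
    · have hj : ∀ j, (φ.basis m h.1).repr x j • φ.e j m = ∑ α : S j,
          (c.basis m h.2).repr ((φ.basis m h.1).repr x j) α.1 •
            orderedMonomial (fun i => c.ξ i m) α.1.1 • φ.e j m := by
        intro j
        have h2 := (φ.mem_gr_iff m h.1 d x).1 hx j
        by_cases h3 : 0 ≤ d - φ.v j
        · rw [← Int.toNat_of_nonneg h3] at h2
          have h4 := c.sum_coeff h.2 (f := Function.update 0 m ((φ.basis m h.1).repr x j))
            (k := (d - φ.v j).toNat) (by rw [Function.update_self]; exact h2)
          simp only [c.coeff_of_mem h.2, Function.update_self] at h4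
          conv_lhs => rw [h4]
          rw [Finset.sum_smul, ← Finset.sum_coe_sort]
          have hS : S j = c.exponents (d - φ.v j).toNat := if_pos h3
          rw [hS]
          refine Finset.sum_congr rfl fun α _ => ?_
          rw [smul_assoc, c.basis_apply]
        · have hS : S j = ∅ := if_neg h3
          rw [hS]
          have h4 : (φ.basis m h.1).repr x j = 0 := by
            cases h5 : d - φ.v j with
            | ofNat k => exact absurd (h5 ▸ Int.natCast_nonneg k) h3
            | negSucc k => rw [h5] at h2; exact h2
          rw [h4]
          simp
      conv_rhs => rw [← (φ.basis m h.1).sum_repr x]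
      simp only [φ.basis_apply]
      rw [Finset.smul_sum, Fintype.sum_sigma]
      refine Finset.sum_congr rfl fun j _ => ?_
      rw [hj, Finset.smul_sum]
      refine Finset.sum_congr rfl fun α _ => ?_
      simp only [C, dif_pos h, e]
      change (χ m * _) • _ = _
      rw [smul_smul, smul_smul, mul_right_comm]
      rfl
    · simp [C, dif_neg h, hout m h]

variable {n : ℕ} {Y : NManifold.{u} I M} (F : NBundle.{u, v} (Y.prodBall n))

/-- A version of `exists_generators` which is uniform in the point of the ball. -/
lemma exists_tube_generators (m₀ : M) (d : ℤ) : ∃ (U : Set M) (_ : IsOpen U) (_ : m₀ ∈ U)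
    (ι : Type) (_ : Fintype ι) (e : ι → ∀ p, F.fib p) (c : ι → ∀ p, F.fib p →ₗ[ℝ] ℝ),
    (∀ a, e a ∈ F.sections d) ∧
    (∀ a, ∀ s ∈ F.sections d, ContMDiffOn (I.prod (UnitBall.model n)) 𝓘(ℝ, ℝ) ∞
      (fun p => c a p (s p)) (Prod.fst ⁻¹' U)) ∧
    ∀ p, p.1 ∈ U → ∀ x ∈ F.gr p d, ∑ a, c a p x • e a p = x := by
  choose ι hι e c χ he hc hχ hχ0 hχ1 hsum using fun b : UnitBall n => F.exists_generators (m₀, b) d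
  obtain ⟨T, hT⟩ := isCompact_univ.elim_finite_subcover
    (fun b : UnitBall n => {b' | 0 < χ b (m₀, b')})
    (fun b => isOpen_lt continuous_const
      ((hχ b).continuous.comp (continuous_const.prodMk continuous_id)))
    fun b _ => Set.mem_iUnion.2 ⟨b, by
      change 0 < χ b (m₀, b)
      rw [hχ1]
      exact one_pos⟩
  -- The expansions of the finite subcover add up to multiplication by `X`. It is positive on `{m₀}
  -- × Bⁿ`, hence by the tube lemma on some `U × Bⁿ`, where one divides by it.
  let X : M × UnitBall n → ℝ := fun p => ∑ b : T, χ b p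
  have hX : ContMDiff (I.prod (UnitBall.model n)) 𝓘(ℝ, ℝ) ∞ X :=
    contMDiff_finsetSum fun b _ => hχ b
  have hX0 : ∀ b, 0 < X (m₀, b) := by
    intro b
    obtain ⟨b', hb', h⟩ := Set.mem_iUnion₂.1 (hT (Set.mem_univ b))
    exact Finset.sum_pos' (fun i _ => hχ0 _ _) ⟨⟨b', hb'⟩, Finset.mem_univ _, h⟩
  obtain ⟨U, W, hU, hW, hm, hWu, hUW⟩ := generalized_tube_lemma (isCompact_singleton (x := m₀))
    (isCompact_univ (X := UnitBall n)) (n := {p | 0 < X p})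
    (isOpen_lt continuous_const hX.continuous) (by
      rintro ⟨m, b⟩ ⟨rfl, -⟩
      exact hX0 b)
  have hpos : ∀ p : M × UnitBall n, p.1 ∈ U → 0 < X p := fun p hp =>
    hUW ⟨hp, hWu (Set.mem_univ p.2)⟩
  refine ⟨U, hU, hm rfl, Σ b : T, ι b, inferInstance, fun a => e a.1 a.2,
    fun a p => (X p)⁻¹ • c a.1 a.2 p, fun a => he _ _, fun a s hs => ?_, fun p hp x hx => ?_⟩
  · exact (hX.contMDiffOn.inv₀ fun p hp => (hpos p hp).ne').mul (hc _ _ s hs).contMDiffOn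
  · rw [Fintype.sum_sigma]
    simp only [LinearMap.smul_apply, smul_assoc, ← Finset.smul_sum, hsum _ p x hx]
    rw [← Finset.sum_smul, smul_smul]
    exact (congrArg (· • x) (inv_mul_cancel₀ (hpos p hp).ne')).trans (one_smul _ _)

end NBundle

end Generators

end

/-! ### Segments in the ball and the transport equation -/

noncomputable section

/-- A set of disjoint segments in the ball, which join the points of `O` to points of the
hypersurface `ρ = 0`: the segment of `x` is parametrized by `x - (1 - t) * ρ x • V x`. -/
structure BallFlow (n : ℕ) where
  ρ : EuclideanSpace ℝ (Fin n) → ℝ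
  V : EuclideanSpace ℝ (Fin n) → EuclideanSpace ℝ (Fin n)
  O : Set (EuclideanSpace ℝ (Fin n))
  isOpen_O : IsOpen O
  contDiff_ρ : ContDiff ℝ ∞ ρ
  contDiff_V : ContDiff ℝ ∞ V
  map_mem : ∀ x ∈ O, x ∈ Metric.closedBall 0 1 → ∀ t ∈ Set.Icc (0 : ℝ) 1,
    x - ((1 - t) * ρ x) • V x ∈ O ∩ Metric.closedBall 0 1
  ρ_map : ∀ x ∈ O, x ∈ Metric.closedBall 0 1 → ∀ t ∈ Set.Icc (0 : ℝ) 1,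
    ρ (x - ((1 - t) * ρ x) • V x) = t * ρ x
  V_map : ∀ x ∈ O, x ∈ Metric.closedBall 0 1 → ∀ t ∈ Set.Icc (0 : ℝ) 1,
    V (x - ((1 - t) * ρ x) • V x) = V x
  fderiv_ρ : ∀ x ∈ O, x ∈ Metric.closedBall 0 1 → fderiv ℝ ρ x (V x) = 1

namespace BallFlow

open Set

variable {n : ℕ} (F : BallFlow n)

/-- The point with parameter `t` on the segment of a point of the ball. -/
def flow (t : ℝ) (b : UnitBall n) : UnitBall n :=
  UnitBall.retract n (b - ((1 - t) * F.ρ b) • F.V b)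

variable {b : UnitBall n} {t : ℝ}

lemma coe_flow (hb : (b : EuclideanSpace ℝ (Fin n)) ∈ F.O) (ht : t ∈ Icc (0 : ℝ) 1) :
    (F.flow t b : EuclideanSpace ℝ (Fin n)) = b - ((1 - t) * F.ρ b) • F.V b :=
  UnitBall.retract_val (F.map_mem b hb b.2 t ht).2

lemma flow_one (b : UnitBall n) : F.flow 1 b = b := by
  simp [flow, UnitBall.retract_coe]

lemma flow_mem (hb : (b : EuclideanSpace ℝ (Fin n)) ∈ F.O) (ht : t ∈ Icc (0 : ℝ) 1) :
    (F.flow t b : EuclideanSpace ℝ (Fin n)) ∈ F.O := by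
  rw [F.coe_flow hb ht]
  exact (F.map_mem b hb b.2 t ht).1

lemma ρ_flow (hb : (b : EuclideanSpace ℝ (Fin n)) ∈ F.O) (ht : t ∈ Icc (0 : ℝ) 1) :
    F.ρ (F.flow t b) = t * F.ρ b := by
  rw [F.coe_flow hb ht, F.ρ_map b hb b.2 t ht]

lemma V_flow (hb : (b : EuclideanSpace ℝ (Fin n)) ∈ F.O) (ht : t ∈ Icc (0 : ℝ) 1) :
    F.V (F.flow t b) = F.V b := by
  rw [F.coe_flow hb ht, F.V_map b hb b.2 t ht]

/-- Along a segment `V` is constant and `ρ` is scaled by the parameter. Hence the segment of an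
intermediate point is the initial part of the same segment, and parameters multiply. -/
lemma flow_flow (hb : (b : EuclideanSpace ℝ (Fin n)) ∈ F.O) (ht : t ∈ Icc (0 : ℝ) 1) {τ : ℝ}
    (hτ : τ ∈ Icc (0 : ℝ) 1) : F.flow τ (F.flow t b) = F.flow (t * τ) b := by
  apply Subtype.ext
  rw [F.coe_flow (F.flow_mem hb ht) hτ, F.ρ_flow hb ht, F.V_flow hb ht, F.coe_flow hb ht,
    F.coe_flow hb (unitInterval.mul_mem ht hτ), sub_sub, ← add_smul]
  congr 2
  ring

lemma continuous_flow (b : UnitBall n) : Continuous fun t => F.flow t b :=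
  (UnitBall.continuous_retract n).comp (by fun_prop)

end BallFlow

section Transport

open Set

/-- The operator with given matrix. -/
def matrixCLM (ι : Type*) [Fintype ι] : (ι → ι → ℝ) →L[ℝ] (ι → ℝ) →L[ℝ] (ι → ℝ) :=
  LinearMap.toContinuousLinearMap
    { toFun := fun A => LinearMap.toContinuousLinearMap
        { toFun := fun v a => ∑ c, A a c * v c
          map_add' := fun v w => by ext a; simp [mul_add, Finset.sum_add_distrib]
          map_smul' := fun r v => by ext a; simp [Finset.mul_sum, mul_left_comm] }
      map_add' := fun A B => by
        ext v a
        simp [add_mul, Finset.sum_add_distrib]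
      map_smul' := fun r A => by
        ext v a
        simp [Finset.mul_sum, mul_assoc] }

lemma matrixCLM_apply {ι : Type*} [Fintype ι] (A : ι → ι → ℝ) (v : ι → ℝ) (a : ι) :
    matrixCLM ι A v a = ∑ c, A a c * v c := rfl

variable {EM : Type*} [NormedAddCommGroup EM] [NormedSpace ℝ EM] {H : Type*} [TopologicalSpace H]
  {I : ModelWithCorners ℝ EM H} {M : Type*} [TopologicalSpace M] [ChartedSpace H M] {n : ℕ}
  (F : BallFlow n) {ι : Type*} [Fintype ι]

/-- The velocity with respect to the parameter is `ρ(b) V(b)`, which is the source of the factor `ρ`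
in the transport equation. Derivatives are taken within the ball and within the interval, since
segments may end on the sphere. -/
lemma BallFlow.hasDerivWithinAt_comp {χ : M × UnitBall n → ℝ} {U : Set (M × UnitBall n)}
    (hU : IsOpen U) (hχ : ContMDiffOn (I.prod (UnitBall.model n)) 𝓘(ℝ, ℝ) ∞ χ U) {m : M}
    {b : UnitBall n} (hb : (b : EuclideanSpace ℝ (Fin n)) ∈ F.O) {t : ℝ} (ht : t ∈ Icc (0 : ℝ) 1)
    (hmem : (m, F.flow t b) ∈ U) :
    HasDerivWithinAt (fun t => χ (m, F.flow t b))
      (F.ρ b * ballDeriv χ (m, F.flow t b) (F.V b)) (Icc 0 1) t := by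
  have h1 := (differentiableWithinAt_comp_retract hχ hU hmem).hasFDerivWithinAt
  have h2 : HasDerivWithinAt (fun t : ℝ => (b : EuclideanSpace ℝ (Fin n)) -
      ((1 - t) * F.ρ b) • F.V b) (F.ρ b • F.V b) (Icc 0 1) t := by
    have h3 := ((((hasDerivWithinAt_id t (Icc (0 : ℝ) 1)).const_sub 1).mul_const
      (F.ρ b)).smul_const (F.V b)).const_sub (b : EuclideanSpace ℝ (Fin n))
    exact h3.congr_deriv (by simp)
  dsimp only at h1
  rw [F.coe_flow hb ht] at h1
  have h3 := h1.comp_hasDerivWithinAt t h2 fun τ hτ => (F.map_mem b hb b.2 τ hτ).2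
  refine h3.congr_deriv ?_
  rw [map_smul, smul_eq_mul, ballDeriv]
  dsimp only
  rw [F.coe_flow hb ht]

section

variable (A : ι → ι → M × UnitBall n → ℝ) (g : ι → M × UnitBall n → ℝ)
  (hA : ∀ a c, Continuous (A a c)) (hg : ∀ a, Continuous (g a))

/-- The matrix of the transport equation along the segment of `p`. -/
def BallFlow.matrixPath (p : M × UnitBall n) : C(unitInterval, (ι → ℝ) →L[ℝ] (ι → ℝ)) :=
  ⟨fun t => matrixCLM ι fun a c => -(F.ρ p.2 * A a c (p.1, F.flow t p.2)), by
    have h : ∀ a c, Continuous fun t : unitInterval => A a c (p.1, F.flow t p.2) := fun a c =>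
      (hA a c).comp (continuous_const.prodMk ((F.continuous_flow p.2).comp continuous_subtype_val))
    exact (matrixCLM ι).continuous.comp (continuous_pi fun a => continuous_pi fun c =>
      (continuous_const.mul (h a c)).neg)⟩

/-- The inhomogeneous term of the transport equation along the segment of `p`. -/
def BallFlow.sourcePath (p : M × UnitBall n) : C(unitInterval, ι → ℝ) :=
  ⟨fun t a => g a (p.1, F.flow t p.2), by
    have h : ∀ a, Continuous fun t : unitInterval => g a (p.1, F.flow t p.2) := fun a =>
      (hg a).comp (continuous_const.prodMk ((F.continuous_flow p.2).comp continuous_subtype_val))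
    exact continuous_pi h⟩

/-- The solution of the transport equation. -/
def BallFlow.transportSol (p : M × UnitBall n) : ι → ℝ :=
  linearODESol (F.matrixPath A hA p) (F.sourcePath g hg p) 1

/-- The equation `w + ρ (∂_V w + A w) = g` is singular where `ρ = 0`. Along a segment, however,
`f(t) = t w(flow t b)` satisfies the regular equation `f' = -ρ(b) A f + g` with `f(0) = 0`, so `w`
is defined as the value of `f` at `1`. Consistency along the segment follows from uniqueness,
applied to the paths `τ ↦ t f_{flow t b}(τ)` and `τ ↦ f_b(t τ)`. -/
lemma BallFlow.transportSol_flow {m : M} {b : UnitBall n}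
    (hb : (b : EuclideanSpace ℝ (Fin n)) ∈ F.O) {t : ℝ} (ht : t ∈ Icc (0 : ℝ) 1) :
    t • F.transportSol A g hA hg (m, F.flow t b) =
      IccExtend zero_le_one
        (linearODESol (F.matrixPath A hA (m, b)) (F.sourcePath g hg (m, b))) t := by
  set B := F.matrixPath A hA (m, b) with hB
  set s := F.sourcePath g hg (m, b) with hs
  set B' := F.matrixPath A hA (m, F.flow t b) with hB'
  set s' := F.sourcePath g hg (m, F.flow t b) with hs'
  have hmul : ∀ τ ∈ Icc (0 : ℝ) 1, t * τ ∈ Icc (0 : ℝ) 1 := fun τ hτ =>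
    unitInterval.mul_mem ht hτ
  have hBB : ∀ τ (hτ : τ ∈ Icc (0 : ℝ) 1), B' ⟨τ, hτ⟩ = t • B ⟨t * τ, hmul τ hτ⟩ := by
    intro τ hτ
    rw [hB, hB', matrixPath, matrixPath, ContinuousMap.coe_mk, ContinuousMap.coe_mk, ← map_smul]
    congr 1
    ext a c
    simp only [Pi.smul_apply, smul_eq_mul]
    rw [F.flow_flow hb ht hτ, F.ρ_flow hb ht]
    ring
  have hss : ∀ τ (hτ : τ ∈ Icc (0 : ℝ) 1), s' ⟨τ, hτ⟩ = s ⟨t * τ, hmul τ hτ⟩ := by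
    intro τ hτ
    ext a
    change g a (m, F.flow τ (F.flow t b)) = g a (m, F.flow (t * τ) b)
    rw [F.flow_flow hb ht hτ]
  have hc : ContinuousOn (IccExtend zero_le_one B') (Icc 0 1) :=
    (continuous_IccExtend B').continuousOn
  have key := eqOn_of_linearODE hc (g := fun τ => t • IccExtend zero_le_one s' τ)
    (f := fun τ => t • IccExtend zero_le_one (linearODESol B' s') τ)
    (f' := fun τ => IccExtend zero_le_one (linearODESol B s) (t * τ)) ?_ ?_ ?_
  · have h1 := key (right_mem_Icc.2 zero_le_one)
    simp only [mul_one] at h1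
    rw [← h1]
    congr 1
    exact (IccExtend_right zero_le_one _).symm
  · intro τ hτ
    have h1 := (hasDerivWithinAt_linearODESol B' s' ⟨τ, hτ⟩).const_smul t
    refine h1.congr_deriv ?_
    rw [IccExtend_of_mem _ _ hτ, IccExtend_of_mem _ _ hτ, IccExtend_of_mem _ _ hτ, map_smul,
      smul_add]
  · intro τ hτ
    have h1 := (hasDerivWithinAt_linearODESol B s ⟨t * τ, hmul τ hτ⟩).scomp τ
      (((hasDerivWithinAt_id τ (Icc (0 : ℝ) 1)).const_mul t)) hmul
    refine h1.congr_deriv ?_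
    rw [IccExtend_of_mem _ _ hτ, IccExtend_of_mem _ _ hτ, IccExtend_of_mem _ _ (hmul τ hτ),
      hBB, hss, mul_one, smul_add]
    rfl
  · rw [mul_zero]
    have h0 : ∀ f : C(unitInterval, ι → ℝ), IccExtend (zero_le_one (α := ℝ)) f 0 = f 0 := fun f =>
      IccExtend_left zero_le_one _
    rw [h0, h0, linearODESol_zero, linearODESol_zero, smul_zero]

/-- Differentiating `t w(flow t b) = f_b(t)` at `t = 1` gives the equation at `b` itself. There is
no division by `t` or by `ρ`, so points of the initial hypersurface are included. -/
lemma BallFlow.transportSol_eq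
    (hf : ∀ a, ContMDiffOn (I.prod (UnitBall.model n)) 𝓘(ℝ, ℝ) ∞
      (fun p => F.transportSol A g hA hg p a) {p | (p.2 : EuclideanSpace ℝ (Fin n)) ∈ F.O})
    {p : M × UnitBall n} (hp : (p.2 : EuclideanSpace ℝ (Fin n)) ∈ F.O) (a : ι) :
    F.transportSol A g hA hg p a + F.ρ p.2 *
      (ballDeriv (fun p => F.transportSol A g hA hg p a) p (F.V p.2) +
        ∑ c, A a c p * F.transportSol A g hA hg p c) = g a p := by
  obtain ⟨m, b⟩ := p
  have hO : IsOpen {p : M × UnitBall n | (p.2 : EuclideanSpace ℝ (Fin n)) ∈ F.O} :=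
    F.isOpen_O.preimage (continuous_subtype_val.comp continuous_snd)
  have h1 : (1 : ℝ) ∈ Icc (0 : ℝ) 1 := right_mem_Icc.2 zero_le_one
  have hd1 := F.hasDerivWithinAt_comp hO (hf a) (m := m) hp h1 (F.flow_mem hp h1)
  have hd2 := (hasDerivWithinAt_id (1 : ℝ) (Icc (0 : ℝ) 1)).mul hd1
  have hd3 := hasDerivWithinAt_pi.1 (hasDerivWithinAt_linearODESol (F.matrixPath A hA (m, b))
    (F.sourcePath g hg (m, b)) 1) a
  have hd4 := hd3.congr_of_mem (f₁ := fun t => id t * F.transportSol A g hA hg (m, F.flow t b) a)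
    (fun t ht => congrFun (F.transportSol_flow A g hA hg (m := m) hp ht) a) h1
  have h := (uniqueDiffOn_Icc one_pos 1 h1).eq_deriv _ hd2 hd4
  simp only [F.flow_one, id, one_mul] at h
  have h5 : (F.matrixPath A hA (m, b) 1) (linearODESol (F.matrixPath A hA (m, b))
      (F.sourcePath g hg (m, b)) 1) a =
      -(F.ρ b * ∑ c, A a c (m, b) * F.transportSol A g hA hg (m, b) c) := by
    have h6 : F.matrixPath A hA (m, b) 1 = matrixCLM ι fun a c => -(F.ρ b * A a c (m, b)) := by
      change matrixCLM ι (fun a c => -(F.ρ b * A a c (m, F.flow (1 : ℝ) b))) = _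
      rw [F.flow_one]
    rw [h6, matrixCLM_apply, Finset.mul_sum, ← Finset.sum_neg_distrib]
    refine Finset.sum_congr rfl fun c _ => ?_
    rw [neg_mul, mul_assoc]
    rfl
  have h6 : F.sourcePath g hg (m, b) 1 a = g a (m, b) := by
    change g a (m, F.flow (1 : ℝ) b) = _
    rw [F.flow_one]
  rw [Pi.add_apply, h5, h6] at h
  dsimp only at h ⊢
  linarith

end

variable [FiniteDimensional ℝ EM] [I.Boundaryless] [IsManifold I ∞ M]

/-- In a chart of the body and the inclusion of the ball, a neighbourhood becomes the convex set
`X`, an open ball times the intersection of an open ball with `Bⁿ`; the body has no boundary, so the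
first factor fits into the target of the chart. The matrix and the source are then smooth maps from
`X` to spaces of paths, and the solution depends smoothly on them. -/
lemma BallFlow.contMDiffOn_transportSol {A : ι → ι → M × UnitBall n → ℝ}
    {g : ι → M × UnitBall n → ℝ}
    (hA : ∀ a c, ContMDiff (I.prod (UnitBall.model n)) 𝓘(ℝ, ℝ) ∞ (A a c))
    (hg : ∀ a, ContMDiff (I.prod (UnitBall.model n)) 𝓘(ℝ, ℝ) ∞ (g a)) (a : ι) :
    ContMDiffOn (I.prod (UnitBall.model n)) 𝓘(ℝ, ℝ) ∞
      (fun p => F.transportSol A g (fun a c => (hA a c).continuous) (fun a => (hg a).continuous)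
        p a) {p | (p.2 : EuclideanSpace ℝ (Fin n)) ∈ F.O} := by
  rintro ⟨m₀, b₀⟩ hb₀
  refine ContMDiffAt.contMDiffWithinAt ?_
  obtain ⟨ε, hε, hεs⟩ := Metric.isOpen_iff.1 (isOpen_extChartAt_target (I := I) m₀) _
    (mem_extChartAt_target m₀)
  obtain ⟨δ, hδ, hδs⟩ := Metric.isOpen_iff.1 F.isOpen_O _ hb₀
  set φ := extChartAt I m₀ with hφ
  let X : Set (EM × EuclideanSpace ℝ (Fin n)) :=
    Metric.ball (φ m₀) ε ×ˢ (Metric.ball (b₀ : EuclideanSpace ℝ (Fin n)) δ ∩ Metric.closedBall 0 1)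
  have hX2 : Convex ℝ (Metric.ball (b₀ : EuclideanSpace ℝ (Fin n)) δ ∩ Metric.closedBall 0 1) :=
    (convex_ball _ _).inter (convex_closedBall _ _)
  have hX : Convex ℝ X := (convex_ball _ _).prod hX2
  have hX' : UniqueDiffOn ℝ X := by
    refine Metric.isOpen_ball.uniqueDiffOn.prod ?_
    rw [inter_comm]
    exact (UnitBall.uniqueDiffOn_closedBall n).inter Metric.isOpen_ball
  have hpath : ∀ χ : M × UnitBall n → ℝ, ContMDiff (I.prod (UnitBall.model n)) 𝓘(ℝ, ℝ) ∞ χ →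
      ContDiffOn ℝ ∞ (fun q : ℝ × EM × EuclideanSpace ℝ (Fin n) =>
        χ (φ.symm q.2.1, F.flow q.1 (UnitBall.retract n q.2.2))) (Icc 0 1 ×ˢ X) := by
    intro χ hχ
    rw [← contMDiffOn_iff_contDiffOn]
    refine hχ.comp_contMDiffOn (ContMDiffOn.prodMk ?_ ?_)
    · refine (contMDiffOn_extChartAt_symm m₀).comp (t := φ.target)
        (contDiff_fst.comp contDiff_snd).contMDiff.contMDiffOn fun q hq => hεs hq.2.1
    · have h1 : ContDiffOn ℝ ∞ (fun q : ℝ × EM × EuclideanSpace ℝ (Fin n) =>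
          q.2.2 - ((1 - q.1) * F.ρ q.2.2) • F.V q.2.2) (Icc 0 1 ×ˢ X) := by
        have h2 : ContDiff ℝ ∞ fun q : ℝ × EM × EuclideanSpace ℝ (Fin n) => q.2.2 :=
          contDiff_snd.comp contDiff_snd
        exact (h2.sub (((contDiff_const.sub contDiff_fst).mul (F.contDiff_ρ.comp h2)).smul
          (F.contDiff_V.comp h2))).contDiffOn
      refine ((UnitBall.contMDiffOn_retract n).comp h1.contMDiffOn fun q hq => ?_).congr
        fun q hq => ?_
      · exact (F.map_mem _ (hδs hq.2.2.1) hq.2.2.2 _ hq.1).2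
      · rw [BallFlow.flow, UnitBall.retract_val hq.2.2.2]
        rfl
  have hB : ContDiffOn ℝ ∞ (fun x : EM × EuclideanSpace ℝ (Fin n) =>
      F.matrixPath A (fun a c => (hA a c).continuous) (φ.symm x.1, UnitBall.retract n x.2)) X := by
    refine ContDiffOn.curry_unitInterval hX hX' (A := fun q => matrixCLM ι fun a c =>
      -(F.ρ q.2.2 * A a c (φ.symm q.2.1, F.flow q.1 (UnitBall.retract n q.2.2)))) ?_ ?_
    · refine (matrixCLM ι).contDiff.comp_contDiffOn ?_
      refine contDiffOn_pi.2 fun a => contDiffOn_pi.2 fun c => ContDiffOn.neg (ContDiffOn.mul ?_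
        (hpath _ (hA a c)))
      exact (F.contDiff_ρ.comp (contDiff_snd.comp contDiff_snd)).contDiffOn
    · intro x hx t
      change matrixCLM ι (fun a c => -(F.ρ (UnitBall.retract n x.2) * _)) = _
      rw [UnitBall.retract_val hx.2.2]
  have hs : ContDiffOn ℝ ∞ (fun x : EM × EuclideanSpace ℝ (Fin n) =>
      F.sourcePath g (fun a => (hg a).continuous) (φ.symm x.1, UnitBall.retract n x.2)) X := by
    refine ContDiffOn.curry_unitInterval hX hX' (A := fun q a =>
      g a (φ.symm q.2.1, F.flow q.1 (UnitBall.retract n q.2.2))) ?_ fun _ _ _ => rfl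
    exact contDiffOn_pi.2 fun a => hpath _ (hg a)
  have hsol : ContDiffOn ℝ ∞ (fun x : EM × EuclideanSpace ℝ (Fin n) =>
      F.transportSol A g (fun a c => (hA a c).continuous) (fun a => (hg a).continuous)
        (φ.symm x.1, UnitBall.retract n x.2) a) X := by
    have h1 := hB.linearODESol hs
    have h2 : ContDiff ℝ ∞ fun f : C(unitInterval, ι → ℝ) => f 1 a :=
      ((ContinuousLinearMap.proj (R := ℝ) (φ := fun _ : ι => ℝ) a).comp
        (ContinuousMap.evalCLM ℝ (1 : unitInterval))).contDiff
    exact h2.comp_contDiffOn h1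
  let W : Set (M × UnitBall n) := (φ.source ∩ φ ⁻¹' Metric.ball (φ m₀) ε) ×ˢ
    ((↑) ⁻¹' Metric.ball (b₀ : EuclideanSpace ℝ (Fin n)) δ)
  have hWo : IsOpen W := ((continuousOn_extChartAt m₀).isOpen_inter_preimage
    (isOpen_extChartAt_source m₀) Metric.isOpen_ball).prod
      (Metric.isOpen_ball.preimage continuous_subtype_val)
  have hψ : ContMDiffOn (I.prod (UnitBall.model n)) 𝓘(ℝ, EM × EuclideanSpace ℝ (Fin n)) ∞
      (fun p : M × UnitBall n => (φ p.1, (p.2 : EuclideanSpace ℝ (Fin n)))) W := by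
    refine ContMDiffOn.prodMk_space ?_ ((UnitBall.contMDiff_coe n).comp contMDiff_snd).contMDiffOn
    refine (contMDiffOn_extChartAt (I := I) (x := m₀)).comp contMDiff_fst.contMDiffOn fun p hp => ?_
    rw [← extChartAt_source I]
    exact hp.1.1
  have hmaps : MapsTo (fun p : M × UnitBall n => (φ p.1, (p.2 : EuclideanSpace ℝ (Fin n)))) W X :=
    fun p hp => ⟨hp.1.2, hp.2, p.2.2⟩
  have hfin := (hsol.contMDiffOn.comp hψ hmaps).congr (f₁ := fun p =>
    F.transportSol A g (fun a c => (hA a c).continuous) (fun a => (hg a).continuous) p a)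
    fun p hp => by
      change _ = F.transportSol A g _ _ (φ.symm (φ p.1), UnitBall.retract n p.2) a
      rw [φ.left_inv hp.1.1, UnitBall.retract_coe]
  exact hfin.contMDiffAt (hWo.mem_nhds ⟨⟨mem_extChartAt_source m₀, Metric.mem_ball_self hε⟩,
    Metric.mem_ball_self hδ⟩)

end Transport

end

noncomputable section

/-! ### Parallel transport of sections -/

section TransportOfSections

variable {EM : Type*} [NormedAddCommGroup EM] [NormedSpace ℝ EM] {H : Type*} [TopologicalSpace H]
  {I : ModelWithCorners ℝ EM H} {M : Type*} [TopologicalSpace M] [ChartedSpace H M] {n : ℕ}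

section BallFunctions

lemma contMDiff_ballFun {G : Type*} [NormedAddCommGroup G] [NormedSpace ℝ G]
    {f : EuclideanSpace ℝ (Fin n) → G} (hf : ContDiff ℝ ∞ f) :
    ContMDiff (I.prod (UnitBall.model n)) 𝓘(ℝ, G) ∞ fun p : M × UnitBall n => f p.2 :=
  hf.contMDiff.comp ((UnitBall.contMDiff_coe n).comp contMDiff_snd)

lemma ballDeriv_ballFun {f : EuclideanSpace ℝ (Fin n) → ℝ} (hf : ContDiff ℝ ∞ f)
    (p : M × UnitBall n) : ballDeriv (fun p : M × UnitBall n => f p.2) p = fderiv ℝ f p.2 := by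
  rw [← (hf.differentiable (by simp) _).fderivWithin (UnitBall.uniqueDiffOn_closedBall n _ p.2.2)]
  exact fderivWithin_congr (fun x hx => congrArg f (UnitBall.retract_val hx))
    (congrArg (fun b : UnitBall n => f b) (UnitBall.retract_coe p.2))

lemma ballDeriv_bodyFun (f : M → ℝ) (p : M × UnitBall n) :
    ballDeriv (fun p : M × UnitBall n => f p.1) p = 0 := by
  simp [ballDeriv]

lemma BallFlow.contMDiff_V_apply (F : BallFlow n) (i : Fin n) :
    ContMDiff (I.prod (UnitBall.model n)) 𝓘(ℝ, ℝ) ∞ fun p : M × UnitBall n => F.V p.2 i :=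
  contMDiff_ballFun (f := fun x => F.V x i) ((contDiff_piLp_apply (p := 2)).comp F.contDiff_V)

lemma exists_bump_eq_one (I : ModelWithCorners ℝ EM H) [FiniteDimensional ℝ EM]
    [IsManifold I ∞ M] [T2Space M] {m : M} {U : Set M} (hU : IsOpen U) (hm : m ∈ U) :
    ∃ χ : M → ℝ, ContMDiff I 𝓘(ℝ, ℝ) ∞ χ ∧ tsupport χ ⊆ U ∧
      ∃ W, IsOpen W ∧ m ∈ W ∧ W ⊆ U ∧ ∀ x ∈ W, χ x = 1 := by
  obtain ⟨f, -, hf⟩ := (SmoothBumpFunction.nhds_basis_tsupport (I := I) m).mem_iff.1 (hU.mem_nhds hm)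
  obtain ⟨W, hW, hWo, hmW⟩ := mem_nhds_iff.1 f.eventuallyEq_one
  exact ⟨f, f.contMDiff, hf, W ∩ U, hWo.inter hU, ⟨hmW, hm⟩, Set.inter_subset_right,
    fun x hx => hW hx.1⟩

end BallFunctions

variable [FiniteDimensional ℝ EM] [IsManifold I ∞ M] [T2Space M] [SigmaCompactSpace M]

/-- A cutoff on the body makes the coefficients globally smooth at the cost of a smaller `U`, which
still contains whole fibres `{m} × Bⁿ` and hence whole segments. -/
lemma NBundle.exists_tube_generators_contMDiff {Y : NManifold.{u} I M}
    (E : NBundle.{u, v} (Y.prodBall n)) (m₀ : M) (d : ℤ) :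
    ∃ (U : Set M) (_ : IsOpen U) (_ : m₀ ∈ U)
    (ι : Type) (_ : Fintype ι) (e : ι → ∀ p, E.fib p) (c : ι → ∀ p, E.fib p →ₗ[ℝ] ℝ),
    (∀ a, e a ∈ E.sections d) ∧
    (∀ a, ∀ s ∈ E.sections d, ContMDiff (I.prod (UnitBall.model n)) 𝓘(ℝ, ℝ) ∞
      fun p => c a p (s p)) ∧
    ∀ p, p.1 ∈ U → ∀ x ∈ E.gr p d, ∑ a, c a p x • e a p = x := by
  obtain ⟨U, hU, hm, ι, hι, e, c, he, hc, hsum⟩ := E.exists_tube_generators m₀ d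
  obtain ⟨χ, hχ, hsupp, W, hW, hmW, hWU, h1⟩ := exists_bump_eq_one I hU hm
  refine ⟨W, hW, hmW, ι, hι, e, fun a p => χ p.1 • c a p, he, fun a s hs => ?_,
    fun p hp x hx => ?_⟩
  · rw [← contMDiffOn_univ]
    refine contMDiffOn_bump (χ := fun p : M × UnitBall n => χ p.1) (hU.preimage continuous_fst)
      isOpen_univ ((hc a s hs).mono Set.inter_subset_left) (hχ.comp contMDiff_fst) ?_
    exact (tsupport_comp_subset_preimage χ continuous_fst).trans (Set.preimage_mono hsupp)
  · simp only [h1 p.1 hp, one_smul]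
    exact hsum p (hWU hp) x hx

namespace NQBundle

variable {Y : NQManifold.{u} I M} (E : NQBundle.{u, v} (Y.prodBall n) (Y.prodBallQ n))
  (F : BallFlow n) {d : ℤ}

/-- The covariant derivative along the segments of `F`. -/
abbrev flowD (s : ∀ p, E.fib p) : ∀ p, E.fib p := E.lieD (fun p => F.V p.2) s

/-- A section vanishes if it is parallel along the segments and vanishes at their starting
points. -/
lemma eq_zero_of_flowD_eq_zero {z : ∀ p, E.fib p} (hz : z ∈ E.sections d) {m : M}
    {b : UnitBall n} (hb : (b : EuclideanSpace ℝ (Fin n)) ∈ F.O) (h0 : z (m, F.flow 0 b) = 0)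
    (hL : ∀ t ∈ Set.Icc (0 : ℝ) 1, E.flowD F z (m, F.flow t b) = 0) : z (m, b) = 0 := by
  obtain ⟨U, hU, hm, ι, _, e, c, he, hc, hsum⟩ := E.exists_tube_generators_contMDiff m d
  have hV := F.contMDiff_V_apply (I := I) (M := M)
  let ζ : ι → M × UnitBall n → ℝ := fun a p => c a p (z p)
  have hζ : ∀ a, ContMDiff (I.prod (UnitBall.model n)) 𝓘(ℝ, ℝ) ∞ (ζ a) := fun a => hc a z hz
  -- The generators may be linearly dependent. The coefficient vector `ζ` satisfies `ζ = R ζ`, and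
  -- this relation supplies a differential equation for it.
  let R : ι → ι → M × UnitBall n → ℝ := fun a a' p => c a p (e a' p)
  have hR : ∀ a a', ContMDiff (I.prod (UnitBall.model n)) 𝓘(ℝ, ℝ) ∞ (R a a') := fun a a' =>
    hc a _ (he a')
  let N : ι → ι → M × UnitBall n → ℝ := fun a a' p => c a p (E.flowD F (e a') p)
  have hN : ∀ a a', ContMDiff (I.prod (UnitBall.model n)) 𝓘(ℝ, ℝ) ∞ (N a a') := fun a a' =>
    hc a _ (E.lieD_mem hV (he a'))
  have hUo : IsOpen (Prod.fst ⁻¹' U : Set (M × UnitBall n)) := hU.preimage continuous_fst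
  have hLz : ∀ p : M × UnitBall n, p.1 ∈ U → E.flowD F z p =
      ∑ a, (ballDeriv (ζ a) p (F.V p.2) • e a p + ζ a p • E.flowD F (e a) p) := by
    intro p hp
    have h1 : E.flowD F z p = E.flowD F (∑ a, ζ a • e a) p :=
      E.lieD_congr hV hUo hz (Submodule.sum_mem _ fun a _ => E.fun_smul_mem (hζ a) (he a))
        (fun q hq => by
          rw [Finset.sum_apply]
          exact (hsum q hq _ (hz.1 q)).symm) hp
    rw [h1, flowD, E.lieD_sum hV _ fun a => E.fun_smul_mem (hζ a) (he a), Finset.sum_apply]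
    refine Finset.sum_congr rfl fun a _ => ?_
    rw [E.lieD_fun_smul hV (hζ a) (he a)]
    rfl
  have hd : ∀ χ : M × UnitBall n → ℝ, ContMDiff (I.prod (UnitBall.model n)) 𝓘(ℝ, ℝ) ∞ χ →
      ∀ t ∈ Set.Icc (0 : ℝ) 1, HasDerivWithinAt (fun t => χ (m, F.flow t b))
        (F.ρ b * ballDeriv χ (m, F.flow t b) (F.V b)) (Set.Icc 0 1) t := fun χ hχ t ht =>
    F.hasDerivWithinAt_comp isOpen_univ hχ.contMDiffOn hb ht trivial
  -- Differentiating `ζ = R ζ` gives `ζ' = R' ζ + R ζ'`. The coefficients of `Lz = 0` say that `R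
  -- ∂_V ζ = -N ζ`, so `ζ' = (R' - ρ(b) N) ζ`.
  let A : ℝ → ι → ι → ℝ := fun t a a' => F.ρ b * ballDeriv (R a a') (m, F.flow t b) (F.V b) -
    F.ρ b * N a a' (m, F.flow t b)
  have hcont : ContinuousOn (fun t => matrixCLM ι (A t)) (Set.Icc 0 1) := by
    refine (matrixCLM ι).continuous.comp_continuousOn ?_
    refine continuousOn_pi.2 fun a => continuousOn_pi.2 fun a' => ContinuousOn.sub ?_ ?_
    · have h1 := ((hR a a').contMDiffOn (s := Set.univ)).comp_retract m
      simp only [Set.mem_univ, Set.ofPred_true, Set.inter_univ] at h1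
      have h2 := h1.continuousOn_fderivWithin (UnitBall.uniqueDiffOn_closedBall n) (by simp)
      have h3 : ContinuousOn (fun t => ballDeriv (R a a') (m, F.flow t b)) (Set.Icc 0 1) :=
        h2.comp (continuous_subtype_val.comp (F.continuous_flow b)).continuousOn
          fun t _ => (F.flow t b).2
      exact continuousOn_const.mul (h3.clm_apply continuousOn_const)
    · exact (continuous_const.mul ((hN a a').continuous.comp
        (continuous_const.prodMk (F.continuous_flow b)))).continuousOn
  have hode : ∀ t ∈ Set.Icc (0 : ℝ) 1, HasDerivWithinAt (fun t a => ζ a (m, F.flow t b))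
      (matrixCLM ι (A t) (fun a => ζ a (m, F.flow t b)) + 0) (Set.Icc 0 1) t := by
    intro t ht
    refine hasDerivWithinAt_pi.2 fun a => ?_
    have h1 : HasDerivWithinAt (fun t => ∑ a', R a a' (m, F.flow t b) * ζ a' (m, F.flow t b))
        (∑ a', (F.ρ b * ballDeriv (R a a') (m, F.flow t b) (F.V b) * ζ a' (m, F.flow t b) +
          R a a' (m, F.flow t b) * (F.ρ b * ballDeriv (ζ a') (m, F.flow t b) (F.V b))))
        (Set.Icc 0 1) t :=
      HasDerivWithinAt.fun_sum fun a' _ => (hd _ (hR a a') t ht).mul (hd _ (hζ a') t ht)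
    have h2 : ∀ t, ∑ a', R a a' (m, F.flow t b) * ζ a' (m, F.flow t b) =
        ζ a (m, F.flow t b) := by
      intro t
      have h3 := congrArg (c a (m, F.flow t b)) (hsum (m, F.flow t b) hm _ (hz.1 _))
      rw [map_sum] at h3
      rw [← show c a (m, F.flow t b) (z (m, F.flow t b)) = ζ a (m, F.flow t b) from rfl, ← h3]
      refine Finset.sum_congr rfl fun a' _ => ?_
      rw [map_smul, smul_eq_mul, mul_comm]
    simp only [h2] at h1
    refine h1.congr_deriv ?_
    have h3 := congrArg (c a (m, F.flow t b)) (hLz (m, F.flow t b) hm)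
    rw [hL t ht, map_zero, map_sum] at h3
    simp only [map_add, map_smul, smul_eq_mul] at h3
    rw [F.V_flow hb ht] at h3
    rw [add_zero, matrixCLM_apply]
    have h4 : ∑ a', (F.ρ b * ballDeriv (R a a') (m, F.flow t b) (F.V b) * ζ a' (m, F.flow t b) +
          R a a' (m, F.flow t b) * (F.ρ b * ballDeriv (ζ a') (m, F.flow t b) (F.V b))) =
        ∑ a', A t a a' * ζ a' (m, F.flow t b) + F.ρ b * ∑ a',
          (ballDeriv (ζ a') (m, F.flow t b) (F.V b) * R a a' (m, F.flow t b) +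
            ζ a' (m, F.flow t b) * N a a' (m, F.flow t b)) := by
      rw [Finset.mul_sum, ← Finset.sum_add_distrib]
      refine Finset.sum_congr rfl fun a' _ => ?_
      simp only [A]
      ring
    refine h4.trans ?_
    have h5 : ∑ a', (ballDeriv (ζ a') (m, F.flow t b) (F.V b) * R a a' (m, F.flow t b) +
            ζ a' (m, F.flow t b) * N a a' (m, F.flow t b)) = 0 := h3.symm
    rw [h5, mul_zero, add_zero]
  have key := eqOn_of_linearODE hcont (g := fun _ => 0) (f' := fun _ => 0) hode
    (fun t _ => by simpa using hasDerivWithinAt_const t (Set.Icc (0 : ℝ) 1) (0 : ι → ℝ)) (by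
      ext a
      change c a _ (z (m, F.flow 0 b)) = 0
      rw [h0, map_zero]) (Set.right_mem_Icc.2 zero_le_one)
  rw [← hsum (m, b) hm _ (hz.1 _)]
  refine Finset.sum_eq_zero fun a _ => ?_
  have h1 : ζ a (m, F.flow 1 b) = 0 := congrFun key a
  rw [F.flow_one] at h1
  rw [show c a (m, b) (z (m, b)) = 0 from h1, zero_smul]

variable [I.Boundaryless] {ψ : EuclideanSpace ℝ (Fin n) → ℝ} {O' : Set (EuclideanSpace ℝ (Fin n))}

/-- For `w = Σ f_a e_a`, expanding each `L e_a` in the generators turns the equation into a system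
for the `f_a`. Solving the system is sufficient even if the generators are dependent. The cutoff `ψ`
extends the solution from `F.O` to the ball. -/
lemma exists_transport_near (hψ : ContDiff ℝ ∞ ψ) (hsupp : tsupport ψ ⊆ F.O) (hO' : IsOpen O')
    (h1 : ∀ x ∈ O', ψ x = 1) {s : ∀ p, E.fib p} (hs : s ∈ E.sections d) (m₀ : M) :
    ∃ U, IsOpen U ∧ m₀ ∈ U ∧ ∃ w ∈ E.sections d, ∀ p : M × UnitBall n, p.1 ∈ U →
      (p.2 : EuclideanSpace ℝ (Fin n)) ∈ O' → w p + F.ρ p.2 • E.flowD F w p = s p := by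
  obtain ⟨U, hU, hm, ι, _, e, c, he, hc, hsum⟩ := E.exists_tube_generators_contMDiff m₀ d
  have hV := F.contMDiff_V_apply (I := I) (M := M)
  let A : ι → ι → M × UnitBall n → ℝ := fun a a' p => c a p (E.flowD F (e a') p)
  have hA : ∀ a a', ContMDiff (I.prod (UnitBall.model n)) 𝓘(ℝ, ℝ) ∞ (A a a') := fun a a' =>
    hc a _ (E.lieD_mem hV (he a'))
  let g : ι → M × UnitBall n → ℝ := fun a p => c a p (s p)
  have hg : ∀ a, ContMDiff (I.prod (UnitBall.model n)) 𝓘(ℝ, ℝ) ∞ (g a) := fun a => hc a s hs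
  let f : ι → M × UnitBall n → ℝ := fun a p => F.transportSol A g
    (fun a c => (hA a c).continuous) (fun a => (hg a).continuous) p a
  have hf : ∀ a, ContMDiffOn (I.prod (UnitBall.model n)) 𝓘(ℝ, ℝ) ∞ (f a)
    {p | (p.2 : EuclideanSpace ℝ (Fin n)) ∈ F.O} := F.contMDiffOn_transportSol hA hg
  have hcoe : Continuous fun p : M × UnitBall n => (p.2 : EuclideanSpace ℝ (Fin n)) :=
    continuous_subtype_val.comp continuous_snd
  have hψf : ∀ a, ContMDiff (I.prod (UnitBall.model n)) 𝓘(ℝ, ℝ) ∞ fun p => ψ p.2 * f a p := by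
    intro a
    rw [← contMDiffOn_univ]
    exact contMDiffOn_bump (χ := fun p : M × UnitBall n => ψ p.2) (F.isOpen_O.preimage hcoe)
      isOpen_univ ((hf a).mono Set.inter_subset_left) (contMDiff_ballFun hψ)
      ((tsupport_comp_subset_preimage ψ hcoe).trans (Set.preimage_mono hsupp))
  refine ⟨U, hU, hm, ∑ a, (fun p => ψ p.2 * f a p) • e a,
    Submodule.sum_mem _ fun a _ => E.fun_smul_mem (hψf a) (he a), fun p hp hpO => ?_⟩
  have hpF : (p.2 : EuclideanSpace ℝ (Fin n)) ∈ F.O :=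
    hsupp (subset_tsupport _ (by rw [Function.mem_support, h1 _ hpO]; exact one_ne_zero))
  rw [flowD, E.lieD_sum hV _ fun a => E.fun_smul_mem (hψf a) (he a), Finset.sum_apply,
    Finset.sum_apply]
  have h2 : ∀ a, E.lieD (fun p => F.V p.2) ((fun p => ψ p.2 * f a p) • e a) p =
      ballDeriv (f a) p (F.V p.2) • e a p + ∑ a', (f a p * A a' a p) • e a' p := by
    intro a
    rw [E.lieD_fun_smul hV (hψf a) (he a)]
    have h3 : ballDeriv (fun p => ψ p.2 * f a p) p = ballDeriv (f a) p :=
      ballDeriv_congr (hO'.preimage hcoe) hpO fun q hq => by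
        rw [h1 _ (show (q.2 : EuclideanSpace ℝ (Fin n)) ∈ O' from hq), one_mul]
    change ballDeriv (fun p => ψ p.2 * f a p) p (F.V p.2) • e a p +
      (ψ p.2 * f a p) • E.lieD (fun p => F.V p.2) (e a) p = _
    rw [h3, h1 _ hpO, one_mul]
    conv_lhs => rw [← hsum p hp _ ((E.lieD_mem hV (he a)).1 p), Finset.smul_sum]
    simp only [smul_smul]
    rfl
  simp only [h2]
  conv_rhs => rw [← hsum p hp _ (hs.1 p)]
  rw [Finset.sum_add_distrib, Finset.sum_comm, ← Finset.sum_add_distrib, Finset.smul_sum,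
    ← Finset.sum_add_distrib]
  refine Finset.sum_congr rfl fun a _ => ?_
  have h3 := F.transportSol_eq A g (fun a c => (hA a c).continuous) (fun a => (hg a).continuous)
    hf hpF a
  change (ψ p.2 * f a p) • e a p + _ = g a p • e a p
  rw [← h3, ← Finset.sum_smul, ← add_smul, smul_smul, ← add_smul, h1 _ hpO, one_mul]
  congr 3
  congr 1
  exact Finset.sum_congr rfl fun a' _ => mul_comm _ _

/-- The solution of the transport equation with given right hand side. -/
lemma exists_flowD_eq (hψ : ContDiff ℝ ∞ ψ) (hsupp : tsupport ψ ⊆ F.O) (hO' : IsOpen O')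
    (h1 : ∀ x ∈ O', ψ x = 1) {s : ∀ p, E.fib p} (hs : s ∈ E.sections d) :
    ∃ w ∈ E.sections d, ∀ p : M × UnitBall n, (p.2 : EuclideanSpace ℝ (Fin n)) ∈ O' →
      w p + F.ρ p.2 • E.flowD F w p = s p := by
  choose U hU hmU w hw hws using E.exists_transport_near F hψ hsupp hO' h1 hs
  have hV := F.contMDiff_V_apply (I := I) (M := M)
  -- The partition of unity lives on the body of `Y`, so its functions are constant along the
  -- segments and commute with `L`. Gluing therefore preserves the equation.
  obtain ⟨μ, hμ⟩ := SmoothPartitionOfUnity.exists_isSubordinate I isClosed_univ U hU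
    fun m _ => Set.mem_iUnion.2 ⟨m, hmU m⟩
  have hμs : ∀ i, ContMDiff (I.prod (UnitBall.model n)) 𝓘(ℝ, ℝ) ∞
      fun p : M × UnitBall n => μ i p.1 := fun i => (μ i).contMDiff.comp contMDiff_fst
  let T : Finset M → ∀ p, E.fib p := fun t => ∑ i ∈ t, (fun p : M × UnitBall n => μ i p.1) • w i
  have hT : ∀ t, T t ∈ E.sections d := fun t =>
    Submodule.sum_mem _ fun i _ => E.fun_smul_mem (hμs i) (hw i)
  -- Over a neighbourhood of each point of the body `W` is one fixed finite sum, to which additivity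
  -- and locality of `L` apply.
  let W : ∀ p, E.fib p := fun p => T (μ.finsupport p.1) p
  have hWT : ∀ (t : Finset M) p, μ.finsupport p.1 ⊆ t → W p = T t p := by
    intro t p ht
    simp only [W, T, Finset.sum_apply]
    refine Finset.sum_subset ht fun i _ hi => ?_
    change μ i p.1 • w i p = 0
    rw [show μ i p.1 = 0 by simpa [SmoothPartitionOfUnity.mem_finsupport] using hi, zero_smul]
  have hnear : ∀ m, ∃ N, IsOpen N ∧ m ∈ N ∧ ∃ t, ∀ m' ∈ N, μ.finsupport m' ⊆ t := by
    intro m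
    obtain ⟨t, ht⟩ : ∃ t : Finset M, ∀ᶠ m' in nhds m, μ.finsupport m' ⊆ t :=
      ⟨_, (μ.eventually_finsupport_subset m).mono fun _ h => h⟩
    obtain ⟨N, hN, hNo, hmN⟩ := eventually_nhds_iff.1 ht
    exact ⟨N, hNo, hmN, t, hN⟩
  have hW : W ∈ E.sections d := by
    refine NBundle.mem_sections_of_local fun p => ?_
    obtain ⟨N, hN, hmN, t, ht⟩ := hnear p.1
    exact ⟨_, hN.preimage continuous_fst, hmN, T t, hT t, fun q hq => hWT t q (ht _ hq)⟩
  refine ⟨W, hW, fun p hp => ?_⟩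
  obtain ⟨N, hN, hmN, t, ht⟩ := hnear p.1
  have h2 : E.flowD F W p = ∑ i ∈ t, μ i p.1 • E.flowD F (w i) p := by
    rw [flowD, E.lieD_congr hV (hN.preimage continuous_fst) hW (hT t)
      (fun q hq => hWT t q (ht _ hq)) hmN, E.lieD_sum hV t fun i => E.fun_smul_mem (hμs i) (hw i),
      Finset.sum_apply]
    refine Finset.sum_congr rfl fun i _ => ?_
    rw [E.lieD_fun_smul hV (hμs i) (hw i)]
    change ballDeriv (fun p : M × UnitBall n => μ i p.1) p (F.V p.2) • w i p + _ = _
    rw [ballDeriv_bodyFun, zero_apply, zero_smul, zero_add]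
    rfl
  rw [h2, hWT t p (ht _ hmN)]
  simp only [T, Finset.sum_apply]
  rw [Finset.smul_sum, ← Finset.sum_add_distrib]
  have h3 : ∀ i ∈ t, ((fun p : M × UnitBall n => μ i p.1) • w i) p +
      F.ρ p.2 • μ i p.1 • E.flowD F (w i) p = μ i p.1 • s p := by
    intro i _
    change μ i p.1 • w i p + _ = _
    rw [smul_comm, ← smul_add]
    by_cases h : p.1 ∈ U i
    · rw [hws i p h hp]
    · rw [image_eq_zero_of_notMem_tsupport fun h' => h (hμ i h'), zero_smul, zero_smul]
  rw [Finset.sum_congr rfl h3, ← Finset.sum_smul]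
  have h4 : ∑ i ∈ t, μ i p.1 = 1 := by
    rw [← μ.sum_finsupport p.1 (Set.mem_univ _)]
    refine (Finset.sum_subset (ht _ hmN) fun i _ hi => ?_).symm
    simpa [SmoothPartitionOfUnity.mem_finsupport] using hi
  rw [h4, one_smul]

/-- Because `V(ρ) = 1`, the transport equation for `w` says that `ρ w` is a primitive of the right
hand side along the segments, and this primitive visibly vanishes where they start. -/
lemma flowD_ρ_smul {w : ∀ p, E.fib p} (hw : w ∈ E.sections d) {p : M × UnitBall n}
    (hp : (p.2 : EuclideanSpace ℝ (Fin n)) ∈ F.O) :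
    E.flowD F ((fun p : M × UnitBall n => F.ρ p.2) • w) p = w p + F.ρ p.2 • E.flowD F w p := by
  rw [flowD, E.lieD_fun_smul (F.contMDiff_V_apply) (contMDiff_ballFun F.contDiff_ρ) hw]
  change ballDeriv (fun p : M × UnitBall n => F.ρ p.2) p (F.V p.2) • w p + _ = _
  rw [ballDeriv_ballFun F.contDiff_ρ, F.fderiv_ρ _ hp p.2.2, one_smul]
  rfl

end NQBundle

end TransportOfSections

end

/-! ### Relative cohomology and the Poincaré lemma along segments -/

noncomputable section

/-- A map which is linear on `Z` and induces a bijection of the quotients. -/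
lemma Submodule.nonempty_quotient_equiv {R N N' : Type*} [Ring R] [AddCommGroup N] [Module R N]
    [AddCommGroup N'] [Module R N'] {Z B : Submodule R N} {Z' B' : Submodule R N'} (f : N → N')
    (hZ : ∀ z ∈ Z, f z ∈ Z') (hadd : ∀ z ∈ Z, ∀ w ∈ Z, f (z + w) = f z + f w)
    (hsmul : ∀ (r : R), ∀ z ∈ Z, f (r • z) = r • f z) (hB : ∀ z ∈ Z, f z ∈ B' ↔ z ∈ B)
    (hs : ∀ z' ∈ Z', ∃ z ∈ Z, z' - f z ∈ B') :
    Nonempty ((Z ⧸ B.submoduleOf Z) ≃ₗ[R] (Z' ⧸ B'.submoduleOf Z')) := by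
  let g : Z →ₗ[R] Z' :=
    { toFun := fun z => ⟨f z, hZ z z.2⟩
      map_add' := fun z w => Subtype.ext (hadd z z.2 w w.2)
      map_smul' := fun r z => Subtype.ext (hsmul r z z.2) }
  let q := (B'.submoduleOf Z').mkQ ∘ₗ g
  have hker : LinearMap.ker q = B.submoduleOf Z := by
    ext z
    rw [LinearMap.mem_ker]
    exact (Submodule.Quotient.mk_eq_zero (p := B'.submoduleOf Z') (x := g z)).trans (hB z z.2)
  have hsurj : Function.Surjective q := by
    intro y
    obtain ⟨⟨z', hz'⟩, rfl⟩ := (B'.submoduleOf Z').mkQ_surjective y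
    obtain ⟨z, hz, h⟩ := hs z' hz'
    exact ⟨⟨z, hz⟩, ((Submodule.Quotient.eq (B'.submoduleOf Z') (x := ⟨z', hz'⟩)
      (y := g ⟨z, hz⟩)).2 h).symm⟩
  exact ⟨(Submodule.quotEquivOfEq _ _ hker.symm).trans (q.quotKerEquivOfSurjective hsurj)⟩

section Relative

variable {EM : Type*} [NormedAddCommGroup EM] [NormedSpace ℝ EM] {H : Type*} [TopologicalSpace H]
  {I : ModelWithCorners ℝ EM H} {M : Type*} [TopologicalSpace M] [ChartedSpace H M] {n : ℕ}

namespace NQBundle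

section General

variable {P : NManifold.{u} I M} {Q : (∀ m, P.fib m) → ∀ m, P.fib m} (E : NQBundle.{u, v} P Q)

/-- The sections of degree `d` in `A` which are closed modulo `B`. -/
def relCocycles (A B : Submodule ℝ (∀ m, E.fib m)) (d : ℤ) : Submodule ℝ (∀ m, E.fib m) where
  carrier := {s | s ∈ E.sections d ∧ s ∈ A ∧ E.D s ∈ B}
  zero_mem' := ⟨zero_mem _, zero_mem _, by rw [E.D_zero]; exact zero_mem _⟩
  add_mem' hs ht := ⟨add_mem hs.1 ht.1, add_mem hs.2.1 ht.2.1, by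
    rw [E.D_add d _ hs.1 _ ht.1]; exact add_mem hs.2.2 ht.2.2⟩
  smul_mem' t s hs := ⟨Submodule.smul_mem _ t hs.1, Submodule.smul_mem _ t hs.2.1, by
    rw [E.D_smul d _ hs.1]; exact Submodule.smul_mem _ t hs.2.2⟩

/-- The sections of degree `d` which are modulo `B` differentials of sections in `A`. -/
def relCoboundaries (A B : Submodule ℝ (∀ m, E.fib m)) (d : ℤ) : Submodule ℝ (∀ m, E.fib m) where
  carrier := {s | ∃ u, u ∈ E.sections (d - 1) ∧ u ∈ A ∧ s - E.D u ∈ B}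
  zero_mem' := ⟨0, zero_mem _, zero_mem _, by rw [E.D_zero, sub_zero]; exact zero_mem _⟩
  add_mem' := by
    rintro s t ⟨u, hu, hu', hs⟩ ⟨w, hw, hw', ht⟩
    refine ⟨u + w, add_mem hu hw, add_mem hu' hw', ?_⟩
    rw [E.D_add _ _ hu _ hw, add_sub_add_comm]
    exact add_mem hs ht
  smul_mem' := by
    rintro r s ⟨u, hu, hu', hs⟩
    refine ⟨r • u, Submodule.smul_mem _ r hu, Submodule.smul_mem _ r hu', ?_⟩
    rw [E.D_smul _ _ hu, ← smul_sub]
    exact Submodule.smul_mem _ r hs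

/-- The cohomology in degree `d` of the complex of the sections in `A` modulo those in `B`. -/
abbrev relCohomology (A B : Submodule ℝ (∀ m, E.fib m)) (d : ℤ) : Type _ :=
  E.relCocycles A B d ⧸ (E.relCoboundaries A B d).submoduleOf (E.relCocycles A B d)

variable {A A' B B' : Submodule ℝ (∀ m, E.fib m)} {d : ℤ}

lemma D_mem_sections {s : ∀ m, E.fib m} (hs : s ∈ E.sections (d - 1)) : E.D s ∈ E.sections d := by
  simpa using E.D_mem _ s hs

lemma cohomologyIn_equiv : Nonempty (E.cohomologyIn A d ≃ₗ[ℝ] E.relCohomology A ⊥ d) := by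
  refine Submodule.nonempty_quotient_equiv id (fun z hz => hz) (fun _ _ _ _ => rfl)
    (fun _ _ _ => rfl) (fun z _ => ?_) fun z hz => ⟨z, hz, by simp⟩
  constructor
  · rintro ⟨u, hu, hu', h⟩
    exact ⟨u, hu, hu', (sub_eq_zero.1 h).symm⟩
  · rintro ⟨u, hu, hu', h⟩
    exact ⟨u, hu, hu', by simp [h]⟩

/-- The inclusion of a subcomplex with acyclic quotient. -/
lemma relCohomology_equiv_left (hAA' : A ≤ A')
    (h : ∀ d, ∀ s ∈ E.sections d, s ∈ A' → E.D s ∈ A →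
      ∃ u ∈ E.sections (d - 1), u ∈ A' ∧ s - E.D u ∈ A) :
    Nonempty (E.relCohomology A ⊥ d ≃ₗ[ℝ] E.relCohomology A' ⊥ d) := by
  refine Submodule.nonempty_quotient_equiv id (fun z hz => ⟨hz.1, hAA' hz.2.1, hz.2.2⟩)
    (fun _ _ _ _ => rfl) (fun _ _ _ => rfl) (fun z hz => ?_) fun z hz => ?_
  · constructor
    · rintro ⟨u, hu, hu', h1⟩
      have h2 : z = E.D u := sub_eq_zero.1 h1
      -- The primitive `u` lies in `A'` only, but `D u = z` lies in `A`. So `u` is closed modulo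
      -- `A`, and an exact term moves it into `A`.
      obtain ⟨w, hw, -, h3⟩ := h _ u hu hu' (h2 ▸ hz.2.1)
      have h4 := E.D_mem_sections hw
      refine ⟨u - E.D w, sub_mem hu h4, h3, ?_⟩
      rw [E.D_sub hu h4, E.D_D _ _ hw, sub_zero]
      exact h1
    · rintro ⟨u, hu, hu', h1⟩
      exact ⟨u, hu, hAA' hu', h1⟩
  · have hz0 : E.D z = 0 := hz.2.2
    obtain ⟨u, hu, hu', h1⟩ := h d z hz.1 hz.2.1 (by rw [hz0]; exact zero_mem _)
    have h2 := E.D_mem_sections hu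
    refine ⟨z - E.D u, ⟨sub_mem hz.1 h2, h1, ?_⟩, u, hu, hu', ?_⟩
    · rw [E.D_sub hz.1 h2, E.D_D _ _ hu, hz0, sub_zero]
      exact zero_mem _
    · simp

/-- The quotient by an acyclic complex. -/
lemma relCohomology_equiv_right (hBB' : B ≤ B')
    (h : ∀ d, ∀ s ∈ E.sections d, s ∈ B' → E.D s ∈ B →
      ∃ u ∈ E.sections (d - 1), u ∈ B' ∧ s - E.D u ∈ B) :
    Nonempty (E.relCohomology ⊤ B d ≃ₗ[ℝ] E.relCohomology ⊤ B' d) := by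
  refine Submodule.nonempty_quotient_equiv id (fun z hz => ⟨hz.1, hz.2.1, hBB' hz.2.2⟩)
    (fun _ _ _ _ => rfl) (fun _ _ _ => rfl) (fun z hz => ?_) fun z hz => ?_
  · constructor
    · rintro ⟨u, hu, -, h1⟩
      have h2 := E.D_mem_sections hu
      obtain ⟨w, hw, -, h3⟩ := h d (z - E.D u) (sub_mem hz.1 h2) h1 (by
        rw [E.D_sub hz.1 h2, E.D_D _ _ hu, sub_zero]
        exact hz.2.2)
      refine ⟨u + w, add_mem hu hw, trivial, ?_⟩
      rw [E.D_add _ _ hu _ hw, ← sub_sub]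
      exact h3
    · rintro ⟨u, hu, hu', h1⟩
      exact ⟨u, hu, hu', hBB' h1⟩
  -- `D z` lies in `B'` and is closed. Subtracting from `z` a primitive `u` in `B'` puts the
  -- differential into `B` and does not change the class modulo `B'`.
  · obtain ⟨u, hu, hu', h1⟩ := h (d + 1) (E.D z) (E.D_mem d z hz.1) hz.2.2 (by
      rw [E.D_D d z hz.1]
      exact zero_mem _)
    rw [add_sub_cancel_right] at hu
    refine ⟨z - u, ⟨sub_mem hz.1 hu, trivial, ?_⟩, 0, zero_mem _, trivial, ?_⟩
    · rw [E.D_sub hz.1 hu]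
      exact h1
    · rw [E.D_zero]
      simpa using hu'

/-- The families which vanish on a set. -/
def vanishOn (Z : Set M) : Submodule ℝ (∀ m, E.fib m) where
  carrier := {s | ∀ m ∈ Z, s m = 0}
  zero_mem' _ _ := rfl
  add_mem' hs ht m hm := by rw [Pi.add_apply, hs m hm, ht m hm, add_zero]
  smul_mem' r s hs m hm := by rw [Pi.smul_apply, hs m hm, smul_zero]

end General

variable {Y : NQManifold.{u} I M} (E : NQBundle.{u, v} (Y.prodBall n) (Y.prodBallQ n))
variable [FiniteDimensional ℝ EM] [IsManifold I ∞ M] [T2Space M] [SigmaCompactSpace M]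

lemma D_mem_vanishOn {Z : Set (M × UnitBall n)} (hZ : IsOpen Z) {d : ℤ} {s : ∀ p, E.fib p}
    (hs : s ∈ E.sections d) (h : s ∈ E.vanishOn Z) : E.D s ∈ E.vanishOn Z := fun _ hp =>
  E.D_eq_zero_of_eqOn hZ hs h hp

lemma contractField_mem_vanishOn {Z : Set (M × UnitBall n)}
    (V : M × UnitBall n → EuclideanSpace ℝ (Fin n)) {s : ∀ p, E.fib p}
    (h : s ∈ E.vanishOn Z) : E.contractField V s ∈ E.vanishOn Z := fun p hp => by
  rw [contractField_apply, h p hp, map_zero]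

end NQBundle

/-- An open set which is preserved by a flow, and on which the transport equation can be solved
globally. -/
structure BallRegion (n : ℕ) extends BallFlow n where
  U : Set (EuclideanSpace ℝ (Fin n))
  isOpen_U : IsOpen U
  map_mem_U : ∀ x ∈ U, x ∈ Metric.closedBall 0 1 → ∀ t ∈ Set.Icc (0 : ℝ) 1,
    x - ((1 - t) * ρ x) • V x ∈ U
  -- This cutoff extends by zero solutions which are smooth on `O` only, without changing them on
  -- `U`.
  ψ : EuclideanSpace ℝ (Fin n) → ℝ
  contDiff_ψ : ContDiff ℝ ∞ ψ
  tsupport_ψ : tsupport ψ ⊆ O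
  ψ_eq_one : ∀ x ∈ U, ψ x = 1

namespace BallRegion

variable (F : BallRegion n)

lemma U_subset : F.U ⊆ F.O := fun x hx =>
  F.tsupport_ψ (subset_tsupport _ (by
    rw [Function.mem_support, F.ψ_eq_one x hx]
    exact one_ne_zero))

lemma flow_mem_U {b : UnitBall n} (hb : (b : EuclideanSpace ℝ (Fin n)) ∈ F.U) {t : ℝ}
    (ht : t ∈ Set.Icc (0 : ℝ) 1) : (F.flow t b : EuclideanSpace ℝ (Fin n)) ∈ F.U := by
  rw [F.coe_flow (F.U_subset hb) ht]
  exact F.map_mem_U b hb b.2 t ht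

lemma ρ_flow_zero {b : UnitBall n} (hb : (b : EuclideanSpace ℝ (Fin n)) ∈ F.U) :
    F.ρ (F.flow 0 b) = 0 := by
  rw [F.ρ_flow (F.U_subset hb) (Set.left_mem_Icc.2 zero_le_one), zero_mul]

/-- The part of `M × Bⁿ` over the region. -/
def tube (M : Type*) : Set (M × UnitBall n) := {p | (p.2 : EuclideanSpace ℝ (Fin n)) ∈ F.U}

lemma isOpen_tube : IsOpen (F.tube M) :=
  F.isOpen_U.preimage (continuous_subtype_val.comp continuous_snd)

lemma contMDiff_ρ : ContMDiff (I.prod (UnitBall.model n)) 𝓘(ℝ, ℝ) ∞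
    fun p : M × UnitBall n => F.ρ p.2 := contMDiff_ballFun F.contDiff_ρ

end BallRegion

namespace NQBundle

variable {Y : NQManifold.{u} I M} (E : NQBundle.{u, v} (Y.prodBall n) (Y.prodBallQ n))
variable [FiniteDimensional ℝ EM] [IsManifold I ∞ M] [T2Space M] [SigmaCompactSpace M]
variable (F : BallRegion n) {d : ℤ}

/-- Contraction with the field of velocities of the segments. -/
abbrev flowK : (∀ p, E.fib p) →ₗ[ℝ] ∀ p, E.fib p := E.contractField fun p => F.V p.2

variable {s : ∀ p, E.fib p}

lemma flowK_mem (hs : s ∈ E.sections d) : E.flowK F s ∈ E.sections (d - 1) :=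
  E.contractField_mem F.contMDiff_V_apply hs

variable [I.Boundaryless]

/-- A primitive of a section along the segments, which is divisible by `ρ`. -/
lemma exists_flow_primitive (hs : s ∈ E.sections d) : ∃ w ∈ E.sections d,
    (∀ p ∈ F.tube M, E.flowD F.toBallFlow ((fun p : M × UnitBall n => F.ρ p.2) • w) p = s p) ∧
    ∀ p ∈ F.tube M, F.ρ p.2 = 0 → w p = s p := by
  obtain ⟨w, hw, h⟩ := E.exists_flowD_eq F.toBallFlow F.contDiff_ψ F.tsupport_ψ F.isOpen_U
    F.ψ_eq_one hs
  refine ⟨w, hw, fun p hp => ?_, fun p hp h0 => ?_⟩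
  · rw [E.flowD_ρ_smul F.toBallFlow hw (F.U_subset hp)]
    exact h p hp
  · have h1 := h p hp
    rwa [h0, zero_smul, add_zero] at h1

/-- On the region `D` commutes with taking primitives, up to terms which are determined on the
initial hypersurface. -/
lemma flowD_D_eq {w : ∀ p, E.fib p} (hw : w ∈ E.sections d) (hs : s ∈ E.sections d)
    (h : ∀ p ∈ F.tube M, E.flowD F.toBallFlow w p = s p) {p : M × UnitBall n}
    (hp : p ∈ F.tube M) : E.flowD F.toBallFlow (E.D w) p = E.D s p := by
  rw [flowD, E.lieD_D F.contMDiff_V_apply hw]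
  exact E.D_congr F.isOpen_tube (E.lieD_mem F.contMDiff_V_apply hw) hs h hp

/-- The sections which vanish on an open set are acyclic on the region, if the segments start in
this set and do not leave it. -/
lemma exists_primitive_of_vanishOn {Z : Set (M × UnitBall n)} (hZ : IsOpen Z)
    (hZU : Z ⊆ F.tube M)
    (hflow : ∀ p ∈ Z, ∀ t ∈ Set.Icc (0 : ℝ) 1, (p.1, F.flow t p.2) ∈ Z)
    (hstart : ∀ p ∈ F.tube M, (p.1, F.flow 0 p.2) ∈ Z) (hs : s ∈ E.sections d)
    (hsZ : s ∈ E.vanishOn Z) (hDs : E.D s ∈ E.vanishOn (F.tube M)) :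
    ∃ u ∈ E.sections (d - 1), u ∈ E.vanishOn Z ∧ s - E.D u ∈ E.vanishOn (F.tube M) := by
  obtain ⟨w', hw', hL, -⟩ := E.exists_flow_primitive F hs
  set w := (fun p : M × UnitBall n => F.ρ p.2) • w' with hwdef
  have hw : w ∈ E.sections d := E.fun_smul_mem F.contMDiff_ρ hw'
  have hwZ : w ∈ E.vanishOn Z := by
    rintro ⟨m, b⟩ hp
    refine E.eq_zero_of_flowD_eq_zero F.toBallFlow hw (F.U_subset (hZU hp)) ?_ fun t ht => ?_
    · change F.ρ (F.flow 0 b) • w' _ = 0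
      rw [F.ρ_flow_zero (hZU hp), zero_smul]
    · have h1 := hflow _ hp t ht
      rw [hL _ (hZU h1)]
      exact hsZ _ h1
  refine ⟨E.flowK F w, E.flowK_mem F hw, E.contractField_mem_vanishOn _ hwZ, ?_⟩
  -- `L(Dw) = Ds` vanishes on the region, and at the starting points `Dw` vanishes because `w` is
  -- zero on the open set `Z` which contains them.
  have hDw : E.D w ∈ E.vanishOn (F.tube M) := by
    rintro ⟨m, b⟩ hp
    refine E.eq_zero_of_flowD_eq_zero F.toBallFlow (E.D_mem d w hw) (F.U_subset hp) ?_
      fun t ht => ?_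
    · exact E.D_mem_vanishOn hZ hw hwZ _ (hstart _ hp)
    · have h1 : (m, F.flow t b) ∈ F.tube M := F.flow_mem_U hp ht
      rw [E.flowD_D_eq F hw hs hL h1]
      exact hDs _ h1
  -- Now `s = Lw = Dιw + ιDw`, and the last term is zero.
  intro p hp
  have h1 := hL p hp
  have h2 : E.flowD F.toBallFlow w p = E.D (E.flowK F w) p + E.contract p (F.V p.2) (E.D w p) :=
    rfl
  rw [h2, hDw p hp, map_zero, add_zero] at h1
  rw [Pi.sub_apply, h1, sub_self]

end NQBundle

end Relative

end

noncomputable section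

/-! ### Excision and the Mayer–Vietoris argument -/

section MayerVietoris

variable {EM : Type*} [NormedAddCommGroup EM] [NormedSpace ℝ EM] {H : Type*} [TopologicalSpace H]
  {I : ModelWithCorners ℝ EM H} {M : Type*} [TopologicalSpace M] [ChartedSpace H M] {n : ℕ}

namespace NQBundle

variable {Y : NQManifold.{u} I M} (E : NQBundle.{u, v} (Y.prodBall n) (Y.prodBallQ n))
variable [FiniteDimensional ℝ EM] [IsManifold I ∞ M] [T2Space M] [SigmaCompactSpace M]
variable {d : ℤ} {χ : M × UnitBall n → ℝ}

/-- Excision. -/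
lemma relCohomology_equiv_excision {W C N : Set (M × UnitBall n)} (hW : IsOpen W) (hN : IsOpen N)
    (hNC : N ⊆ C) (hNW : ∀ p, p ∈ W ∨ p ∈ N)
    (hχ : ContMDiff (I.prod (UnitBall.model n)) 𝓘(ℝ, ℝ) ∞ χ) (h1 : ∀ p ∈ N, χ p = 1)
    (h0 : ∀ p ∉ C, χ p = 0) :
    Nonempty (E.relCohomology (E.vanishOn W) ⊥ d ≃ₗ[ℝ]
      E.relCohomology (E.vanishOn (C ∩ W)) (E.vanishOn C) d) := by
  have hsub : ∀ {u : ∀ p, E.fib p}, u ∈ E.vanishOn (C ∩ W) → χ • u ∈ E.vanishOn W := by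
    intro u hu p hp
    change χ p • u p = 0
    by_cases hpC : p ∈ C
    · rw [hu p ⟨hpC, hp⟩, smul_zero]
    · rw [h0 p hpC, zero_smul]
  have hD : ∀ {d : ℤ} {u : ∀ p, E.fib p}, u ∈ E.sections d → ∀ p ∈ N,
      E.D (χ • u) p = E.D u p := by
    intro d u hu p hp
    refine E.D_congr hN (E.fun_smul_mem hχ hu) hu (fun q hq => ?_) hp
    change χ q • u q = u q
    rw [h1 q hq, one_smul]
  refine Submodule.nonempty_quotient_equiv id (fun z hz => ⟨hz.1, fun p hp => hz.2.1 p hp.2, ?_⟩)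
    (fun _ _ _ _ => rfl) (fun _ _ _ => rfl) (fun z hz => ?_) fun z hz => ?_
  · rw [id, (Submodule.mem_bot ℝ).1 hz.2.2]
    exact zero_mem _
  · constructor
    · rintro ⟨u, hu, huZ, h⟩
      refine ⟨χ • u, E.fun_smul_mem hχ hu, hsub huZ, ?_⟩
      refine (Submodule.mem_bot ℝ).2 (funext fun p => ?_)
      rcases hNW p with hp | hp
      · rw [Pi.sub_apply, hz.2.1 p hp, E.D_mem_vanishOn hW (E.fun_smul_mem hχ hu) (hsub huZ) p hp,
          sub_zero]
        rfl
      · rw [Pi.sub_apply, hD hu p hp]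
        exact h p (hNC hp)
    · rintro ⟨u, hu, huW, h⟩
      refine ⟨u, hu, fun p hp => huW p hp.2, ?_⟩
      rw [id, (Submodule.mem_bot ℝ).1 h]
      exact zero_mem _
  -- On `C` the section `χz` equals `z`: on `N` because `χ = 1`, elsewhere in `C` because both
  -- vanish on `C ∩ W`. Outside `C` it is zero, so it vanishes on all of `W`.
  · refine ⟨χ • z, ⟨E.fun_smul_mem hχ hz.1, hsub hz.2.1, ?_⟩, 0, zero_mem _, zero_mem _, ?_⟩
    · refine (Submodule.mem_bot ℝ).2 (funext fun p => ?_)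
      rcases hNW p with hp | hp
      · exact E.D_mem_vanishOn hW (E.fun_smul_mem hχ hz.1) (hsub hz.2.1) p hp
      · rw [hD hz.1 p hp]
        exact hz.2.2 p (hNC hp)
    · rw [E.D_zero, sub_zero]
      intro p hpC
      change z p - χ p • z p = 0
      rcases hNW p with hp | hp
      · rw [hz.2.1 p ⟨hpC, hp⟩, smul_zero, sub_zero]
      · rw [h1 p hp, one_smul, sub_self]

/-- The connecting isomorphism of Mayer and Vietoris, for two acyclic complexes. -/
lemma relCohomology_equiv_union {C Z Z₁ Z₂ : Set (M × UnitBall n)} (hC : IsOpen C)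
    (hZ : IsOpen Z) (hZ₁ : IsOpen Z₁) (hZ₂ : IsOpen Z₂) (hZZ₁ : Z ⊆ Z₁) (hZZ₂ : Z ⊆ Z₂)
    (hZC : Z₁ ⊆ C) (hχ : ContMDiff (I.prod (UnitBall.model n)) 𝓘(ℝ, ℝ) ∞ χ)
    (h1 : ∀ p ∈ Z₁, p ∈ Z ∨ χ p = 1) (h2 : ∀ p ∈ Z₂, p ∈ Z ∨ χ p = 0)
    (hac₁ : ∀ d, ∀ s ∈ E.sections d, s ∈ E.vanishOn Z₁ → E.D s ∈ E.vanishOn C →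
      ∃ u ∈ E.sections (d - 1), u ∈ E.vanishOn Z₁ ∧ s - E.D u ∈ E.vanishOn C)
    (hac₂ : ∀ d, ∀ s ∈ E.sections d, s ∈ E.vanishOn Z₂ → E.D s ∈ E.vanishOn C →
      ∃ u ∈ E.sections (d - 1), u ∈ E.vanishOn Z₂ ∧ s - E.D u ∈ E.vanishOn C) :
    Nonempty (E.relCohomology (E.vanishOn Z) (E.vanishOn C) d ≃ₗ[ℝ]
      E.relCohomology (E.vanishOn (Z₁ ∪ Z₂)) (E.vanishOn C) (d + 1)) := by
  have hs₁ : ∀ {s : ∀ p, E.fib p}, s ∈ E.vanishOn Z → ∀ p ∈ Z₁, (χ • s) p = s p := by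
    intro s hs p hp
    change χ p • s p = s p
    rcases h1 p hp with h | h
    · rw [hs p h, smul_zero]
    · rw [h, one_smul]
  have hs₂ : ∀ {s : ∀ p, E.fib p}, s ∈ E.vanishOn Z → χ • s ∈ E.vanishOn Z₂ := by
    intro s hs p hp
    change χ p • s p = 0
    rcases h2 p hp with h | h
    · rw [hs p h, smul_zero]
    · rw [h, zero_smul]
  -- The connecting map: `χs` agrees with `s` on `Z₁` and vanishes on `Z₂`, so for `s` closed on `C`
  -- the differential of `χs` vanishes on both.
  refine Submodule.nonempty_quotient_equiv (fun s => E.D (χ • s)) (fun s hs => ?_)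
    (fun s hs t ht => ?_) (fun r s hs => ?_) (fun s hs => ?_) fun t ht => ?_
  · have hχs := E.fun_smul_mem hχ hs.1
    refine ⟨E.D_mem _ _ hχs, fun p hp => ?_, ?_⟩
    · rcases hp with hp | hp
      · rw [E.D_congr hZ₁ hχs hs.1 (hs₁ hs.2.1) hp]
        exact hs.2.2 p (hZC hp)
      · exact E.D_mem_vanishOn hZ₂ hχs (hs₂ hs.2.1) p hp
    · rw [E.D_D _ _ hχs]
      exact zero_mem _
  · rw [smul_add, E.D_add d _ (E.fun_smul_mem hχ hs.1) _ (E.fun_smul_mem hχ ht.1)]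
  · rw [smul_comm, E.D_smul d _ (E.fun_smul_mem hχ hs.1)]
  · have hχs := E.fun_smul_mem hχ hs.1
    constructor
    · rintro ⟨w, hw, hwZ, h⟩
      rw [add_sub_cancel_right] at hw
      -- If `D(χs)` equals `Dw` on `C`, then `s = (s - χs + w) + (χs - w)` splits into two sections
      -- closed on `C`, the first one zero on `Z₁` and the second one on `Z₂`. Acyclicity gives a
      -- primitive of each.
      obtain ⟨u₂, hu₂, huZ₂, hu₂'⟩ := hac₂ d (χ • s - w) (sub_mem hχs hw)
        (sub_mem (hs₂ hs.2.1) fun p hp => hwZ p (Or.inr hp)) (by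
          rw [E.D_sub hχs hw]
          exact h)
      obtain ⟨u₁, hu₁, huZ₁, hu₁'⟩ := hac₁ d (s - (χ • s - w)) (sub_mem hs.1 (sub_mem hχs hw))
        (fun p hp => by
          rw [Pi.sub_apply, Pi.sub_apply, hs₁ hs.2.1 p hp, hwZ p (Or.inl hp), sub_zero,
            sub_self]) (by
          rw [E.D_sub hs.1 (sub_mem hχs hw), E.D_sub hχs hw]
          exact sub_mem hs.2.2 h)
      refine ⟨u₁ + u₂, add_mem hu₁ hu₂,
        add_mem (fun p hp => huZ₁ p (hZZ₁ hp)) (fun p hp => huZ₂ p (hZZ₂ hp)), ?_⟩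
      rw [E.D_add _ _ hu₁ _ hu₂]
      have h3 := add_mem hu₁' hu₂'
      convert h3 using 1
      abel
    · rintro ⟨u, hu, huZ, h⟩
      have hDu := E.D_mem_sections hu
      have hχu := E.fun_smul_mem hχ hu
      have hχDu := E.fun_smul_mem hχ hDu
      have hDuZ := E.D_mem_vanishOn hZ hu huZ
      -- This is `-dχ · u`, so it vanishes on `Z₁` and `Z₂`. Its differential is `D(χ Du)`, which
      -- agrees with `D(χs)` on `C`.
      refine ⟨χ • E.D u - E.D (χ • u), ?_, fun p hp => ?_, ?_⟩
      · rw [add_sub_cancel_right]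
        exact sub_mem hχDu (E.D_mem_sections hχu)
      · rw [Pi.sub_apply]
        rcases hp with hp | hp
        · rw [hs₁ hDuZ p hp, E.D_congr hZ₁ hχu hu (hs₁ huZ) hp, sub_self]
        · rw [hs₂ hDuZ p hp, E.D_mem_vanishOn hZ₂ hχu (hs₂ huZ) p hp, sub_zero]
      · rw [E.D_sub hχDu (E.D_mem_sections hχu), E.D_D _ _ hχu, sub_zero, ← E.D_sub hχs hχDu,
          ← smul_sub]
        refine E.D_mem_vanishOn hC (E.fun_smul_mem hχ (sub_mem hs.1 hDu)) fun p hp => ?_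
        change χ p • (s - E.D u) p = 0
        rw [h p hp, smul_zero]
  · obtain ⟨u₁, hu₁, huZ₁, hu₁'⟩ := hac₁ _ t ht.1 (fun p hp => ht.2.1 p (Or.inl hp)) ht.2.2
    obtain ⟨u₂, hu₂, huZ₂, hu₂'⟩ := hac₂ _ t ht.1 (fun p hp => ht.2.1 p (Or.inr hp)) ht.2.2
    rw [add_sub_cancel_right] at hu₁ hu₂
    have hs : u₂ - u₁ ∈ E.sections d := sub_mem hu₂ hu₁
    have hsZ : u₂ - u₁ ∈ E.vanishOn Z :=
      sub_mem (fun p hp => huZ₂ p (hZZ₂ hp)) (fun p hp => huZ₁ p (hZZ₁ hp))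
    have hχs := E.fun_smul_mem hχ hs
    -- The difference of two primitives of `t` is closed on `C`. The correction `u₂ - χ(u₂ - u₁)`
    -- equals `u₁` on `Z₁` and `u₂` on `Z₂`, hence is zero on both.
    refine ⟨u₂ - u₁, ⟨hs, hsZ, ?_⟩, u₂ - χ • (u₂ - u₁), ?_, fun p hp => ?_, ?_⟩
    · rw [E.D_sub hu₂ hu₁]
      have h3 := sub_mem hu₁' hu₂'
      rwa [sub_sub_sub_cancel_left] at h3
    · rw [add_sub_cancel_right]
      exact sub_mem hu₂ hχs
    · rw [Pi.sub_apply]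
      rcases hp with hp | hp
      · rw [hs₁ hsZ p hp, Pi.sub_apply, huZ₁ p hp, sub_zero, sub_self]
      · rw [hs₂ hsZ p hp, huZ₂ p hp, sub_zero]
    · rw [E.D_sub hu₂ hχs, sub_sub, add_sub_cancel]
      exact hu₂'

end NQBundle

end MayerVietoris

/-! ### Cubes and annuli -/

section Regions

open Set

variable {n : ℕ}

lemma exists_cutoff {K O : Set (EuclideanSpace ℝ (Fin n))} (hK : IsClosed K) (hO : IsOpen O)
    (hKO : K ⊆ O) : ∃ ψ : EuclideanSpace ℝ (Fin n) → ℝ, ContDiff ℝ ∞ ψ ∧ tsupport ψ ⊆ O ∧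
      ∀ x ∈ K, ψ x = 1 := by
  obtain ⟨μ, hμ⟩ := SmoothPartitionOfUnity.exists_isSubordinate
    𝓘(ℝ, EuclideanSpace ℝ (Fin n)) hK (fun _ : Unit => O) (fun _ => hO)
    (fun x hx => mem_iUnion.2 ⟨(), hKO hx⟩)
  refine ⟨μ (), (μ ()).contMDiff.contDiff, hμ (), fun x hx => ?_⟩
  have := μ.sum_eq_one hx
  rwa [finsum_unique] at this

/-- The unit for the sizes of the cubes in the ball. -/
def cubeUnit (n : ℕ) : ℝ := (4 * (n + 1))⁻¹

lemma cubeUnit_pos (n : ℕ) : 0 < cubeUnit n := by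
  rw [cubeUnit]
  positivity

/-- The open cube with centre `0`. -/
def openCube (n : ℕ) (r : ℝ) : Set (EuclideanSpace ℝ (Fin n)) := {x | ∀ i, |x i| < r}

lemma continuous_coord (i : Fin n) : Continuous fun x : EuclideanSpace ℝ (Fin n) => x i :=
  (EuclideanSpace.proj i : EuclideanSpace ℝ (Fin n) →L[ℝ] ℝ).continuous

lemma isOpen_openCube (r : ℝ) : IsOpen (openCube n r) := by
  rw [openCube, ofPred_forall]
  exact isOpen_iInter_of_finite fun i => isOpen_lt (continuous_coord i).abs continuous_const

lemma isClosed_closedCube (r : ℝ) :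
    IsClosed {x : EuclideanSpace ℝ (Fin n) | ∀ i, |x i| ≤ r} := by
  rw [ofPred_forall]
  exact isClosed_iInter fun i => isClosed_le (continuous_coord i).abs continuous_const

/-- The bound is `n (3u)² = 9n / (16 (n + 1)²) ≤ 1` for the unit `u`. Three sizes occur: sections
are made to vanish outside size `u`, cohomology is compared on size `2u`, and the coordinate
segments exist in size `3u`, which leaves room for cutoffs. -/
lemma openCube_subset_closedBall : openCube n (3 * cubeUnit n) ⊆ Metric.closedBall 0 1 := by
  intro x hx
  rw [mem_closedBall_zero_iff, EuclideanSpace.norm_eq, Real.sqrt_le_iff]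
  refine ⟨zero_le_one, ?_⟩
  have h : ∀ i ∈ Finset.univ, ‖x i‖ ^ 2 ≤ (3 * cubeUnit n) ^ 2 := fun i _ =>
    pow_le_pow_left₀ (norm_nonneg _) (hx i).le 2
  refine (Finset.sum_le_card_nsmul _ _ _ h).trans ?_
  rw [Finset.card_univ, Fintype.card_fin, nsmul_eq_mul, cubeUnit]
  have h1 : (0 : ℝ) < n + 1 := by positivity
  rw [mul_pow, inv_pow, mul_pow]
  field_simp
  nlinarith [sq_nonneg (n : ℝ), (Nat.cast_nonneg n : (0 : ℝ) ≤ n)]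

lemma sub_smul_single_apply (x : EuclideanSpace ℝ (Fin n)) (k : Fin n) (r : ℝ) (i : Fin n) :
    (x - r • EuclideanSpace.single k (1 : ℝ)) i = if i = k then x k - r else x i := by
  rw [PiLp.sub_apply, PiLp.smul_apply, PiLp.single_apply]
  split_ifs with h
  · simp [h]
  · simp

lemma abs_convex_lt {x a r t : ℝ} (hx : |x| < r) (ha : |a| < r) (ht : t ∈ Icc (0 : ℝ) 1) :
    |x - (1 - t) * (x - a)| < r := by
  have h := (convex_Ioo (-r) r) (abs_lt.1 hx) (abs_lt.1 ha) ht.1 (sub_nonneg.2 ht.2)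
    (add_sub_cancel t 1)
  rw [smul_eq_mul, smul_eq_mul] at h
  rw [show x - (1 - t) * (x - a) = t * x + (1 - t) * a by ring, abs_lt]
  exact h

/-- The segments in the direction of a coordinate. -/
def lineRegion (k : Fin n) (a : ℝ) (ha : |a| < 2 * cubeUnit n) : BallRegion n where
  ρ x := x k - a
  V _ := EuclideanSpace.single k 1
  O := openCube n (3 * cubeUnit n)
  isOpen_O := isOpen_openCube _
  contDiff_ρ := (contDiff_piLp_apply (p := 2)).sub contDiff_const
  contDiff_V := contDiff_const
  map_mem x hx _ t ht := by
    have h : x - ((1 - t) * (x k - a)) • EuclideanSpace.single k (1 : ℝ) ∈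
        openCube n (3 * cubeUnit n) := by
      intro i
      rw [sub_smul_single_apply]
      split_ifs
      · exact abs_convex_lt (hx k) (ha.trans (by linarith [cubeUnit_pos n])) ht
      · exact hx i
    exact ⟨h, openCube_subset_closedBall h⟩
  ρ_map x _ _ t _ := by
    rw [sub_smul_single_apply, if_pos rfl]
    ring
  V_map _ _ _ _ _ := rfl
  fderiv_ρ x _ _ := by
    have h : HasFDerivAt (fun x : EuclideanSpace ℝ (Fin n) => x k - a)
        (EuclideanSpace.proj k : EuclideanSpace ℝ (Fin n) →L[ℝ] ℝ) x :=
      (EuclideanSpace.proj k : EuclideanSpace ℝ (Fin n) →L[ℝ] ℝ).hasFDerivAt.sub_const a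
    rw [h.fderiv]
    simp
  U := openCube n (2 * cubeUnit n)
  isOpen_U := isOpen_openCube _
  map_mem_U x hx _ t ht i := by
    rw [sub_smul_single_apply]
    split_ifs
    · exact abs_convex_lt (hx k) ha ht
    · exact hx i
  ψ := (exists_cutoff (isClosed_closedCube (2 * cubeUnit n)) (isOpen_openCube (3 * cubeUnit n))
    fun x hx i => (hx i).trans_lt (by linarith [cubeUnit_pos n])).choose
  contDiff_ψ := (exists_cutoff (isClosed_closedCube (2 * cubeUnit n))
    (isOpen_openCube (3 * cubeUnit n))
    fun x hx i => (hx i).trans_lt (by linarith [cubeUnit_pos n])).choose_spec.1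
  tsupport_ψ := (exists_cutoff (isClosed_closedCube (2 * cubeUnit n))
    (isOpen_openCube (3 * cubeUnit n))
    fun x hx i => (hx i).trans_lt (by linarith [cubeUnit_pos n])).choose_spec.2.1
  ψ_eq_one x hx := (exists_cutoff (isClosed_closedCube (2 * cubeUnit n))
    (isOpen_openCube (3 * cubeUnit n))
    fun x hx i => (hx i).trans_lt (by linarith [cubeUnit_pos n])).choose_spec.2.2 x
      fun i => (hx i).le

lemma lineRegion_flow_apply {k : Fin n} {a : ℝ} (ha : |a| < 2 * cubeUnit n) {b : UnitBall n}
    (hb : (b : EuclideanSpace ℝ (Fin n)) ∈ openCube n (2 * cubeUnit n)) {t : ℝ}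
    (ht : t ∈ Icc (0 : ℝ) 1) (i : Fin n) :
    ((lineRegion k a ha).flow t b : EuclideanSpace ℝ (Fin n)) i =
      if i = k then b.1 k - (1 - t) * (b.1 k - a) else b.1 i := by
  rw [(lineRegion k a ha).coe_flow ((lineRegion k a ha).U_subset hb) ht]
  exact sub_smul_single_apply _ _ _ _

end Regions

end

noncomputable section

/-! ### Radial segments -/

section Radial

open Set

variable {n : ℕ}

lemma contDiff_cutoff_mul {ψ g : EuclideanSpace ℝ (Fin n) → ℝ} {O : Set (EuclideanSpace ℝ (Fin n))}
    (hψ : ContDiff ℝ ∞ ψ) (hsupp : tsupport ψ ⊆ O)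
    (hg : ∀ x ∈ O, ContDiffAt ℝ ∞ g x) : ContDiff ℝ ∞ fun x => ψ x * g x := by
  rw [contDiff_iff_contDiffAt]
  intro x
  by_cases h : x ∈ tsupport ψ
  · exact hψ.contDiffAt.mul (hg x (hsupp h))
  · refine (contDiffAt_const (c := (0 : ℝ))).congr_of_eventuallyEq ?_
    filter_upwards [notMem_tsupport_iff_eventuallyEq.1 h] with y hy
    rw [hy, Pi.zero_apply, zero_mul]

/-- The radial segments which start at the sphere. -/
lemma exists_radialRegion (n : ℕ) {r : ℝ} (hr : 0 < r) : ∃ F : BallRegion n,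
    F.U = {x | 2 * r < ‖x‖} ∧ ∀ x, 2 * r < ‖x‖ → F.ρ x = ‖x‖ - 1 ∧ F.V x = ‖x‖⁻¹ • x := by
  -- The factor `η` makes `‖x‖` and `x / ‖x‖` smooth at the origin and is equal to one where the
  -- segments run.
  obtain ⟨η, hη, hηs, hη1⟩ := exists_cutoff (n := n) (K := {x | r ≤ ‖x‖}) (O := {x | x ≠ 0})
    (isClosed_le continuous_const continuous_norm) isOpen_ne (fun x hx => by
      rintro rfl
      rw [mem_ofPred_eq, norm_zero] at hx
      exact hx.not_gt hr)
  obtain ⟨ψ, hψ, hψs, hψ1⟩ := exists_cutoff (n := n) (K := {x | 2 * r ≤ ‖x‖}) (O := {x | r < ‖x‖})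
    (isClosed_le continuous_const continuous_norm) (isOpen_lt continuous_const continuous_norm)
    (fun x hx => by
      rw [mem_ofPred_eq] at hx ⊢
      linarith)
  have hρ : ∀ x, r < ‖x‖ → η x * ‖x‖ - 1 = ‖x‖ - 1 := fun x hx => by
    rw [hη1 x hx.le, one_mul]
  have hV : ∀ x, r < ‖x‖ → (η x * ‖x‖⁻¹) • x = ‖x‖⁻¹ • x := fun x hx => by
    rw [hη1 x hx.le, one_mul]
  -- The point with parameter `t` lies on the ray of `x` and has norm `t‖x‖ + (1 - t)` if `x` is in
  -- the ball. So segments run from the sphere inwards to `x`, and norms along them are at least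
  -- `‖x‖`.
  have hmap : ∀ x, r < ‖x‖ → ∀ t : ℝ, x - ((1 - t) * (η x * ‖x‖ - 1)) • (η x * ‖x‖⁻¹) • x =
      ((t * ‖x‖ + (1 - t)) * ‖x‖⁻¹) • x := by
    intro x hx t
    have hx0 : ‖x‖ ≠ 0 := (hr.trans hx).ne'
    rw [hρ x hx, hV x hx, smul_smul]
    nth_rewrite 1 [← one_smul ℝ x]
    rw [← sub_smul]
    congr 1
    field_simp
    ring
  have hnorm : ∀ x, r < ‖x‖ → x ∈ Metric.closedBall 0 1 → ∀ t ∈ Icc (0 : ℝ) 1,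
      ‖x - ((1 - t) * (η x * ‖x‖ - 1)) • (η x * ‖x‖⁻¹) • x‖ = t * ‖x‖ + (1 - t) := by
    intro x hx hx1 t ht
    have hx0 : 0 < ‖x‖ := hr.trans hx
    have h1 : 0 ≤ t * ‖x‖ + (1 - t) :=
      add_nonneg (mul_nonneg ht.1 hx0.le) (sub_nonneg.2 ht.2)
    rw [hmap x hx, norm_smul, Real.norm_of_nonneg (mul_nonneg h1 (inv_nonneg.2 hx0.le)), mul_assoc,
      inv_mul_cancel₀ hx0.ne', mul_one]
  have hle : ∀ x, x ∈ Metric.closedBall (0 : EuclideanSpace ℝ (Fin n)) 1 → ∀ t ∈ Icc (0 : ℝ) 1,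
      ‖x‖ ≤ t * ‖x‖ + (1 - t) ∧ t * ‖x‖ + (1 - t) ≤ 1 := by
    intro x hx t ht
    rw [mem_closedBall_zero_iff] at hx
    constructor <;> nlinarith [ht.1, ht.2, norm_nonneg x]
  refine ⟨{ ρ := fun x => η x * ‖x‖ - 1, V := fun x => (η x * ‖x‖⁻¹) • x, O := {x | r < ‖x‖}
            isOpen_O := isOpen_lt continuous_const continuous_norm
            contDiff_ρ := ?_, contDiff_V := ?_, map_mem := ?_, ρ_map := ?_, V_map := ?_
            fderiv_ρ := ?_, U := {x | 2 * r < ‖x‖}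
            isOpen_U := isOpen_lt continuous_const continuous_norm
            map_mem_U := ?_, ψ := ψ, contDiff_ψ := hψ, tsupport_ψ := hψs
            ψ_eq_one := fun x hx => hψ1 x (show 2 * r ≤ ‖x‖ from le_of_lt hx) }, rfl,
          fun x hx => ⟨hρ x (by linarith), hV x (by linarith)⟩⟩
  · exact (contDiff_cutoff_mul hη hηs fun x hx => contDiffAt_norm ℝ hx).sub
      contDiff_const
  · exact (contDiff_cutoff_mul hη hηs fun x hx =>
      (contDiffAt_norm ℝ hx).inv (norm_ne_zero_iff.2 hx)).smul contDiff_id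
  · intro x hx hx1 t ht
    rw [mem_inter_iff, mem_ofPred_eq, mem_closedBall_zero_iff, hnorm x hx hx1 t ht]
    exact ⟨lt_of_lt_of_le hx (hle x hx1 t ht).1, (hle x hx1 t ht).2⟩
  · intro x hx hx1 t ht
    have h1 := hnorm x hx hx1 t ht
    rw [hρ _ (by rw [h1]; exact lt_of_lt_of_le hx (hle x hx1 t ht).1), h1, hρ x hx]
    ring
  · intro x hx hx1 t ht
    have h1 := hnorm x hx hx1 t ht
    have hpos : r < t * ‖x‖ + (1 - t) := lt_of_lt_of_le hx (hle x hx1 t ht).1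
    rw [hV _ (by rw [h1]; exact hpos), h1, hV x hx, ← hV x hx, hmap x hx, smul_smul, ← mul_assoc,
      inv_mul_cancel₀ (hr.trans hpos).ne', one_mul]
    exact (hV x hx).symm
  · intro x hx _
    have hx0 : 0 < ‖x‖ := hr.trans hx
    have h1 : HasFDerivAt (fun y : EuclideanSpace ℝ (Fin n) => ‖y‖) (fderiv ℝ (fun y => ‖y‖) x) x :=
      ((contDiffAt_norm ℝ (norm_pos_iff.1 hx0)).differentiableAt (n := ∞) (by simp)).hasFDerivAt
    have h2 : (fun y : EuclideanSpace ℝ (Fin n) => η y * ‖y‖ - 1) =ᶠ[nhds x] fun y => ‖y‖ - 1 := by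
      filter_upwards [(isOpen_lt continuous_const continuous_norm).mem_nhds hx] with y hy
      exact hρ y hy
    rw [h2.fderiv_eq, (h1.sub_const 1).fderiv, hV x hx, map_smul]
    -- The radial derivative of the norm is found by homogeneity: `s ↦ ‖s x‖` is linear for `s > 0`.
    have h3 : HasDerivAt (fun s : ℝ => s • x) x 1 := by
      simpa using (hasDerivAt_id (1 : ℝ)).smul_const x
    have h4 : HasDerivAt (fun s : ℝ => ‖s • x‖) (fderiv ℝ (fun y => ‖y‖) x x) 1 := by
      have h5 : HasFDerivAt (fun y : EuclideanSpace ℝ (Fin n) => ‖y‖)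
        (fderiv ℝ (fun y => ‖y‖) x) ((1 : ℝ) • x) := by rwa [one_smul]
      exact h5.comp_hasDerivAt (1 : ℝ) h3
    have h6 : HasDerivAt (fun s : ℝ => ‖s • x‖) ‖x‖ 1 := by
      have h7 : HasDerivAt (fun s : ℝ => s * ‖x‖) ‖x‖ 1 := by
        simpa using (hasDerivAt_id (1 : ℝ)).mul_const ‖x‖
      refine h7.congr_of_eventuallyEq ?_
      filter_upwards [lt_mem_nhds (zero_lt_one (α := ℝ))] with s hs
      rw [norm_smul, Real.norm_of_nonneg hs.le]
    rw [h4.unique h6, smul_eq_mul, inv_mul_cancel₀ hx0.ne']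
  · intro x hx hx1 t ht
    rw [mem_ofPred_eq] at hx
    rw [mem_ofPred_eq, hnorm x (by linarith) hx1 t ht]
    exact lt_of_lt_of_le hx (hle x hx1 t ht).1

end Radial

/-! ### Cohomology of sections which vanish near the boundary of a cube -/

section Cubes

variable {EM : Type*} [NormedAddCommGroup EM] [NormedSpace ℝ EM] {H : Type*} [TopologicalSpace H]
  {I : ModelWithCorners ℝ EM H} {M : Type*} [TopologicalSpace M] [ChartedSpace H M] {n : ℕ}

/-- The points of the ball in a cube. -/
def cubeTube (M : Type*) (n : ℕ) (r : ℝ) : Set (M × UnitBall n) :=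
  {p | (p.2 : EuclideanSpace ℝ (Fin n)) ∈ openCube n r}

/-- The points of the ball outside a closed cube. -/
def offCube (M : Type*) (n : ℕ) (r : ℝ) : Set (M × UnitBall n) :=
  {p | ∃ i, r < |(p.2 : EuclideanSpace ℝ (Fin n)) i|}

/-- The points of a cube which are outside a smaller cube in one of the last coordinates. -/
def collar (M : Type*) (n k : ℕ) : Set (M × UnitBall n) :=
  {p | p ∈ cubeTube M n (2 * cubeUnit n) ∧
    ∃ i : Fin n, k ≤ i ∧ cubeUnit n < |(p.2 : EuclideanSpace ℝ (Fin n)) i|}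

/-- The points of a cube which are outside a smaller cube in one of the last coordinates, or on one
side of it in the coordinate before these. -/
def sideCollar (M : Type*) (n : ℕ) (k : Fin n) (σ : ℝ) : Set (M × UnitBall n) :=
  {p | p ∈ cubeTube M n (2 * cubeUnit n) ∧
    ((∃ i : Fin n, k + 1 ≤ (i : ℕ) ∧ cubeUnit n < |(p.2 : EuclideanSpace ℝ (Fin n)) i|) ∨
      cubeUnit n < σ * (p.2 : EuclideanSpace ℝ (Fin n)) k)}

lemma continuous_ballCoord (i : Fin n) :
    Continuous fun p : M × UnitBall n => (p.2 : EuclideanSpace ℝ (Fin n)) i :=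
  (continuous_coord i).comp (continuous_subtype_val.comp continuous_snd)

lemma isOpen_cubeTube (r : ℝ) : IsOpen (cubeTube M n r) :=
  (isOpen_openCube r).preimage (continuous_subtype_val.comp continuous_snd)

lemma isOpen_offCube (r : ℝ) : IsOpen (offCube M n r) := by
  rw [offCube, Set.ofPred_exists]
  exact isOpen_iUnion fun i => isOpen_lt continuous_const (continuous_ballCoord i).abs

lemma isOpen_exists_coord (k : ℕ) (r : ℝ) : IsOpen {p : M × UnitBall n |
    ∃ i : Fin n, k ≤ i ∧ r < |(p.2 : EuclideanSpace ℝ (Fin n)) i|} := by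
  rw [Set.ofPred_exists]
  refine isOpen_iUnion fun i => ?_
  rw [Set.ofPred_and]
  exact isOpen_const.inter (isOpen_lt continuous_const (continuous_ballCoord i).abs)

lemma isOpen_collar (k : ℕ) : IsOpen (collar M n k) :=
  (isOpen_cubeTube _).inter (isOpen_exists_coord k _)

lemma isOpen_sideCollar (k : Fin n) (σ : ℝ) : IsOpen (sideCollar M n k σ) :=
  (isOpen_cubeTube _).inter ((isOpen_exists_coord _ _).union
    (isOpen_lt continuous_const (continuous_const.mul (continuous_ballCoord k))))

/-- The coordinate `k` can exceed the unit on either side. The two parts share the conditions on the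
later coordinates, that is `collar M n (k + 1)`; they have the form required by
`relCohomology_equiv_union`. -/
lemma collar_eq_union (k : Fin n) :
    collar M n k = sideCollar M n k 1 ∪ sideCollar M n k (-1) := by
  ext p
  constructor
  · rintro ⟨hp, i, hi, h⟩
    rcases eq_or_lt_of_le hi with h1 | h1
    · obtain rfl : k = i := Fin.ext h1
      rcases lt_abs.1 h with h2 | h2
      · exact Or.inl ⟨hp, Or.inr (by linarith)⟩
      · exact Or.inr ⟨hp, Or.inr (by linarith)⟩
    · exact Or.inl ⟨hp, Or.inl ⟨i, h1, h⟩⟩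
  · rintro (⟨hp, ⟨i, hi, h⟩ | h⟩ | ⟨hp, ⟨i, hi, h⟩ | h⟩)
    · exact ⟨hp, i, by omega, h⟩
    · exact ⟨hp, k, le_rfl, lt_abs.2 (Or.inl (by linarith))⟩
    · exact ⟨hp, i, by omega, h⟩
    · exact ⟨hp, k, le_rfl, lt_abs.2 (Or.inr (by linarith))⟩

namespace NQBundle

variable {Y : NQManifold.{u} I M} (E : NQBundle.{u, v} (Y.prodBall n) (Y.prodBallQ n))
variable [FiniteDimensional ℝ EM] [IsManifold I ∞ M] [T2Space M] [SigmaCompactSpace M]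
variable {d : ℤ}

lemma relCohomology_equiv_offCube :
    Nonempty (E.relCohomology (E.vanishOn (offCube M n (cubeUnit n))) ⊥ d ≃ₗ[ℝ]
      E.relCohomology (E.vanishOn (collar M n 0))
        (E.vanishOn (cubeTube M n (2 * cubeUnit n))) d) := by
  have hc := cubeUnit_pos n
  obtain ⟨β, hβ, hβs, hβ1⟩ := exists_cutoff (isClosed_closedCube (n := n) (3 / 2 * cubeUnit n))
    (isOpen_openCube (2 * cubeUnit n)) fun x hx i => (hx i).trans_lt (by linarith)
  have h : collar M n 0 = cubeTube M n (2 * cubeUnit n) ∩ offCube M n (cubeUnit n) := by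
    ext p
    exact ⟨fun ⟨hp, i, _, h⟩ => ⟨hp, i, h⟩, fun ⟨hp, i, h⟩ => ⟨hp, i, Nat.zero_le _, h⟩⟩
  rw [h]
  -- Any size strictly between one and two units works: this cube and the complement of the unit
  -- cube cover the ball, and a cutoff can fall to zero before the cube of two units ends.
  refine E.relCohomology_equiv_excision (N := cubeTube M n (3 / 2 * cubeUnit n))
    (isOpen_offCube _) (isOpen_cubeTube _) (fun p hp i => (hp i).trans (by linarith)) (fun p => ?_)
    (contMDiff_ballFun hβ) (fun p hp => hβ1 _ fun i => (hp i).le) fun p hp => ?_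
  · by_cases hp : p ∈ offCube M n (cubeUnit n)
    · exact Or.inl hp
    · refine Or.inr fun i => lt_of_le_of_lt (not_lt.1 fun h => hp ⟨i, h⟩) (by linarith)
  · exact image_eq_zero_of_notMem_tsupport fun h' => hp (hβs h')

variable [I.Boundaryless]

/-- The segments start at `x_k = σ · 3/2 u`, with `u` the unit. This hyperplane lies in the part of
the collar on the side `σ`, where the section vanishes, and meets the cube of size `2u`. By
convexity the segments of points on this side stay there, and the other coordinates do not move. -/
lemma exists_primitive_sideCollar (k : Fin n) {σ : ℝ} (hσ : σ * σ = 1) {s : ∀ p, E.fib p}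
    (hs : s ∈ E.sections d) (hsZ : s ∈ E.vanishOn (sideCollar M n k σ))
    (hDs : E.D s ∈ E.vanishOn (cubeTube M n (2 * cubeUnit n))) :
    ∃ u ∈ E.sections (d - 1), u ∈ E.vanishOn (sideCollar M n k σ) ∧
      s - E.D u ∈ E.vanishOn (cubeTube M n (2 * cubeUnit n)) := by
  have hc := cubeUnit_pos n
  have ha : |σ * (3 / 2 * cubeUnit n)| < 2 * cubeUnit n := by
    have h1 : |σ| = 1 := by
      rcases mul_self_eq_one_iff.1 hσ with rfl | rfl <;> simp
    rw [abs_mul, h1, one_mul, abs_of_pos (by linarith)]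
    linarith
  have hσa : σ * (σ * (3 / 2 * cubeUnit n)) = 3 / 2 * cubeUnit n := by
    rw [← mul_assoc, hσ, one_mul]
  refine E.exists_primitive_of_vanishOn (lineRegion k _ ha) (isOpen_sideCollar k σ)
    (fun p hp => hp.1) (fun p hp t ht => ⟨(lineRegion k _ ha).flow_mem_U hp.1 ht, ?_⟩)
    (fun p hp => ⟨(lineRegion k _ ha).flow_mem_U hp (Set.left_mem_Icc.2 zero_le_one), Or.inr ?_⟩)
    hs hsZ hDs
  · rcases hp.2 with ⟨i, hi, h⟩ | h
    · refine Or.inl ⟨i, hi, ?_⟩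
      rw [lineRegion_flow_apply ha hp.1 ht, if_neg (by rintro rfl; omega)]
      exact h
    · refine Or.inr ?_
      rw [lineRegion_flow_apply ha hp.1 ht, if_pos rfl]
      have h1 : σ * (p.2.1 k - (1 - t) * (p.2.1 k - σ * (3 / 2 * cubeUnit n))) =
          t * (σ * p.2.1 k) + (1 - t) * (3 / 2 * cubeUnit n) := by
        linear_combination (1 - t) * hσa
      rw [h1]
      have h2 := (convex_Ioi (cubeUnit n)) h (show (3 / 2 * cubeUnit n) ∈ Set.Ioi (cubeUnit n) by
        rw [Set.mem_Ioi]; linarith) ht.1 (sub_nonneg.2 ht.2) (add_sub_cancel t 1)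
      exact h2
  · rw [lineRegion_flow_apply ha hp (Set.left_mem_Icc.2 zero_le_one), if_pos rfl, sub_zero,
      one_mul, sub_sub_cancel, hσa]
    linarith

/-- The cutoff depends on `x_k` only: it is one for `x_k` at least the unit and zero for `x_k ≤ 0`,
so it separates the two sides. Both side collars are acyclic, and the connecting map raises the
degree by one. -/
lemma relCohomology_equiv_collar (k : Fin n) :
    Nonempty (E.relCohomology (E.vanishOn (collar M n (k + 1)))
        (E.vanishOn (cubeTube M n (2 * cubeUnit n))) d ≃ₗ[ℝ]
      E.relCohomology (E.vanishOn (collar M n k))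
        (E.vanishOn (cubeTube M n (2 * cubeUnit n))) (d + 1)) := by
  have hc := cubeUnit_pos n
  rw [collar_eq_union]
  have hχ : ContDiff ℝ ∞ fun x : EuclideanSpace ℝ (Fin n) =>
      Real.smoothTransition (x k * (cubeUnit n)⁻¹) :=
    Real.smoothTransition.contDiff.comp ((contDiff_piLp_apply (p := 2)).mul contDiff_const)
  refine E.relCohomology_equiv_union (isOpen_cubeTube _) (isOpen_collar _) (isOpen_sideCollar _ _)
    (isOpen_sideCollar _ _) (fun p hp => ⟨hp.1, Or.inl hp.2⟩) (fun p hp => ⟨hp.1, Or.inl hp.2⟩)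
    (fun p hp => hp.1) (contMDiff_ballFun hχ) (fun p hp => ?_) (fun p hp => ?_)
    (fun d s hs h h' => E.exists_primitive_sideCollar k (by norm_num) hs h h')
    (fun d s hs h h' => E.exists_primitive_sideCollar k (by norm_num) hs h h')
  · rcases hp.2 with h | h
    · exact Or.inl ⟨hp.1, h⟩
    · refine Or.inr (Real.smoothTransition.one_of_one_le ?_)
      rw [one_mul] at h
      rw [← div_eq_mul_inv, one_le_div hc]
      exact h.le
  · rcases hp.2 with h | h
    · exact Or.inl ⟨hp.1, h⟩
    · refine Or.inr (Real.smoothTransition.zero_of_nonpos ?_)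
      exact mul_nonpos_of_nonpos_of_nonneg (by linarith) (inv_nonneg.2 hc.le)

lemma relCohomology_equiv_collar_zero :
    Nonempty (E.relCohomology ⊤ (E.vanishOn (cubeTube M n (2 * cubeUnit n))) d ≃ₗ[ℝ]
      E.relCohomology (E.vanishOn (collar M n 0))
        (E.vanishOn (cubeTube M n (2 * cubeUnit n))) (d + n)) := by
  have key : ∀ j k : ℕ, j + k = n →
      Nonempty (E.relCohomology ⊤ (E.vanishOn (cubeTube M n (2 * cubeUnit n))) d ≃ₗ[ℝ]
        E.relCohomology (E.vanishOn (collar M n k))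
          (E.vanishOn (cubeTube M n (2 * cubeUnit n))) (d + j)) := by
    intro j
    induction j with
    | zero =>
      intro k hk
      -- Here `k = n`, so no coordinate has index at least `k`: the collar is empty and nothing has
      -- to vanish.
      have h : E.vanishOn (collar M n k) = ⊤ := by
        refine eq_top_iff.2 fun s _ p hp => ?_
        obtain ⟨-, i, hi, -⟩ := hp
        exact absurd i.2 (by omega)
      rw [h, Nat.cast_zero, add_zero]
      exact ⟨LinearEquiv.refl _ _⟩
    | succ j ih =>
      intro k hk
      obtain ⟨e⟩ := ih (k + 1) (by omega)
      obtain ⟨e'⟩ := E.relCohomology_equiv_collar (d := d + j) ⟨k, by omega⟩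
      rw [show d + (j + 1 : ℕ) = d + j + 1 by push_cast; ring]
      exact ⟨e.trans e'⟩
  exact key n 0 (add_zero n)

end NQBundle

end Cubes

end

/-! ### Sections which vanish on the sphere -/

noncomputable section

/-- Modulo `ξ` the map `f` is the identity, so the induced map changes a form only by multiples of
`ξ`, and these are killed by the product with `ξ`. -/
lemma ExteriorAlgebra.ι_mul_map {R V : Type*} [CommRing R] [AddCommGroup V] [Module R V] (ξ : V)
    (f : V →ₗ[R] V) (hf : ∀ v, ∃ r : R, f v = v + r • ξ) (x : ExteriorAlgebra R V) :
    ι R ξ * map f x = ι R ξ * x := by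
  have hswap : ∀ v : V, ι R ξ * ι R v = -(ι R v * ι R ξ) := fun v =>
    eq_neg_of_add_eq_zero_left (by rw [← ι_add_mul_swap ξ v])
  induction x using CliffordAlgebra.left_induction with
  | algebraMap r =>
    congr 1
    exact (map f).commutes r
  | add x y hx hy => rw [map_add, mul_add, mul_add, hx, hy]
  | ι_mul x v hx =>
    obtain ⟨r, hr⟩ := hf v
    change ι R ξ * map f (ι R v * x) = ι R ξ * (ι R v * x)
    rw [map_mul, map_apply_ι, ← mul_assoc, hswap, neg_mul, mul_assoc, hx, ← mul_assoc, ← neg_mul,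
      ← hswap, hr, map_add, map_smul, mul_add, mul_smul_comm, ι_sq_zero, smul_zero, add_zero,
      mul_assoc]

section Sphere

variable {EM : Type*} [NormedAddCommGroup EM] [NormedSpace ℝ EM] {H : Type*} [TopologicalSpace H]
  {I : ModelWithCorners ℝ EM H} {M : Type*} [TopologicalSpace M] [ChartedSpace H M] {n : ℕ}

/-- The product with a covector. -/
def NManifold.covectorMul (Y : NManifold.{u} I M) (p : M × UnitBall n)
    (ξ : Module.Dual ℝ (EuclideanSpace ℝ (Fin n))) :
    (Y.prodBall n).fib p →ₗ[ℝ] (Y.prodBall n).fib p :=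
  (GradedTensorProduct.of ℝ (Y.gr p.1) (Covectors.gr n)).toLinearMap ∘ₗ
    TensorProduct.map (parityMap (Y.gr p.1)) (LinearMap.mulLeft ℝ (ExteriorAlgebra.ι ℝ ξ)) ∘ₗ
      (GradedTensorProduct.of ℝ (Y.gr p.1) (Covectors.gr n)).symm.toLinearMap

lemma NManifold.covectorMul_apply (Y : NManifold.{u} I M) {p : M × UnitBall n}
    (ξ : Module.Dual ℝ (EuclideanSpace ℝ (Fin n))) (a : (Y.prodBall n).fib p) :
    Y.covectorMul p ξ a = Y.form n p 1 (ExteriorAlgebra.ι ℝ ξ) * a := by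
  induction a using Y.form_induction with
  | zero => rw [mul_zero, map_zero]
  | add b b' h h' => rw [mul_add, map_add, h, h']
  | form k a ha j x hx =>
    have h1 : ExteriorAlgebra.ι ℝ ξ ∈ Covectors.gr n 1 := by
      simp [Covectors.gr, ExteriorAlgebra.exteriorPower]
    rw [Y.form_mul n _ h1 ha, one_mul, one_mul, ← NManifold.form_smul_left, ← parityMap_of_mem _ ha]
    rfl

/-- The product with the conormal form of a hyperplane only depends on the restriction to this
hyperplane. -/
lemma NManifold.form_ι_mul_eq_zero (Y : NManifold.{u} I M) {p : M × UnitBall n}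
    {b : EuclideanSpace ℝ (Fin n)} (hb : ‖b‖ = 1)
    {a : (Y.prodBall n).fib p} (ha : Y.restrictCovectors n (ℝ ∙ b)ᗮ p a = 0) :
    Y.form n p 1 (ExteriorAlgebra.ι ℝ (innerSL ℝ b).toLinearMap) * a = 0 := by
  set ξ : Module.Dual ℝ (EuclideanSpace ℝ (Fin n)) := (innerSL ℝ b).toLinearMap with hξ
  set W : Submodule ℝ (EuclideanSpace ℝ (Fin n)) := (ℝ ∙ b)ᗮ with hW
  -- Restricting a covector to `W` and pulling it back along the orthogonal projection changes it
  -- only by a multiple of the conormal `ξ`. So `ξ ∧ x` can be recovered from the restriction of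
  -- `x`.
  let π : EuclideanSpace ℝ (Fin n) →ₗ[ℝ] W := W.orthogonalProjectionOnto.toLinearMap
  have hπ : ∀ v : EuclideanSpace ℝ (Fin n), (π v : EuclideanSpace ℝ (Fin n)) =
      v - inner ℝ b v • b := by
    intro v
    have h1 := Submodule.starProjection_orthogonal_val (𝕜 := ℝ) (K := ℝ ∙ b) v
    have h2 := Submodule.starProjection_unit_singleton ℝ hb v
    rw [h2] at h1
    exact h1
  have hf : ∀ ψ : Module.Dual ℝ (EuclideanSpace ℝ (Fin n)), ∃ r : ℝ,
      (π.dualMap ∘ₗ W.subtype.dualMap) ψ = ψ + r • ξ := by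
    intro ψ
    refine ⟨-ψ b, LinearMap.ext fun v => ?_⟩
    change ψ (π v : EuclideanSpace ℝ (Fin n)) = ψ v + -ψ b * inner ℝ b v
    rw [hπ, map_sub, map_smul, smul_eq_mul]
    ring
  have h2 : LinearMap.mulLeft ℝ (ExteriorAlgebra.ι ℝ ξ) =
      (LinearMap.mulLeft ℝ (ExteriorAlgebra.ι ℝ ξ) ∘ₗ
        (ExteriorAlgebra.map π.dualMap).toLinearMap) ∘ₗ
        (ExteriorAlgebra.map W.subtype.dualMap).toLinearMap := by
    refine LinearMap.ext fun x => ?_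
    have h3 := ExteriorAlgebra.ι_mul_map ξ _ hf x
    rw [← ExteriorAlgebra.map_comp_map] at h3
    exact h3.symm
  have h4 : parityMap (Y.gr p.1) = parityMap (Y.gr p.1) ∘ₗ LinearMap.id := rfl
  rw [← Y.covectorMul_apply, NManifold.covectorMul, h2, h4, TensorProduct.map_comp]
  let T := TensorProduct.map (parityMap (Y.gr p.1))
    (LinearMap.mulLeft ℝ (ExteriorAlgebra.ι ℝ ξ) ∘ₗ (ExteriorAlgebra.map π.dualMap).toLinearMap)
  exact (congrArg (GradedTensorProduct.of ℝ (Y.gr p.1) (Covectors.gr n))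
    ((congrArg T ha).trans (map_zero T))).trans (map_zero _)

/-- A homogeneous function commutes up to sign with each homogeneous component of `b`, so the
vectors which it annihilates form a submodule. -/
lemma NBundle.smul_smul_eq_zero {P : NManifold.{u} I M} {E : NBundle.{u, v} P} {m : M} {k : ℕ}
    {a : P.fib m} (ha : a ∈ P.gr m k) {x : E.fib m} (hx : a • x = 0) (b : P.fib m) :
    a • b • x = 0 := by
  induction b using DirectSum.Decomposition.inductionOn (P.gr m) with
  | zero => rw [zero_smul, smul_zero]
  | add b b' h h' => rw [add_smul, smul_add, h, h', add_zero]
  | homogeneous b => rw [← mul_smul, P.gcomm m _ _ a ha _ b.2, smul_assoc, mul_smul, hx, smul_zero,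
      smul_zero]

namespace NQBundle

variable {Y : NQManifold.{u} I M} (E : NQBundle.{u, v} (Y.prodBall n) (Y.prodBallQ n))

lemma bodyDiff_ballFun {f : EuclideanSpace ℝ (Fin n) → ℝ} (hf : ContDiff ℝ ∞ f)
    (p : M × UnitBall n) : Y.bodyDiff n (fun p => f p.2) p =
      Y.form n p 1 (ExteriorAlgebra.ι ℝ (fderiv ℝ f p.2 : Module.Dual ℝ _)) := by
  rw [Y.bodyDiff_eq n (contMDiff_ballFun hf), ballDeriv_ballFun hf, NManifold.oneForm,
    show Y.Q (fun m => f (m, p.2).2 • 1) = 0 from Y.Q_const_smul_one (f p.2)]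
  have h : Y.form n p ((0 : ∀ m, Y.fib m) p.1) 1 = 0 := TensorProduct.zero_tmul _ _
  rw [h, zero_add]

/-- At the sphere `dρ` is the conormal form, and a form which vanishes on tangent vectors of the
sphere has zero product with it. This turns the condition of vanishing on `T[1]Sⁿ⁻¹` into the
equation `dρ · s = 0`. -/
lemma bodyDiff_smul_of_mem_sphereIdeal {f : EuclideanSpace ℝ (Fin n) → ℝ} (hf : ContDiff ℝ ∞ f)
    {p : M × UnitBall n} (hp : ‖(p.2 : EuclideanSpace ℝ (Fin n))‖ = 1)
    (hf' : f =ᶠ[nhds (p.2 : EuclideanSpace ℝ (Fin n))] fun x => ‖x‖ - 1) {x : E.fib p}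
    (hx : x ∈ E.sphereIdeal p) : Y.bodyDiff n (fun p => f p.2) p • x = 0 := by
  have h1 : fderiv ℝ f p.2 = innerSL ℝ (p.2 : EuclideanSpace ℝ (Fin n)) := by
    -- The derivative is found by comparing `(f + 1)²` with `‖x‖²`, whose derivative is linear; at
    -- the sphere `f + 1 = 1`.
    have h2 : HasFDerivAt f (fderiv ℝ f p.2) p.2 := (hf.differentiable (by simp) _).hasFDerivAt
    have h3 := ((h2.add_const 1).pow 2).congr_of_eventuallyEq
      (f₁ := fun x : EuclideanSpace ℝ (Fin n) => ‖x‖ ^ 2) (by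
        filter_upwards [hf'] with x hx
        rw [hx, sub_add_cancel])
    have h4 := h3.unique (hasStrictFDerivAt_norm_sq (p.2 : EuclideanSpace ℝ (Fin n))).hasFDerivAt
    rw [show f p.2 = 0 by rw [hf'.self_of_nhds]; exact sub_eq_zero.2 hp] at h4
    ext v
    have h5 := DFunLike.congr_fun h4 v
    simp at h5
    simpa using h5
  rw [bodyDiff_ballFun hf, h1]
  refine Submodule.span_induction (p := fun x _ => Y.form n p 1 (ExteriorAlgebra.ι ℝ
    (innerSL ℝ (p.2 : EuclideanSpace ℝ (Fin n))).toLinearMap) • x = 0) ?_ ?_ ?_ ?_ hx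
  · rintro _ ⟨a, t, ha, rfl⟩
    rw [← mul_smul, Y.form_ι_mul_eq_zero hp ha, zero_smul]
  · exact smul_zero _
  · intro x y _ _ hx hy
    rw [smul_add, hx, hy, add_zero]
  · intro a x _ hx
    exact NBundle.smul_smul_eq_zero (tensorGr.tmul_mem (Y.gr p.1) (Covectors.gr n) (zero_add 1)
      SetLike.GradedOne.one_mem (by simp [Covectors.gr, ExteriorAlgebra.exteriorPower])) hx a

lemma offCube_of_norm_eq_one {p : M × UnitBall n} (hp : ‖(p.2 : EuclideanSpace ℝ (Fin n))‖ = 1) :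
    p ∈ offCube M n (cubeUnit n) := by
  by_contra h
  have hc := cubeUnit_pos n
  -- If all coordinates were at most the unit, twice the point would still lie in the cube of three
  -- units and hence in the ball, which contradicts norm one.
  have h1 : (2 : ℝ) • (p.2 : EuclideanSpace ℝ (Fin n)) ∈ openCube n (3 * cubeUnit n) := by
    intro i
    have h2 : ¬cubeUnit n < |(p.2 : EuclideanSpace ℝ (Fin n)) i| := fun h' => h ⟨i, h'⟩
    rw [PiLp.smul_apply, smul_eq_mul, abs_mul, abs_two]
    linarith [not_lt.1 h2]
  have h3 := openCube_subset_closedBall h1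
  rw [mem_closedBall_zero_iff, norm_smul, hp] at h3
  norm_num at h3

lemma D_fun_smul_apply {χ : M × UnitBall n → ℝ}
    (hχ : ContMDiff (I.prod (UnitBall.model n)) 𝓘(ℝ, ℝ) ∞ χ) {d : ℤ} {s : ∀ p, E.fib p}
    (hs : s ∈ E.sections d) (p : M × UnitBall n) :
    E.D (χ • s) p = Y.bodyDiff n χ p • s p + χ p • E.D s p :=
  congrFun (E.D_fun_smul hχ hs) p

variable [FiniteDimensional ℝ EM] [IsManifold I ∞ M] [T2Space M] [SigmaCompactSpace M]
lemma contract_bodyDiff_smul {χ : M × UnitBall n → ℝ}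
    (hχ : ContMDiff (I.prod (UnitBall.model n)) 𝓘(ℝ, ℝ) ∞ χ) (p : M × UnitBall n)
    (v : EuclideanSpace ℝ (Fin n)) (x : E.fib p) :
    E.contract p v (Y.bodyDiff n χ p • x) =
      ballDeriv χ p v • x - Y.bodyDiff n χ p • E.contract p v x := by
  rw [Y.bodyDiff_eq n hχ]
  exact E.contract_oneForm_smul p v (Y.Q_smul_one_mem hχ p) _ _

/-- A radial region reaching the sphere. -/
structure IsRadial (F : BallRegion n) (r : ℝ) : Prop where
  pos : 0 < r
  mem_U : ∀ x, x ∈ F.U ↔ r < ‖x‖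
  ρ_eq : ∀ x, r < ‖x‖ → F.ρ x = ‖x‖ - 1
  V_eq : ∀ x, r < ‖x‖ → F.V x = ‖x‖⁻¹ • x

namespace IsRadial

variable {F : BallRegion n} {r : ℝ} (hF : IsRadial F r)

include hF in
lemma norm_flow_zero {b : UnitBall n} (hb : (b : EuclideanSpace ℝ (Fin n)) ∈ F.U) :
    ‖(F.flow 0 b : EuclideanSpace ℝ (Fin n))‖ = 1 := by
  have h0 := F.ρ_flow_zero hb
  have h1 := F.flow_mem_U hb (Set.left_mem_Icc.2 zero_le_one)
  rw [hF.ρ_eq _ ((hF.mem_U _).1 h1)] at h0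
  linarith

include hF in
-- Points of a radial segment are multiples of its inner end by a factor at least one. Hence
-- segments of points outside the cube remain outside, and conditions imposed only there can be
-- transported.
lemma abs_le_abs_flow {b : UnitBall n} (hb : (b : EuclideanSpace ℝ (Fin n)) ∈ F.U) {t : ℝ}
    (ht : t ∈ Set.Icc (0 : ℝ) 1) (i : Fin n) :
    |(b : EuclideanSpace ℝ (Fin n)) i| ≤ |(F.flow t b : EuclideanSpace ℝ (Fin n)) i| := by
  have hb' := (hF.mem_U _).1 hb
  have hpos : 0 < ‖(b : EuclideanSpace ℝ (Fin n))‖ := hF.pos.trans hb'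
  have hb1 : ‖(b : EuclideanSpace ℝ (Fin n))‖ ≤ 1 := mem_closedBall_zero_iff.1 b.2
  rw [F.coe_flow (F.U_subset hb) ht, hF.ρ_eq _ hb', hF.V_eq _ hb', PiLp.sub_apply,
    PiLp.smul_apply, PiLp.smul_apply, smul_eq_mul, smul_eq_mul]
  have h3 : b.1 i - (1 - t) * (‖b.1‖ - 1) * (‖b.1‖⁻¹ * b.1 i) =
      (1 + (1 - t) * (1 - ‖b.1‖) * ‖b.1‖⁻¹) * b.1 i := by ring
  rw [h3, abs_mul]
  have h4 : 0 ≤ (1 - t) * (1 - ‖b.1‖) * ‖b.1‖⁻¹ :=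
    mul_nonneg (mul_nonneg (sub_nonneg.2 ht.2) (sub_nonneg.2 hb1)) (inv_nonneg.2 hpos.le)
  refine le_mul_of_one_le_left (abs_nonneg _) (le_trans ?_ (le_abs_self _))
  linarith

end IsRadial

variable [I.Boundaryless] {d : ℤ}
variable {F : BallRegion n} (hF : IsRadial F (cubeUnit n)) {s : ∀ p, E.fib p}

include hF in
lemma offCube_subset_tube : offCube M n (cubeUnit n) ⊆ F.tube M := by
  rintro p ⟨i, hi⟩
  exact (hF.mem_U _).2 (hi.trans_le (PiLp.norm_apply_le (p.2 : EuclideanSpace ℝ (Fin n)) i))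

include hF in
lemma ρ_eq_zero_of_norm {p : M × UnitBall n} (hp : ‖(p.2 : EuclideanSpace ℝ (Fin n))‖ = 1) :
    F.ρ p.2 = 0 := by
  rw [hF.ρ_eq _ ((hF.mem_U _).1 (offCube_subset_tube hF (offCube_of_norm_eq_one hp))), hp, sub_self]

include hF in
/-- A section of the subcomplex is cohomologous to one which vanishes at the points of the
sphere. -/
lemma sub_D_ρ_smul_eq_zero (hs : s ∈ E.sections d) (hsS : s ∈ E.vanishOnSphere)
    {p : M × UnitBall n} (hp : ‖(p.2 : EuclideanSpace ℝ (Fin n))‖ = 1) :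
    (s - E.D ((fun p : M × UnitBall n => F.ρ p.2) • E.flowK F s)) p = 0 := by
  have hU : (p.2 : EuclideanSpace ℝ (Fin n)) ∈ F.U :=
    offCube_subset_tube hF (offCube_of_norm_eq_one hp)
  -- On the sphere `ρ = 0`, so `D(ρ ιs) = dρ · ιs`. Since `dρ · s = 0` and `V(ρ) = 1`, the
  -- contraction rule gives `0 = ι(dρ · s) = s - dρ · ιs`.
  have h2 := E.contract_bodyDiff_smul F.contMDiff_ρ p (F.V p.2) (s p)
  rw [E.bodyDiff_smul_of_mem_sphereIdeal F.contDiff_ρ hp ?_ (hsS p hp), map_zero,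
    ballDeriv_ballFun F.contDiff_ρ, F.fderiv_ρ _ (F.U_subset hU) p.2.2, one_smul] at h2
  · rw [Pi.sub_apply, E.D_fun_smul_apply F.contMDiff_ρ (E.flowK_mem F hs), ρ_eq_zero_of_norm hF hp,
      zero_smul, add_zero]
    exact h2.symm
  · filter_upwards [F.isOpen_U.mem_nhds hU] with x hx
    exact hF.ρ_eq x ((hF.mem_U x).1 hx)

include hF in
-- The Poincaré argument with the sphere as initial hypersurface. For `w = ρ w'` one has `Dw = dρ ·
-- w' + ρ Dw'`, and on the sphere `w' = s = 0`; so `Dw` vanishes there and then along every segment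
-- outside the cube, where `Ds = 0`.
lemma exists_primitive_of_radial (hs : s ∈ E.sections d)
    (hsS : ∀ p : M × UnitBall n, ‖(p.2 : EuclideanSpace ℝ (Fin n))‖ = 1 → s p = 0)
    (hDs : E.D s ∈ E.vanishOn (offCube M n (cubeUnit n))) :
    ∃ u ∈ E.sections (d - 1),
      (∀ p : M × UnitBall n, ‖(p.2 : EuclideanSpace ℝ (Fin n))‖ = 1 → u p = 0) ∧
      s - E.D u ∈ E.vanishOn (offCube M n (cubeUnit n)) := by
  have hsub := offCube_subset_tube (M := M) hF
  obtain ⟨w', hw', hL, hw'0⟩ := E.exists_flow_primitive F hs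
  have hw := E.fun_smul_mem F.contMDiff_ρ hw'
  have hDw : E.D ((fun p : M × UnitBall n => F.ρ p.2) • w') ∈
      E.vanishOn (offCube M n (cubeUnit n)) := by
    rintro ⟨m, b⟩ hp
    have hb : (b : EuclideanSpace ℝ (Fin n)) ∈ F.U := hsub hp
    refine E.eq_zero_of_flowD_eq_zero F.toBallFlow (E.D_mem d _ hw) (F.U_subset hb) ?_
      fun t ht => ?_
    · rw [E.D_fun_smul_apply F.contMDiff_ρ hw', hw'0 (m, F.flow 0 b)
        (F.flow_mem_U hb (Set.left_mem_Icc.2 zero_le_one)) (F.ρ_flow_zero hb),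
        hsS (m, F.flow 0 b) (hF.norm_flow_zero hb), smul_zero, zero_add, F.ρ_flow_zero hb,
        zero_smul]
    · have hbt : (m, F.flow t b) ∈ F.tube M := F.flow_mem_U hb ht
      rw [E.flowD_D_eq F hw hs hL hbt]
      obtain ⟨i, hi⟩ := hp
      exact hDs _ ⟨i, hi.trans_le (hF.abs_le_abs_flow hb ht i)⟩
  refine ⟨_, E.flowK_mem F hw, fun p hp => ?_, fun p hp => ?_⟩
  · rw [contractField_apply]
    change E.contract p _ (F.ρ p.2 • w' p) = 0
    rw [ρ_eq_zero_of_norm hF hp, zero_smul, map_zero]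
  · have h1 := hL p (hsub hp)
    rw [flowD, lieD, Pi.add_apply, E.contractField_mem_vanishOn _ hDw p hp, add_zero] at h1
    rw [Pi.sub_apply, h1, sub_self]

/-- The sections which vanish on the sphere are cohomologous to sections which vanish outside a
cube. -/
lemma exists_primitive_vanishOnSphere (hs : s ∈ E.sections d)
    (hsS : s ∈ E.vanishOnSphere) (hDs : E.D s ∈ E.vanishOn (offCube M n (cubeUnit n))) :
    ∃ u ∈ E.sections (d - 1), u ∈ E.vanishOnSphere ∧
      s - E.D u ∈ E.vanishOn (offCube M n (cubeUnit n)) := by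
  -- Half the unit is used so that the region is where the norm exceeds the unit. It contains the
  -- complement of the cube, because the norm dominates each coordinate.
  obtain ⟨F, hU, hF'⟩ := exists_radialRegion n (half_pos (cubeUnit_pos n))
  rw [mul_div_cancel₀ _ (two_ne_zero)] at hU hF'
  have hF : IsRadial F (cubeUnit n) := ⟨cubeUnit_pos n, fun x => by rw [hU]; rfl,
    fun x hx => (hF' x hx).1, fun x hx => (hF' x hx).2⟩
  have hρK := E.fun_smul_mem F.contMDiff_ρ (E.flowK_mem F hs)
  have hDρK := E.D_mem_sections hρK
  obtain ⟨u, hu, huS, h⟩ := E.exists_primitive_of_radial hF (sub_mem hs hDρK)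
    (fun p hp => E.sub_D_ρ_smul_eq_zero hF hs hsS hp) (by
      rwa [E.D_sub hs hDρK, E.D_D _ _ hρK, sub_zero])
  refine ⟨_, add_mem hρK hu, fun p hp => ?_, ?_⟩
  · have h1 : ((fun p : M × UnitBall n => F.ρ p.2) • E.flowK F s + u) p = 0 := by
      rw [Pi.add_apply, huS p hp, add_zero]
      change F.ρ p.2 • E.flowK F s p = 0
      rw [ρ_eq_zero_of_norm hF hp, zero_smul]
    rw [h1]
    exact zero_mem _
  · rwa [E.D_add _ _ hρK _ hu, ← sub_sub]

lemma relCohomology_equiv_sphere :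
    Nonempty (E.relCohomology (E.vanishOn (offCube M n (cubeUnit n))) ⊥ d ≃ₗ[ℝ]
      E.relCohomology E.vanishOnSphere ⊥ d) :=
  E.relCohomology_equiv_left (fun s hs p hp => by
    rw [hs p (offCube_of_norm_eq_one hp)]
    exact zero_mem _) fun _ _ hs hsS hDs => E.exists_primitive_vanishOnSphere hs hsS hDs

end NQBundle

end Sphere

end

noncomputable section

/-! ### Restriction to coordinate subspaces -/

section Coordinates

variable {EM : Type*} [NormedAddCommGroup EM] [NormedSpace ℝ EM] {H : Type*} [TopologicalSpace H]
  {I : ModelWithCorners ℝ EM H} {M : Type*} [TopologicalSpace M] [ChartedSpace H M] {n : ℕ}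

lemma contMDiff_ballCoord (i : Fin n) : ContMDiff (I.prod (UnitBall.model n)) 𝓘(ℝ, ℝ) ∞
    fun p : M × UnitBall n => (p.2 : EuclideanSpace ℝ (Fin n)) i :=
  contMDiff_ballFun (contDiff_piLp_apply (p := 2))

lemma ballDeriv_ballCoord (i : Fin n) (p : M × UnitBall n) (v : EuclideanSpace ℝ (Fin n)) :
    ballDeriv (fun p : M × UnitBall n => (p.2 : EuclideanSpace ℝ (Fin n)) i) p v = v i := by
  rw [ballDeriv_ballFun (contDiff_piLp_apply (p := 2))]
  exact congrArg (· v) (EuclideanSpace.proj i : EuclideanSpace ℝ (Fin n) →L[ℝ] ℝ).fderiv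

namespace NQManifold

variable (Y : NQManifold.{u} I M)

/-- The differential of a coordinate of the ball. -/
def coordForm (i : Fin n) : ∀ p, (Y.prodBall n).fib p :=
  Y.bodyDiff n fun p => (p.2 : EuclideanSpace ℝ (Fin n)) i

/-- The product of the differentials of some coordinates of the ball. -/
def coordProd : List (Fin n) → ∀ p, (Y.prodBall n).fib p
  | [] => 1
  | i :: l => coordProd l * Y.coordForm i

lemma coordProd_nil_smul {E : NBundle.{u, v} (Y.prodBall n)} (s : ∀ p, E.fib p) :
    Y.coordProd (n := n) [] • s = s :=
  funext fun p => one_smul ((Y.prodBall n).fib p) (s p)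

lemma coordProd_cons_smul {E : NBundle.{u, v} (Y.prodBall n)} (i : Fin n) (l : List (Fin n))
    (s : ∀ p, E.fib p) : Y.coordProd (i :: l) • s = Y.coordProd l • Y.coordForm i • s :=
  funext fun _ => mul_smul _ _ _

lemma coordProd_cons_smul_apply {E : NBundle.{u, v} (Y.prodBall n)} (i : Fin n) (l : List (Fin n))
    {p : M × UnitBall n} (x : E.fib p) :
    Y.coordProd (i :: l) p • x = Y.coordProd l p • Y.coordForm i p • x := mul_smul _ _ _

lemma coordProd_mem (l : List (Fin n)) (p : M × UnitBall n) :
    Y.coordProd l p ∈ (Y.prodBall n).gr p l.length := by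
  induction l with
  | nil => exact SetLike.GradedOne.one_mem
  | cons i l ih => exact SetLike.GradedMul.mul_mem ih (Y.bodyDiff_mem (contMDiff_ballCoord i) p)

end NQManifold

namespace NQBundle

variable {Y : NQManifold.{u} I M} (E : NQBundle.{u, v} (Y.prodBall n) (Y.prodBallQ n))
  {d : ℤ} {s : ∀ p, E.fib p}

/-- The families whose restriction to the part of a cube where some coordinates vanish, with the
differentials of these coordinates equal to zero, is zero. -/
def coordKernel (l : List (Fin n)) : Submodule ℝ (∀ p, E.fib p) where
  carrier := {s | ∀ p ∈ cubeTube M n (2 * cubeUnit n),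
    (∀ i ∈ l, (p.2 : EuclideanSpace ℝ (Fin n)) i = 0) → Y.coordProd l p • s p = 0}
  zero_mem' p _ _ := smul_zero _
  add_mem' hs ht p hp h := by rw [Pi.add_apply, smul_add, hs p hp h, ht p hp h, add_zero]
  smul_mem' r s hs p hp h := by
    rw [Pi.smul_apply]
    refine (smul_algebra_smul_comm r (Y.coordProd l p) (s p)).trans ?_
    rw [hs p hp h, smul_zero]

lemma coordKernel_nil : E.coordKernel [] = E.vanishOn (cubeTube M n (2 * cubeUnit n)) := by
  ext s
  have h : ∀ p, Y.coordProd [] p • s p = s p := fun p => one_smul _ _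
  constructor
  · intro hs p hp
    rw [← h]
    exact hs p hp fun i hi => absurd hi List.not_mem_nil
  · intro hs p hp _
    rw [h, hs p hp]

lemma coordKernel_le_cons (k : Fin n) (l : List (Fin n)) :
    E.coordKernel l ≤ E.coordKernel (k :: l) := by
  intro s hs p hp h
  have h1 := hs p hp fun i hi => h i (List.mem_cons_of_mem _ hi)
  rw [Y.coordProd_cons_smul_apply]
  exact NBundle.smul_smul_eq_zero (Y.coordProd_mem l p) h1 _

lemma coordForm_smul_mem (i : Fin n) (hs : s ∈ E.sections d) :
    Y.coordForm i • s ∈ E.sections (d + 1) := E.bodyDiff_smul_mem (contMDiff_ballCoord i) hs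

lemma coordProd_smul_mem (l : List (Fin n)) (hs : s ∈ E.sections d) :
    Y.coordProd l • s ∈ E.sections (d + l.length) := by
  induction l generalizing s d with
  | nil =>
    rw [Y.coordProd_nil_smul]
    simpa using hs
  | cons i l ih =>
    have h := ih (E.coordForm_smul_mem i hs)
    rw [Y.coordProd_cons_smul]
    convert h using 2
    rw [List.length_cons]
    push_cast
    ring

variable [FiniteDimensional ℝ EM] [IsManifold I ∞ M] [T2Space M] [SigmaCompactSpace M]

lemma lieD_coordProd_smul {k : Fin n} {l : List (Fin n)} (hk : k ∉ l) (hs : s ∈ E.sections d)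
    {V : M × UnitBall n → EuclideanSpace ℝ (Fin n)} (hV : ∀ p, V p = EuclideanSpace.single k 1) :
    E.lieD V (Y.coordProd l • s) = Y.coordProd l • E.lieD V s := by
  obtain rfl : V = fun _ => EuclideanSpace.single k 1 := funext hV
  induction l generalizing s d with
  | nil =>
    rw [Y.coordProd_nil_smul, Y.coordProd_nil_smul]
  | cons i l ih =>
    rw [List.mem_cons, not_or] at hk
    rw [Y.coordProd_cons_smul, Y.coordProd_cons_smul,
      ih hk.2 (E.coordForm_smul_mem i hs)]
    congr 1
    refine E.lieD_bodyDiff_smul (fun _ => contMDiff_const) (contMDiff_ballCoord i) (fun p => ?_) hs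
    rw [ballDeriv_ballCoord, PiLp.single_apply, if_neg (Ne.symm hk.1)]

lemma contract_coordForm_smul (i k : Fin n) {p : M × UnitBall n} (x : E.fib p) :
    E.contract p (EuclideanSpace.single k 1) (Y.coordForm i p • x) =
      (if i = k then x else 0) -
        Y.coordForm i p • E.contract p (EuclideanSpace.single k 1) x := by
  rw [NQManifold.coordForm, E.contract_bodyDiff_smul (contMDiff_ballCoord i), ballDeriv_ballCoord,
    PiLp.single_apply]
  split_ifs
  · rw [one_smul]
  · rw [zero_smul]

lemma contract_coordProd_smul {k : Fin n} {l : List (Fin n)} (hk : k ∉ l) {p : M × UnitBall n}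
    (x : E.fib p) : E.contract p (EuclideanSpace.single k 1) (Y.coordProd l p • x) =
      (-1 : ℝ) ^ l.length • Y.coordProd l p • E.contract p (EuclideanSpace.single k 1) x := by
  induction l generalizing x with
  | nil =>
    have h : ∀ x : E.fib p, Y.coordProd [] p • x = x := fun x => one_smul _ _
    rw [h, h, List.length_nil, pow_zero, one_smul]
  | cons i l ih =>
    rw [List.mem_cons, not_or] at hk
    rw [Y.coordProd_cons_smul_apply, Y.coordProd_cons_smul_apply, ih hk.2,
      E.contract_coordForm_smul, if_neg (Ne.symm hk.1), zero_sub, smul_neg, List.length_cons,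
      pow_succ, mul_neg_one, neg_smul, smul_neg]

variable [I.Boundaryless]

/-- The Poincaré argument along the `k`-th axis, with initial hypersurface `x_k = 0`, after
multiplication by the product `Θ` of the `dx_i` with `i ∈ l`. Since `k ∉ l`, the functions `x_i` are
constant along the segments, so `Θ` commutes with `L` and up to sign with `ι`. The primitive is
divisible by `x_k`, hence restricts to zero. -/
lemma exists_primitive_coordKernel {k : Fin n} {l : List (Fin n)} (hk : k ∉ l)
    (hs : s ∈ E.sections d) (hsk : s ∈ E.coordKernel (k :: l)) (hDs : E.D s ∈ E.coordKernel l) :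
    ∃ u ∈ E.sections (d - 1), u ∈ E.coordKernel (k :: l) ∧ s - E.D u ∈ E.coordKernel l := by
  have h0 : |(0 : ℝ)| < 2 * cubeUnit n := by
    rw [abs_zero]
    linarith [cubeUnit_pos n]
  have hχ := contMDiff_ballCoord (I := I) (M := M) k
  have hρ : (fun p : M × UnitBall n => (lineRegion k 0 h0).ρ p.2) =
      fun p => (p.2 : EuclideanSpace ℝ (Fin n)) k := funext fun p => sub_zero _
  have hK := E.flowK_mem (lineRegion k 0 h0) hs
  have hχK := E.fun_smul_mem hχ hK
  have hDχK := E.D_mem_sections hχK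
  have hs₁ := sub_mem hs hDχK
  obtain ⟨w', hw', hL, hw'0⟩ := E.exists_flow_primitive (lineRegion k 0 h0) hs₁
  rw [hρ] at hL
  have hw := E.fun_smul_mem hχ hw'
  have hz := E.D_mem _ _ hw
  have hΘz := E.coordProd_smul_mem l hz
  have hkey : ∀ p ∈ cubeTube M n (2 * cubeUnit n),
      (∀ i ∈ l, (p.2 : EuclideanSpace ℝ (Fin n)) i = 0) →
      Y.coordProd l p • E.D ((fun p : M × UnitBall n => (p.2 : EuclideanSpace ℝ (Fin n)) k) • w') p
        = 0 := by
    rintro ⟨m, b⟩ hp hb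
    have hflow : ∀ t ∈ Set.Icc (0 : ℝ) 1, ∀ i,
        ((lineRegion k 0 h0).flow t b : EuclideanSpace ℝ (Fin n)) i =
          if i = k then t * b.1 k else b.1 i := fun t ht i => by
      rw [lineRegion_flow_apply h0 hp ht]
      congr 1
      ring
    have hcube : ∀ t ∈ Set.Icc (0 : ℝ) 1,
        (m, (lineRegion k 0 h0).flow t b) ∈ (lineRegion k 0 h0).tube M :=
      fun t ht => (lineRegion k 0 h0).flow_mem_U hp ht
    have hzero : ∀ t ∈ Set.Icc (0 : ℝ) 1, ∀ i ∈ l,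
        ((lineRegion k 0 h0).flow t b : EuclideanSpace ℝ (Fin n)) i = 0 := fun t ht i hi => by
      rw [hflow t ht, if_neg (by rintro rfl; exact hk hi), hb i hi]
    refine E.eq_zero_of_flowD_eq_zero (lineRegion k 0 h0).toBallFlow hΘz
      ((lineRegion k 0 h0).U_subset hp) ?_ fun t ht => ?_
    · have hI := Set.left_mem_Icc.2 (zero_le_one (α := ℝ))
      have hk0 : ((lineRegion k 0 h0).flow 0 b : EuclideanSpace ℝ (Fin n)) k = 0 := by
        rw [hflow 0 hI, if_pos rfl, zero_mul]
      have h1 := hsk (m, (lineRegion k 0 h0).flow 0 b) (hcube 0 hI) fun i hi => by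
        rcases List.mem_cons.1 hi with rfl | hi
        · exact hk0
        · exact hzero 0 hI i hi
      rw [Y.coordProd_cons_smul_apply] at h1
      -- Where `x_k = 0`, the differential of `x_k w'` is `dx_k · w'`, and there `w' = s - dx_k ·
      -- ιs`. As `dx_k` has square zero, only `dx_k · s` remains, whose product with the other
      -- differentials is zero by hypothesis.
      rw [Pi.smul_apply', E.D_fun_smul_apply hχ hw', hw'0 _ (hcube 0 hI)
        ((lineRegion k 0 h0).ρ_flow_zero hp), Pi.sub_apply, E.D_fun_smul_apply hχ hK, hk0, zero_smul,
        zero_smul, add_zero, add_zero, smul_sub, E.bodyDiff_smul_self hχ, sub_zero]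
      exact h1
    · have h1 := E.lieD_coordProd_smul (V := fun p => (lineRegion k 0 h0).V p.2) hk hz
        fun _ => rfl
      have h2 := E.flowD_D_eq (lineRegion k 0 h0) hw hs₁ hL (hcube t ht)
      rw [flowD] at h2
      rw [flowD, h1, Pi.smul_apply', h2, E.D_sub hs hDχK, E.D_D _ _ hχK, sub_zero]
      exact hDs _ (hcube t ht) (hzero t ht)
  have hKw := E.flowK_mem (lineRegion k 0 h0) hw
  refine ⟨_, add_mem hχK hKw, fun p _ h => ?_, fun p hp h => ?_⟩
  · have h1 := h k List.mem_cons_self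
    have h2 : ((fun p : M × UnitBall n => (p.2 : EuclideanSpace ℝ (Fin n)) k) •
        E.flowK (lineRegion k 0 h0) s + E.flowK (lineRegion k 0 h0)
          ((fun p : M × UnitBall n => (p.2 : EuclideanSpace ℝ (Fin n)) k) • w')) p = 0 := by
      rw [contractField_fun_smul, ← smul_add]
      change (p.2 : EuclideanSpace ℝ (Fin n)) k • _ = (0 : E.fib p)
      rw [h1, zero_smul]
    rw [h2, smul_zero]
  -- What remains of `s` after subtracting the differential is `ι(Dw)` for `w = x_k w'`, and moving
  -- `ι` across the product of differentials reduces the claim to `hkey`.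
  · have h1 := hL p hp
    rw [flowD, lieD, Pi.add_apply] at h1
    rw [E.D_add _ _ hχK _ hKw, ← sub_sub, Pi.sub_apply, ← h1, add_sub_cancel_left,
      contractField_apply]
    have h2 := E.contract_coordProd_smul hk
      (E.D ((fun p : M × UnitBall n => (p.2 : EuclideanSpace ℝ (Fin n)) k) • w') p)
    rw [hkey p hp h, map_zero] at h2
    exact (smul_eq_zero_iff_right (pow_ne_zero l.length (by norm_num : (-1 : ℝ) ≠ 0))).1 h2.symm

/-- The coordinates are imposed one after another; each enlargement of the kernel has an acyclic
quotient. -/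
lemma relCohomology_equiv_coordKernel {l : List (Fin n)} (hl : l.Nodup) :
    Nonempty (E.relCohomology ⊤ (E.vanishOn (cubeTube M n (2 * cubeUnit n))) d ≃ₗ[ℝ]
      E.relCohomology ⊤ (E.coordKernel l) d) := by
  induction l with
  | nil =>
    rw [coordKernel_nil]
    exact ⟨LinearEquiv.refl _ _⟩
  | cons k l ih =>
    rw [List.nodup_cons] at hl
    obtain ⟨e⟩ := ih hl.2
    obtain ⟨e'⟩ := E.relCohomology_equiv_right (d := d) (E.coordKernel_le_cons k l)
      fun d s hs h h' => E.exists_primitive_coordKernel hl.1 hs h h'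
    exact ⟨e.trans e'⟩

end NQBundle

end Coordinates

end

noncomputable section

/-! ### Identification with the restriction to the centre -/

section Centre

variable {EM : Type*} [NormedAddCommGroup EM] [NormedSpace ℝ EM] {H : Type*} [TopologicalSpace H]
  {I : ModelWithCorners ℝ EM H} {M : Type*} [TopologicalSpace M] [ChartedSpace H M] {n : ℕ}

namespace NQManifold

variable (Y : NQManifold.{u} I M)

lemma coordForm_eq (i : Fin n) (p : M × UnitBall n) :
    Y.coordForm i p = Y.form n p 1 (Covectors.θ i) := by
  have h := NQBundle.bodyDiff_ballFun (Y := Y)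
    (f := fun x : EuclideanSpace ℝ (Fin n) => x i) (contDiff_piLp_apply (p := 2)) p
  refine h.trans ?_
  rw [Covectors.θ]
  congr 2
  refine LinearMap.ext fun v => ?_
  rw [Covectors.coordBasis_apply]
  exact congrArg (· v) (EuclideanSpace.proj i : EuclideanSpace ℝ (Fin n) →L[ℝ] ℝ).fderiv

lemma augment_coordForm (i : Fin n) (p : M × UnitBall n) :
    Y.augment n p (Y.coordForm i p) = 0 := by
  rw [coordForm_eq, Y.augment_tmul, NManifold.algebraMapInv_eq_zero n one_ne_zero (Covectors.θ_mem i),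
    map_zero, mul_zero]

lemma coordProd_mul_coordForm {i : Fin n} {l : List (Fin n)} (hi : i ∈ l) (p : M × UnitBall n) :
    Y.coordProd l p * Y.coordForm i p = 0 := by
  induction l with
  | nil => exact absurd hi List.not_mem_nil
  | cons k l ih =>
    change Y.coordProd l p * Y.coordForm k p * Y.coordForm i p = 0
    have h := Y.bodyDiff_mul_swap (contMDiff_ballCoord k) (contMDiff_ballCoord i) p
    change Y.coordForm k p * Y.coordForm i p = -(Y.coordForm i p * Y.coordForm k p) at h
    rcases List.mem_cons.1 hi with rfl | hi
    · rw [eq_neg_iff_add_eq_zero, ← two_smul ℝ] at h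
      rw [mul_assoc, (smul_eq_zero_iff_right (two_ne_zero : (2 : ℝ) ≠ 0)).1 h, mul_zero]
    · rw [mul_assoc, h, mul_neg, ← mul_assoc, ih hi, zero_mul, neg_zero]

/-- The product of the differentials of all coordinates annihilates the forms of positive
degree. -/
lemma coordProd_mul_form (p : M × UnitBall n) (y : Y.fib p.1) {k j : ℕ} (hy : y ∈ Y.gr p.1 k)
    {x : Covectors n} (hx : x ∈ Covectors.gr n (j + 1)) :
    Y.coordProd (List.finRange n) p * Y.form n p y x = 0 := by
  rw [Covectors.gr, ExteriorAlgebra.exteriorPower, pow_succ'] at hx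
  induction hx using Submodule.mul_induction_on' with
  | mem_mul_mem m hm x hx =>
    obtain ⟨ξ, rfl⟩ := hm
    have hcov : ∀ z : (Y.prodBall n).fib p, Y.coordProd (List.finRange n) p *
        Y.covectorMul p ξ z = 0 := by
      intro z
      have h1 : ξ = ∑ i, ξ (EuclideanSpace.single i 1) • Covectors.coordBasis n i := by
        refine (EuclideanSpace.basisFun (Fin n) ℝ).toBasis.ext fun j => ?_
        simp [LinearMap.sum_apply, Covectors.coordBasis_apply]
      have h2 : Y.form n p 1 (ExteriorAlgebra.ι ℝ ξ) =
          ∑ i, ξ (EuclideanSpace.single i 1) • Y.coordForm i p := by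
        have h5 : ∀ x : Fin n → Covectors n, Y.form n p 1 (∑ i, x i) = ∑ i, Y.form n p 1 (x i) :=
          fun x => TensorProduct.tmul_sum _ _ _
        conv_lhs => rw [h1, map_sum, h5]
        refine Finset.sum_congr rfl fun i _ => ?_
        rw [map_smul, NManifold.form_smul_right, coordForm_eq]
        rfl
      rw [Y.covectorMul_apply, ← mul_assoc, h2, Finset.mul_sum]
      have h3 : ∀ i, Y.coordProd (List.finRange n) p *
          ξ (EuclideanSpace.single i 1) • Y.coordForm i p = 0 := fun i => by
        rw [mul_smul_comm, Y.coordProd_mul_coordForm (List.mem_finRange i), smul_zero]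
      rw [Finset.sum_eq_zero fun i _ => h3 i, zero_mul]
    -- `covectorMul` applies the parity to the factor from `Y`; starting from the parity of `y`, the
    -- two signs cancel.
    have h := hcov (Y.form n p (parityMap (Y.gr p.1) y) x)
    have h2 : Y.covectorMul p ξ (Y.form n p (parityMap (Y.gr p.1) y) x) =
        Y.form n p y (ExteriorAlgebra.ι ℝ ξ * x) := by
      change Y.form n p (parityMap (Y.gr p.1) (parityMap (Y.gr p.1) y)) _ = _
      rw [parityMap_of_mem _ hy, map_smul, parityMap_of_mem _ hy, smul_smul, ← mul_pow]
      norm_num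
    rwa [h2] at h
  | add x _ x' _ h h' => rw [NManifold.form_add_right, mul_add, h, h', add_zero]

/-- The product of all differentials is a top form on the ball, so only the component of form degree
zero of the other factor survives. -/
lemma coordProd_mul_eq (p : M × UnitBall n) (b : (Y.prodBall n).fib p) :
    Y.coordProd (List.finRange n) p * b =
      Y.coordProd (List.finRange n) p * Y.incl n p (Y.augment n p b) := by
  induction b using Y.form_induction with
  | zero => rw [map_zero, map_zero]
  | add b b' h h' => rw [mul_add, h, h', map_add, map_add, mul_add]
  | form k a ha j x hx =>
    cases j with
    | zero =>
      obtain ⟨r, rfl⟩ := Submodule.mem_one.1 (show x ∈ (1 : Submodule ℝ (Covectors n)) by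
        simpa [Covectors.gr, ExteriorAlgebra.exteriorPower] using hx)
      rw [Y.augment_tmul, AlgHom.commutes, ← Algebra.commutes, ← Algebra.smul_def]
      congr 1
      rw [Algebra.algebraMap_eq_smul_one, NManifold.form_smul_right]
      exact (NManifold.form_smul_left _ _ _ _ _ _).symm
    | succ j =>
      rw [Y.coordProd_mul_form p a ha hx, Y.augment_tmul,
        NManifold.algebraMapInv_eq_zero n (Nat.succ_ne_zero j) hx, map_zero, mul_zero, map_zero, mul_zero]

end NQManifold

namespace NQBundle

variable {Y : NQManifold.{u} I M} (E : NQBundle.{u, v} (Y.prodBall n) (Y.prodBallQ n))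

lemma coordProd_smul_of_mem_centreIdeal {m : M} {x : E.fib (m, UnitBall.centre n)}
    (hx : x ∈ E.centreIdeal m) :
    Y.coordProd (List.finRange n) (m, UnitBall.centre n) • x = 0 := by
  refine Submodule.span_induction
    (p := fun x _ => Y.coordProd (List.finRange n) (m, UnitBall.centre n) • x = 0) ?_ ?_ ?_ ?_ hx
  · rintro _ ⟨a, t, ha, rfl⟩
    rw [← mul_smul, Y.coordProd_mul_eq, ha, map_zero, mul_zero, zero_smul]
  · exact smul_zero _
  · intro x y _ _ hx hy
    rw [smul_add, hx, hy, add_zero]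
  · intro a x _ hx
    exact NBundle.smul_smul_eq_zero (Y.coordProd_mem _ _) hx a

variable [FiniteDimensional ℝ EM] [IsManifold I ∞ M] [T2Space M] [SigmaCompactSpace M]

/-- Contraction with the basis vector `e_k` splits any `x` as `ι(dx_k · x) + dx_k · ιx`. By
induction `dx_k · x` lies in the span for `l`, and `ι` preserves that span because it anticommutes
with the other differentials. -/
lemma mem_span_of_coordProd_smul_eq_zero {l : List (Fin n)} (hl : l.Nodup) {p : M × UnitBall n}
    {x : E.fib p} (hx : Y.coordProd l p • x = 0) :
    x ∈ Submodule.span ℝ {x : E.fib p | ∃ i ∈ l, ∃ t : E.fib p, x = Y.coordForm i p • t} := by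
  induction l generalizing x with
  | nil =>
    have h : Y.coordProd [] p • x = x := one_smul ((Y.prodBall n).fib p) x
    rw [← h, hx]
    exact zero_mem _
  | cons k l ih =>
    rw [List.nodup_cons] at hl
    rw [Y.coordProd_cons_smul_apply] at hx
    have h1 := ih hl.2 hx
    have h2 := E.contract_coordForm_smul k k x
    rw [if_pos rfl, eq_sub_iff_add_eq] at h2
    rw [← h2]
    refine add_mem ?_ (Submodule.subset_span ⟨k, List.mem_cons_self, _, rfl⟩)
    refine Submodule.span_induction (p := fun x _ => E.contract p (EuclideanSpace.single k 1) x ∈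
      Submodule.span ℝ {x : E.fib p | ∃ i ∈ k :: l, ∃ t : E.fib p, x = Y.coordForm i p • t})
      ?_ ?_ ?_ ?_ h1
    · rintro _ ⟨i, hi, t, rfl⟩
      rw [E.contract_coordForm_smul, if_neg (by rintro rfl; exact hl.1 hi), zero_sub]
      exact neg_mem (Submodule.subset_span ⟨i, List.mem_cons_of_mem _ hi, _, rfl⟩)
    · rw [map_zero]
      exact zero_mem _
    · intro x y _ _ hx hy
      rw [map_add]
      exact add_mem hx hy
    · intro r x _ hx
      rw [map_smul]
      exact Submodule.smul_mem _ r hx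

/-- The centre is the only point of the ball with all coordinates zero. There, the submodule
generated by positive form degree is exactly what the product of all differentials annihilates: one
inclusion holds since this is a top form, the other one by `mem_span_of_coordProd_smul_eq_zero`. -/
lemma restrict_eq_zero_iff {s : ∀ p, E.fib p} :
    E.restrict s = 0 ↔ s ∈ E.coordKernel (List.finRange n) := by
  have hcentre : ∀ i, ((UnitBall.centre n : UnitBall n) : EuclideanSpace ℝ (Fin n)) i = 0 :=
    fun i => rfl
  constructor
  · rintro hs ⟨m, b⟩ - hb
    obtain rfl : b = UnitBall.centre n := by
      refine Subtype.ext ?_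
      ext i
      rw [hb i (List.mem_finRange i), hcentre]
    exact E.coordProd_smul_of_mem_centreIdeal (E.centreMk_eq_zero.1 (congrFun hs m))
  · intro hs
    funext m
    refine E.centreMk_eq_zero.2 ?_
    have h1 := hs (m, UnitBall.centre n) (fun i => by
      rw [hcentre, abs_zero]
      linarith [cubeUnit_pos n]) fun i _ => hcentre i
    refine Submodule.span_induction (p := fun x _ => x ∈ E.centreIdeal m) ?_ (zero_mem _)
      (fun x y _ _ hx hy => add_mem hx hy) (fun r x _ hx => ?_)
      (E.mem_span_of_coordProd_smul_eq_zero (List.nodup_finRange n) h1)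
    · rintro _ ⟨i, -, t, rfl⟩
      exact Submodule.subset_span ⟨_, t, Y.augment_coordForm i _, rfl⟩
    · rw [← algebraMap_smul ((Y.prodBall n).fib (m, UnitBall.centre n)) r x]
      exact Submodule.smul_mem _ _ hx

/-- Every section of `E₀` extends to the ball, restriction commutes with the differentials, and its
kernel has just been identified. -/
lemma relCohomology_equiv_restrictCentre {d : ℤ} :
    Nonempty (E.relCohomology ⊤ (E.coordKernel (List.finRange n)) d ≃ₗ[ℝ]
      E.restrictCentre.cohomology d) := by
  have hadd : ∀ s t : ∀ p, E.fib p, E.restrict (s + t) = E.restrict s + E.restrict t :=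
    fun s t => funext fun m => map_add (E.centreMk m) _ _
  have hsub : ∀ s t : ∀ p, E.fib p, E.restrict (s - t) = E.restrict s - E.restrict t :=
    fun s t => funext fun m => map_sub (E.centreMk m) _ _
  have hD : ∀ {d : ℤ} {s : ∀ p, E.fib p}, s ∈ E.sections d →
      E.restrictCentre.D (E.restrict s) = E.restrict (E.D s) := fun hs => E.centreD_restrict hs
  refine Submodule.nonempty_quotient_equiv (fun s => E.restrict s) (fun z hz => ?_)
    (fun z _ w _ => hadd z w)
    (fun r z _ => funext fun m => map_smul (E.centreMk m) r _) (fun z hz => ?_) fun z hz => ?_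
  · exact ⟨E.restrict_mem hz.1, trivial, (hD hz.1).trans (E.restrict_eq_zero_iff.2 hz.2.2)⟩
  · constructor
    · rintro ⟨u, hu, -, h⟩
      obtain ⟨w, hw, rfl⟩ := E.exists_restrict_eq hu
      refine ⟨w, hw, trivial, E.restrict_eq_zero_iff.1 ?_⟩
      rw [hsub]
      exact sub_eq_zero.2 (h.symm.trans (hD hw))
    · rintro ⟨w, hw, -, h⟩
      refine ⟨E.restrict w, E.restrict_mem hw, trivial, (hD hw).trans ?_⟩
      have h1 := E.restrict_eq_zero_iff.2 h
      rw [hsub, sub_eq_zero] at h1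
      exact h1.symm
  · obtain ⟨s, hs, rfl⟩ := E.exists_restrict_eq hz.1
    refine ⟨s, ⟨hs, trivial, E.restrict_eq_zero_iff.1 ((hD hs).symm.trans hz.2.2)⟩, ?_⟩
    have h0 : E.restrict s - E.restrict s = 0 := sub_self _
    exact (congrArg (· ∈ E.restrictCentre.coboundaries ⊤ d) h0).mpr (zero_mem _)

end NQBundle

end Centre

end

/-! ### The isomorphism -/

theorem lemma1 {EM : Type*} [NormedAddCommGroup EM] [NormedSpace ℝ EM] [FiniteDimensional ℝ EM]
    {H : Type*} [TopologicalSpace H] (I : ModelWithCorners ℝ EM H) [I.Boundaryless]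
    {M : Type*} [TopologicalSpace M] [ChartedSpace H M] [IsManifold I ∞ M] [T2Space M]
    [SigmaCompactSpace M] (Y : NQManifold.{u} I M) (n : ℕ)
    (E : NQBundle.{u, v} (Y.prodBall n) (Y.prodBallQ n)) (d : ℤ) :
    Nonempty (E.cohomologyIn E.vanishOnSphere (d + n) ≃ₗ[ℝ] E.restrictCentre.cohomology d) := by
  obtain ⟨e₁⟩ := E.cohomologyIn_equiv (A := E.vanishOnSphere) (d := d + n)
  obtain ⟨e₂⟩ := E.relCohomology_equiv_sphere (d := d + n)
  obtain ⟨e₃⟩ := E.relCohomology_equiv_offCube (d := d + n)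
  obtain ⟨e₄⟩ := E.relCohomology_equiv_collar_zero (d := d)
  obtain ⟨e₅⟩ := E.relCohomology_equiv_coordKernel (d := d) (List.nodup_finRange n)
  obtain ⟨e₆⟩ := E.relCohomology_equiv_restrictCentre (d := d)
  exact ⟨((((e₁.trans e₂.symm).trans e₃).trans e₄.symm).trans e₅).trans e₆⟩
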